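/- Let $L\ge 1$, $\alpha>0$, and let $\rho$ be a probability law on $\mathbb{R}_+^L=[0,\infty)^L$, the law of a weight vector $\mathbf W=(W_1,\dots,W_L)$. Assume: (i) (Multivariate regular variation.) There are a regularly varying function $b$ of index $1/\alpha$ and a non-zero Borel measure $\nu$ on $\mathbb{R}_+^L\setminus\{\mathbf 0\}$, finite on sets bounded away from $\mathbf 0$, such that $t\,\mathbb{E} f(\mathbf W/b(t))\to\int f\,d\nu$ as $t\to\infty$ for every bounded continuous $f\ge 0$ on $\mathbb{R}_+^L\setminus\{\mathbf 0\}$ whose support is bounded away from $\mathbf 0$. (ii) Every marginal tail $x\mapsto\mathbb{P}(W_l>x)$ is regularly varying with index $-\alpha$. Let $\mathbf W_1,\mathbf W_2,\dots$ be i.i.d. with law $\rho$, $\mathbf W_i=(W_{i1},\dots,W_{iL})$, and $T_l(N)=\sum_{i=1}^N W_{il}$. For each $N$ let $(A_{ijl})_{i,j\le N,\,l\le L}$ be symmetric in $(i,j)$ and, conditionally on $\mathbf W_1,\dots,\mathbf W_N$, let the $A_{ijl}$ with $i\le j$ be independent and Poisson with parameter $g_l\big(W_{il}W_{jl}/T_l(N)\big)$.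 The connection functions $g_l:[0,\infty)\to[0,\infty)$ are measurable with $\sup_{x>0}g_l(x)/x<\infty$ and $\lim_{x\downarrow0}g_l(x)/x=1$; if $\alpha\le 1$, they are also concave (for instance $g_l(x)=x$, $1-e^{-x}$, $\min(x,1)$, $x/(1+x)$). Let $D_{il}(N)=\sum_{j=1}^N A_{ijl}$, and let $(t_N)$ be a sequence of positive integers with $t_N\to\infty$ and $t_N/N\to0$. Let $\hat u_{l,N}=\inf\{x: \hat G_{l,N}(x)\ge 1-t_N/N\}$ with $\hat G_{l,N}(x)=\frac1N\#\{i\le N: D_{il}(N)\le x\}$. For two layers $s,m$ put $$\hat\lambda^{s,m}_{D(N)}=\frac{\#\{i\le N: D_{is}(N)>\hat u_{s,N},\ D_{im}(N)>\hat u_{m,N}\}}{\#\{i\le N: D_{is}(N)>\hat u_{s,N}\}}\qquad(0/0:=0).$$ Let $F_l$ be the distribution function of $W_l$, let $F_l^{-1}(q)=\inf\{x:F_l(x)\ge q\}$, and let $$\lambda_U^{s,m}=\lim_{q\to1^-}\mathbb{P}\big(W_m>F_m^{-1}(q)\,\big|\,W_s>F_s^{-1}(q)\big)$$ be the upper tail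 dependence coefficient, when this limit exists. Let $C_{s,m}$ be a copula of $(W_s,W_m)$, i.e. $\mathbb{P}(W_s\le x,W_m\le y)=C_{s,m}(F_s(x),F_m(y))$ for all $x,y$. Then: 1. $\lambda_U^{s,m}$ exists if and only if $\lim_{q\to1^-}\frac{1-2q+C_{s,m}(q,q)}{1-q}$ exists; in that case the two are equal and, as $N\to\infty$, $$\hat\lambda^{s,m}_{D(N)}\stackrel{p}{\longrightarrow}\lambda_U^{s,m}=\lim_{q\to1^-}\frac{1-2q+C_{s,m}(q,q)}{1-q}.$$ 2. The limit $\lambda_U^{s,m}$ exists whenever $\nu\{x:x_s>1\}>0$ and $\nu\{x:x_m>1\}>0$. 3. If $C_{s,m}$ is the Gumbel copula $C_\theta(u,v)=\exp\big(-((-\ln u)^{\theta}+(-\ln v)^{\theta})^{1/\theta}\big)$ with $\theta=\theta_{s,m}\ge1$, then $\lambda_U^{s,m}$ exists and $\hat\lambda^{s,m}_{D(N)}\stackrel{p}{\longrightarrow}\lambda_U^{s,m}=2-2^{1/\theta_{s,m}}$. -/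

import Mathlib

open MeasureTheory ProbabilityTheory Filter Topology
open scoped NNReal ENNReal

noncomputable section

/-- `f : ℝ₊ → ℝ₊` is regularly varying (at infinity) with index `r`. -/
structure IsRegularlyVarying (f : ℝ≥0 → ℝ≥0) (r : ℝ) : Prop where
  measurable : Measurable f
  eventually_pos : ∀ᶠ t in atTop, 0 < f t
  tendsto : ∀ x : ℝ≥0, 0 < x → Tendsto (fun t => f (t * x) / f t) atTop (𝓝 (x ^ r))

/-- The class `𝕄(ℝ₊ᴸ ∖ {0})`: Borel measures on `ℝ₊ᴸ ∖ {0}` (seen as measures on `ℝ₊ᴸ` without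
mass at the origin) that are finite on sets bounded away from the origin. -/
structure IsMMeasure {L : ℕ} (ν : Measure (Fin L → ℝ≥0)) : Prop where
  zero : ν {0} = 0
  finite_away : ∀ ε : ℝ, 0 < ε → ν {x | ε ≤ dist x 0} < ∞

/-- The test functions of `𝕄`-convergence: nonnegative, bounded, continuous on `ℝ₊ᴸ ∖ {0}`, with
support bounded away from the origin. -/
structure IsMTest {L : ℕ} (f : (Fin L → ℝ≥0) → ℝ≥0) : Prop where
  continuousOn : ContinuousOn f {0}ᶜ
  bounded : ∃ K : ℝ≥0, ∀ x, f x ≤ K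
  away : ∃ ε : ℝ, 0 < ε ∧ ∀ x, f x ≠ 0 → ε ≤ dist x 0

/-- Multivariate regular variation `MRV(α, b, ν, ℝ₊ᴸ ∖ {0})` of a law `ρ` on `ℝ₊ᴸ`:
`t · P(Z / b(t) ∈ ·) → ν` in `𝕄(ℝ₊ᴸ ∖ {0})` as `t → ∞`, with `ν` not the zero measure. -/
structure IsMRV {L : ℕ} (ρ : Measure (Fin L → ℝ≥0)) (α : ℝ) (b : ℝ≥0 → ℝ≥0)
    (ν : Measure (Fin L → ℝ≥0)) : Prop where
  scaling : IsRegularlyVarying b (1 / α)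
  limit : IsMMeasure ν
  nonzero : ν ≠ 0
  tendsto : ∀ f : (Fin L → ℝ≥0) → ℝ≥0, IsMTest f →
    Tendsto (fun t : ℝ≥0 => (t : ℝ≥0∞) * ∫⁻ z, (f (fun l => z l / b t) : ℝ≥0∞) ∂ρ) atTop
      (𝓝 (∫⁻ x, (f x : ℝ≥0∞) ∂ν))

/-- The tail function `x ↦ P(W_l > x)` of the `l`-th coordinate. -/
def marginalTail {L : ℕ} (ρ : Measure (Fin L → ℝ≥0)) (l : Fin L) (x : ℝ≥0) : ℝ≥0 :=
  (ρ {w | x < w l}).toNNReal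

/-- The distribution function `F_l` of the `l`-th coordinate. -/
def marginalCDF {L : ℕ} (ρ : Measure (Fin L → ℝ≥0)) (l : Fin L) (x : ℝ) : ℝ :=
  cdf (ρ.map (fun w => (w l : ℝ))) x

/-- The generalized inverse `F⁻¹(q) = inf {x : q ≤ F(x)}`. -/
def quantile (F : ℝ → ℝ) (q : ℝ) : ℝ := sInf {x : ℝ | q ≤ F x}

/-- `λ(q) = P(W_m > F_m⁻¹(q) | W_s > F_s⁻¹(q))`. -/
def utd {L : ℕ} (ρ : Measure (Fin L → ℝ≥0)) (s m : Fin L) (q : ℝ) : ℝ :=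
  (ProbabilityTheory.cond ρ {w | quantile (marginalCDF ρ s) q < (w s : ℝ)}).real
    {w | quantile (marginalCDF ρ m) q < (w m : ℝ)}

/-- `lam` is the upper tail dependence coefficient of the coordinates `s` and `m`. -/
def IsUTDCoeff {L : ℕ} (ρ : Measure (Fin L → ℝ≥0)) (s m : Fin L) (lam : ℝ) : Prop :=
  Tendsto (utd ρ s m) (𝓝[<] 1) (𝓝 lam)

/-- `C` restricted to `[0,1]²` is a bivariate copula. -/
structure IsCopula (C : ℝ → ℝ → ℝ) : Prop where
  zero_left : ∀ v ∈ Set.Icc (0 : ℝ) 1, C 0 v = 0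
  zero_right : ∀ u ∈ Set.Icc (0 : ℝ) 1, C u 0 = 0
  one_left : ∀ v ∈ Set.Icc (0 : ℝ) 1, C 1 v = v
  one_right : ∀ u ∈ Set.Icc (0 : ℝ) 1, C u 1 = u
  two_increasing : ∀ u ∈ Set.Icc (0 : ℝ) 1, ∀ u' ∈ Set.Icc (0 : ℝ) 1,
    ∀ v ∈ Set.Icc (0 : ℝ) 1, ∀ v' ∈ Set.Icc (0 : ℝ) 1, u ≤ u' → v ≤ v' →
      0 ≤ C u' v' - C u' v - C u v' + C u v

/-- `C` is a copula of the coordinates `s` and `m`: `P(W_s ≤ x, W_m ≤ y) = C(F_s(x), F_m(y))`. -/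
structure IsPairCopula {L : ℕ} (ρ : Measure (Fin L → ℝ≥0)) (s m : Fin L) (C : ℝ → ℝ → ℝ) :
    Prop where
  copula : IsCopula C
  sklar : ∀ x y : ℝ, ρ.real {w | (w s : ℝ) ≤ x ∧ (w m : ℝ) ≤ y} =
    C (marginalCDF ρ s x) (marginalCDF ρ m y)

/-- The bivariate Gumbel copula on `[0,1]²`; it vanishes where a coordinate is `0`, by the
convention `-ln 0 = ∞`. -/
def gumbel (θ : ℝ) (u v : ℝ) : ℝ :=
  if u = 0 ∨ v = 0 then 0
  else Real.exp (-(((-Real.log u) ^ θ + (-Real.log v) ^ θ) ^ (1 / θ)))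

/-- Connection functions: `g(x) = O(x)` on `ℝ₊` and `g(x) ~ x` at the origin; in the heavy regime
`α ≤ 1` also concave. -/
structure IsConnectionFun (α : ℝ) (g : ℝ≥0 → ℝ≥0) : Prop where
  measurable : Measurable g
  linear_bound : ∃ K : ℝ≥0, ∀ x, g x ≤ K * x
  tendsto_one : Tendsto (fun x => g x / x) (𝓝[>] 0) (𝓝 1)
  concave : α ≤ 1 → ConcaveOn ℝ≥0 Set.univ g

/-- The Poisson parameter `g_l(W_il W_jl / T_l(N))`, where `T_l(N) = ∑ᵢ W_il`. -/
def edgeRate {L N : ℕ} (g : Fin L → ℝ≥0 → ℝ≥0) (w : Fin N → Fin L → ℝ≥0) (i j : Fin N)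
    (l : Fin L) : ℝ≥0 :=
  g l (w i l * w j l / ∑ k, w k l)

/-- `A` is the adjacency tensor of the `L`-layer inhomogeneous random graph on `N` nodes with
weights `W`: it is symmetric in each layer and, conditionally on `W`, the entries `A_ijl` with
`i ≤ j` are independent with Poisson laws of parameters `edgeRate g W i j l`. The conditional law
is expressed by the joint law of `(A, W)`. -/
structure IsMIRG {Ω : Type*} [MeasurableSpace Ω] (μ : Measure Ω) {L N : ℕ}
    (g : Fin L → ℝ≥0 → ℝ≥0) (W : Fin N → Ω → Fin L → ℝ≥0)
    (A : Fin N → Fin N → Fin L → Ω → ℕ) : Prop where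
  measurable : ∀ i j l, Measurable (A i j l)
  symm : ∀ i j l ω, A i j l ω = A j i l ω
  cond_law : ∀ B : Set (Fin N → Fin L → ℝ≥0), MeasurableSet B →
    ∀ k : Fin N → Fin N → Fin L → ℕ,
      μ {ω | (fun i => W i ω) ∈ B ∧ ∀ i j l, i ≤ j → A i j l ω = k i j l} =
        ∫⁻ ω in {ω | (fun i => W i ω) ∈ B},
          ∏ i, ∏ j ∈ Finset.univ.filter (fun j => i ≤ j), ∏ l,
            poissonMeasure (edgeRate g (fun i => W i ω) i j l) {k i j l} ∂μ

/-- The degree `D_il(N) = ∑ⱼ A_ijl`. -/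
def degree {L N : ℕ} (a : Fin N → Fin N → Fin L → ℕ) (i : Fin N) (l : Fin L) : ℕ :=
  ∑ j, a i j l

/-- The empirical distribution function of the degrees in layer `l`. -/
def empiricalCDF {L N : ℕ} (a : Fin N → Fin N → Fin L → ℕ) (l : Fin L) (x : ℝ) : ℝ :=
  ((Finset.univ.filter (fun i => (degree a i l : ℝ) ≤ x)).card : ℝ) / N

/-- The empirical `(1 - t/N)`-quantile of the degrees in layer `l`. -/
def degreeThreshold {L N : ℕ} (a : Fin N → Fin N → Fin L → ℕ) (t : ℕ) (l : Fin L) : ℝ :=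
  quantile (empiricalCDF a l) (1 - (t : ℝ) / N)

/-- The degree-based estimator of the upper tail dependence coefficient of layers `s` and `m`. -/
def utdEstimator {L N : ℕ} (a : Fin N → Fin N → Fin L → ℕ) (t : ℕ) (s m : Fin L) : ℝ :=
  ((Finset.univ.filter (fun i => degreeThreshold a t s < (degree a i s : ℝ) ∧
      degreeThreshold a t m < (degree a i m : ℝ))).card : ℝ) /
    ((Finset.univ.filter (fun i => degreeThreshold a t s < (degree a i s : ℝ))).card : ℝ)

end

/-!
Conditionally on the weights, the degree of a node is Poisson. Once the conditional mean degrees of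
the nodes of weight at most `u` and of the nodes of weight above `v = (1 + δ) u` lie on different
sides of a common threshold `κ`, by a constant factor, Chernoff's bound shows that few nodes are
ranked wrongly by their degree, the error probability `exp (-κ c)` being beaten by the polynomial
tail. Hence the nodes whose degree exceeds the empirical quantile and the nodes whose weight
exceeds the quantile of `W_l` differ by `o(t_N)` nodes in probability, and the estimator behaves
like the proportion of joint weight exceedances, to which the law of large numbers applies.

If the weights have a finite mean, the mean degree of a node is close to its weight by the law of
large numbers. If not, then `α ≤ 1`, the mean degree is a sum of concave rates `g_l (x w / T)`, and
regular variation of the tail makes its expectation grow by a constant factor with `x`.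

In terms of the copula, `λ_U` has the stated form because `P (W_l > F_l⁻¹ (q)) / (1 - q) → 1` and
copulas are Lipschitz. Under multivariate regular variation, the tails rescaled to have margins
`1 / t` converge; for the Gumbel copula the limit is `2` minus the derivative of `q ^ 2 ^ (1 / θ)`
at `1`.
-/

section Poisson

lemma integrable_exp_mul_poissonMeasure (r : ℝ≥0) (s : ℝ) :
    Integrable (fun n : ℕ => Real.exp (s * n)) (poissonMeasure r) := by
  rw [integrable_poissonMeasure_iff]
  have h := (NormedSpace.expSeries_div_hasSum_exp ((r : ℝ) * Real.exp s)).summable.mul_left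
    (Real.exp (-r))
  refine h.congr fun n => ?_
  rw [Real.norm_of_nonneg (Real.exp_pos _).le, mul_pow, ← Real.exp_nat_mul, mul_comm (n : ℝ) s]
  ring

lemma mgf_cast_poissonMeasure (r : ℝ≥0) (s : ℝ) :
    mgf (fun n : ℕ => (n : ℝ)) (poissonMeasure r) s = Real.exp (r * (Real.exp s - 1)) := by
  have h := (NormedSpace.expSeries_div_hasSum_exp ((r : ℝ) * Real.exp s)).mul_left
    (Real.exp (-r))
  rw [← Real.exp_eq_exp_ℝ, ← Real.exp_add] at h
  rw [mgf, integral_poissonMeasure,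
    show (r : ℝ) * (Real.exp s - 1) = -r + r * Real.exp s by ring, ← h.tsum_eq]
  congr with n
  rw [mul_pow, ← Real.exp_nat_mul, mul_comm (n : ℝ) s, smul_eq_mul]
  ring

lemma hasLaw_sum_poissonMeasure {Ω ι : Type*} [MeasurableSpace Ω] {μ : Measure Ω}
    [IsProbabilityMeasure μ] {X : ι → Ω → ℕ} {r : ι → ℝ≥0}
    (hX : ∀ i, HasLaw (X i) (poissonMeasure (r i)) μ) (hind : iIndepFun X μ) (s : Finset ι) :
    HasLaw (∑ i ∈ s, X i) (poissonMeasure (∑ i ∈ s, r i)) μ := by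
  classical
  induction s using Finset.induction_on with
  | empty =>
    have poisson_zero : poissonMeasure 0 = Measure.dirac 0 := by
      refine Measure.ext_of_singleton fun n => ?_
      cases n <;> simp [poissonMeasure_singleton]
    rw [Finset.sum_empty, Finset.sum_empty, poisson_zero]
    refine ⟨aemeasurable_const, ?_⟩
    rw [Pi.zero_def, Measure.map_const, measure_univ, one_smul]
  | insert i s hi ih =>
    rw [Finset.sum_insert hi, Finset.sum_insert hi]
    exact ((hind.indepFun_finsetSum_of_notMem₀ (fun i => (hX i).aemeasurable)
      hi).symm).hasLaw_add_poissonMeasure (hX i) ih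

/-- A common exponential rate in Chernoff's bounds for the two tails of a Poisson law beyond a
threshold which differs from the mean by the factor `1 + c`. -/
noncomputable def poissonRate (c : ℝ) : ℝ :=
  min (Real.log (1 + c) - c / (1 + c)) (c - Real.log (1 + c))

lemma one_sub_inv_one_add {c : ℝ} (hc : 0 < c) : 1 - (1 + c)⁻¹ = c / (1 + c) := by
  field_simp
  ring

lemma poissonRate_pos {c : ℝ} (hc : 0 < c) : 0 < poissonRate c := by
  refine lt_min ?_ ?_
  · have h := Real.log_lt_sub_one_of_pos (x := (1 + c)⁻¹) (by positivity)
      (by rw [Ne, inv_eq_one]; linarith)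
    rw [Real.log_inv] at h
    linarith [one_sub_inv_one_add hc]
  · linarith [Real.log_lt_sub_one_of_pos (x := 1 + c) (by linarith) (by linarith)]

variable {r : ℝ≥0} {c κ : ℝ}

lemma poissonMeasure_gt_le (hc : 0 < c) (h : r * (1 + c) ≤ κ) :
    (poissonMeasure r).real {n | κ < (n : ℝ)} ≤ Real.exp (-(κ * poissonRate c)) := by
  have hκ : 0 ≤ κ := le_trans (by positivity) h
  have chernoff := measure_ge_le_exp_mul_mgf κ (Real.log_nonneg (by linarith : 1 ≤ 1 + c))
    (integrable_exp_mul_poissonMeasure r _)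
  rw [mgf_cast_poissonMeasure, ← Real.exp_add, Real.exp_log (by linarith)] at chernoff
  have hmono : (poissonMeasure r).real {n | κ < (n : ℝ)} ≤
      (poissonMeasure r).real {n | κ ≤ (n : ℝ)} :=
    measureReal_mono fun n hn => le_of_lt (Set.mem_ofPred_eq ▸ hn)
  refine hmono.trans (chernoff.trans (Real.exp_le_exp.2 ?_))
  have hrc : r * c ≤ κ * (c / (1 + c)) := by
    rw [mul_div_assoc', le_div_iff₀ (by linarith)]
    nlinarith
  have hrate : κ * poissonRate c ≤ κ * (Real.log (1 + c) - c / (1 + c)) := by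
    gcongr
    exact min_le_left _ _
  linarith

lemma poissonMeasure_le_le (hc : 0 < c) (h : κ * (1 + c) ≤ r) :
    (poissonMeasure r).real {n | (n : ℝ) ≤ κ} ≤ Real.exp (-(κ * poissonRate c)) := by
  rcases lt_or_ge κ 0 with hκ | hκ
  · have hempty : {n : ℕ | (n : ℝ) ≤ κ} = ∅ :=
      Set.eq_empty_of_forall_notMem fun n hn => (hκ.trans_le n.cast_nonneg).not_ge hn
    rw [hempty, measureReal_empty]
    exact (Real.exp_pos _).le
  have chernoff := measure_le_le_exp_mul_mgf κ
    (neg_nonpos.2 (Real.log_nonneg (by linarith : 1 ≤ 1 + c)))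
    (integrable_exp_mul_poissonMeasure r _)
  rw [mgf_cast_poissonMeasure, ← Real.exp_add, Real.exp_neg, Real.exp_log (by linarith)] at chernoff
  refine chernoff.trans ?_
  have hrc : κ * c ≤ r * (c / (1 + c)) := by
    rw [mul_div_assoc', le_div_iff₀ (by linarith)]
    nlinarith
  have hrate : κ * poissonRate c ≤ κ * (c - Real.log (1 + c)) := by
    gcongr
    exact min_le_right _ _
  have hinv := one_sub_inv_one_add hc
  gcongr
  nlinarith

end Poisson

section Separation

/-- The conditional mean degree of node `i`, given the weights `x` of the nodes, in a single layer
with connection function `G`. -/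
noncomputable def meanDegree {N : ℕ} (G : ℝ≥0 → ℝ≥0) (x : Fin N → ℝ≥0) (i : Fin N) : ℝ≥0 :=
  ∑ j, G (x i * x j / ∑ k, x k)

/-- The threshold `κ ≥ κmin` separates the conditional mean degrees of the nodes of weight at most
`u` from those of the nodes of weight above `v`, with a factor `1 + c` to spare on both sides. -/
def IsSeparated {N : ℕ} (G : ℝ≥0 → ℝ≥0) (u v c κmin κ : ℝ) (x : Fin N → ℝ≥0) : Prop :=
  κmin ≤ κ ∧ ∀ i, ((x i : ℝ) ≤ u → meanDegree G x i * (1 + c) ≤ κ) ∧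
    (v < (x i : ℝ) → κ * (1 + c) ≤ meanDegree G x i)

/-- A node of weight `x` and degree `d` is misclassified by the degree threshold `κ` if its weight
is at most `u` but `d` exceeds `κ`, or its weight is above `v` but `d` does not exceed `κ`. -/
def IsMisclassified (u v κ : ℝ) (x : ℝ≥0) (d : ℕ) : Prop :=
  ((x : ℝ) ≤ u ∧ κ < d) ∨ (v < (x : ℝ) ∧ (d : ℝ) ≤ κ)

lemma poissonMeasure_isMisclassified_le {r x : ℝ≥0} {u v c κmin κ : ℝ} (hc : 0 < c) (huv : u ≤ v)
    (hκ : κmin ≤ κ) (hlow : (x : ℝ) ≤ u → r * (1 + c) ≤ κ)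
    (hhigh : v < (x : ℝ) → κ * (1 + c) ≤ r) :
    poissonMeasure r {d | IsMisclassified u v κ x d} ≤
      ENNReal.ofReal (Real.exp (-(κmin * poissonRate c))) := by
  rw [← ofReal_measureReal]
  refine ENNReal.ofReal_le_ofReal (le_trans ?_ (Real.exp_le_exp.2 (neg_le_neg
    (mul_le_mul_of_nonneg_right hκ (poissonRate_pos hc).le))))
  rcases le_or_gt (x : ℝ) u with hxu | hxu
  · refine (measureReal_mono ?_).trans (poissonMeasure_gt_le hc (hlow hxu))
    rintro d (hd | hd)
    exacts [hd.2, absurd hd.1 (hxu.trans huv).not_gt]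
  rcases le_or_gt (x : ℝ) v with hxv | hxv
  · have hempty : {d | IsMisclassified u v κ x d} = ∅ := by
      simp [IsMisclassified, hxu.not_ge, hxv.not_gt]
    rw [hempty, measureReal_empty]
    exact (Real.exp_pos _).le
  · refine (measureReal_mono ?_).trans (poissonMeasure_le_le hc (hhigh hxv))
    rintro d (hd | hd)
    exacts [absurd hd.1 hxu.not_ge, hd.2]

lemma measurable_meanDegree {N : ℕ} {G : ℝ≥0 → ℝ≥0} (hG : Measurable G) (i : Fin N) :
    Measurable fun x : Fin N → ℝ≥0 => meanDegree G x i :=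
  Finset.measurable_fun_sum _ fun j _ => hG.comp (by fun_prop)

lemma measurableSet_isSeparated {N : ℕ} {G : ℝ≥0 → ℝ≥0} (hG : Measurable G) (u v c κmin : ℝ)
    {κ : (Fin N → ℝ≥0) → ℝ} (hκ : Measurable κ) :
    MeasurableSet {x | IsSeparated G u v c κmin (κ x) x} := by
  have hmean := fun i : Fin N => (measurable_meanDegree hG i).coe_nnreal_real
  have hcoord := fun i : Fin N => (measurable_pi_apply (X := fun _ => ℝ≥0) i).coe_nnreal_real
  simp only [IsSeparated, Set.ofPred_and, Set.ofPred_forall]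
  exact (measurableSet_le measurable_const hκ).inter <| MeasurableSet.iInter fun i =>
    ((measurableSet_le (hcoord i) measurable_const).imp
      (measurableSet_le ((hmean i).mul_const _) hκ)).inter
    ((measurableSet_lt measurable_const (hcoord i)).imp
      (measurableSet_le (hκ.mul_const _) (hmean i)))

end Separation

section CountableKernel

variable {E F : Type*} [MeasurableSpace E] [MeasurableSpace F] [Countable F]
  [MeasurableSingletonClass F]

lemma measurable_measure_of_singleton {κ : E → Measure F}
    (hκ : ∀ k, Measurable fun x => κ x {k}) : Measurable κ := by
  refine Measure.measurable_of_measurable_coe _ fun s hs => ?_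
  simp only [← Measure.tsum_indicator_apply_singleton _ s hs]
  refine Measurable.tsum fun k => ?_
  by_cases hk : k ∈ s
  · simpa only [Set.indicator_of_mem hk] using hκ k
  · simpa only [Set.indicator_of_notMem hk] using measurable_const

lemma eq_compProd_of_singleton {ν : Measure E} [SFinite ν] {κ : Kernel E F} [IsSFiniteKernel κ]
    {ρ : Measure (E × F)}
    (h : ∀ B, MeasurableSet B → ∀ k, ρ (B ×ˢ {k}) = ∫⁻ x in B, κ x {k} ∂ν) : ρ = ν ⊗ₘ κ := by
  ext s hs
  have slice_meas : ∀ k, MeasurableSet ((fun x : E => (x, k)) ⁻¹' s) := fun k =>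
    measurable_prodMk_right hs
  have hunion : s = ⋃ k, ((fun x : E => (x, k)) ⁻¹' s) ×ˢ {k} := by
    ext ⟨x, k⟩
    simp
  have hdisj : Pairwise
      (Function.onFun Disjoint fun k : F => ((fun x : E => (x, k)) ⁻¹' s) ×ˢ {k}) :=
    fun k k' hkk' => Set.disjoint_prod.2 (Or.inr (Set.disjoint_singleton.2 hkk'))
  have hmeas := fun k => (slice_meas k).prod (measurableSet_singleton k)
  rw [hunion, measure_iUnion hdisj hmeas, measure_iUnion hdisj hmeas]
  exact tsum_congr fun k => by
    rw [h _ (slice_meas k), Measure.compProd_apply_prod (slice_meas k) (measurableSet_singleton k)]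

end CountableKernel

section Graph

variable {L N : ℕ}

/-- The places `(i, j, l)` with `i ≤ j` of the independent entries of an adjacency tensor. -/
abbrev EdgeSlot (N L : ℕ) := {p : Fin N × Fin N × Fin L // p.1 ≤ p.2.1}

/-- The slot of the unordered pair `{i, j}` in layer `l`. -/
def edgeSlot (i j : Fin N) (l : Fin L) : EdgeSlot N L := ⟨(min i j, max i j, l), min_le_max⟩

lemma edgeSlot_of_le {i j : Fin N} (h : i ≤ j) (l : Fin L) : edgeSlot i j l = ⟨(i, j, l), h⟩ := by
  simp [edgeSlot, h]

lemma edgeSlot_comm (i j : Fin N) (l : Fin L) : edgeSlot i j l = edgeSlot j i l := by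
  simp only [edgeSlot, min_comm, max_comm]

lemma edgeSlot_right_injective (i : Fin N) (l : Fin L) :
    Function.Injective fun j => edgeSlot i j l := by
  intro j j' h
  obtain ⟨hmin, hmax⟩ : min i j = min i j' ∧ max i j = max i j' := by
    simpa [edgeSlot] using h
  rcases le_total i j with hj | hj <;> rcases le_total i j' with hj' | hj' <;>
    simp only [min_eq_left, min_eq_right, max_eq_left, max_eq_right, *] at hmin hmax <;> order

/-- The entries of a symmetric adjacency tensor that determine it. -/
def slotEntries (a : Fin N → Fin N → Fin L → ℕ) (p : EdgeSlot N L) : ℕ := a p.1.1 p.1.2.1 p.1.2.2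

/-- The symmetric adjacency tensor with prescribed entries in the slots. -/
def tensorOfSlots (k : EdgeSlot N L → ℕ) (i j : Fin N) (l : Fin L) : ℕ := k (edgeSlot i j l)

lemma slotEntries_tensorOfSlots (k : EdgeSlot N L → ℕ) : slotEntries (tensorOfSlots k) = k := by
  ext ⟨⟨i, j, l⟩, h⟩
  exact congrArg k (edgeSlot_of_le h l)

lemma tensorOfSlots_slotEntries {a : Fin N → Fin N → Fin L → ℕ}
    (ha : ∀ i j l, a i j l = a j i l) : tensorOfSlots (slotEntries a) = a := by
  ext i j l
  rcases le_total i j with h | h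
  · rw [tensorOfSlots, edgeSlot_of_le h, slotEntries]
  · rw [tensorOfSlots, edgeSlot_comm, edgeSlot_of_le h, slotEntries, ha]

lemma slotEntries_eq_iff {a : Fin N → Fin N → Fin L → ℕ} {k : EdgeSlot N L → ℕ} :
    slotEntries a = k ↔ ∀ i j l, i ≤ j → a i j l = tensorOfSlots k i j l := by
  constructor
  · rintro rfl i j l h
    rw [tensorOfSlots, edgeSlot_of_le h, slotEntries]
  · intro h
    ext ⟨⟨i, j, l⟩, hij⟩
    rw [slotEntries, h i j l hij, tensorOfSlots, edgeSlot_of_le]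

/-- The law of the independent Poisson edge multiplicities, given the weights `w`. -/
noncomputable def edgeLaw (g : Fin L → ℝ≥0 → ℝ≥0) (w : Fin N → Fin L → ℝ≥0) :
    Measure (EdgeSlot N L → ℕ) :=
  Measure.pi fun p => poissonMeasure (edgeRate g w p.1.1 p.1.2.1 p.1.2.2)

instance (g : Fin L → ℝ≥0 → ℝ≥0) (w : Fin N → Fin L → ℝ≥0) :
    IsProbabilityMeasure (edgeLaw g w) :=
  inferInstanceAs (IsProbabilityMeasure (Measure.pi fun p : EdgeSlot N L =>
    poissonMeasure (edgeRate g w p.1.1 p.1.2.1 p.1.2.2)))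

lemma edgeRate_comm (g : Fin L → ℝ≥0 → ℝ≥0) (w : Fin N → Fin L → ℝ≥0) (i j : Fin N)
    (l : Fin L) : edgeRate g w i j l = edgeRate g w j i l := by
  simp only [edgeRate, mul_comm (w i l)]

lemma hasLaw_eval_edgeSlot (g : Fin L → ℝ≥0 → ℝ≥0) (w : Fin N → Fin L → ℝ≥0) (i j : Fin N)
    (l : Fin L) : HasLaw (fun k : EdgeSlot N L → ℕ => k (edgeSlot i j l))
      (poissonMeasure (edgeRate g w i j l)) (edgeLaw g w) := by
  wlog h : i ≤ j generalizing i j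
  · rw [edgeSlot_comm, edgeRate_comm]
    exact this j i (le_of_not_ge h)
  rw [edgeSlot_of_le h]
  exact (measurePreserving_eval (fun p : EdgeSlot N L =>
    poissonMeasure (edgeRate g w p.1.1 p.1.2.1 p.1.2.2)) (⟨(i, j, l), h⟩ : EdgeSlot N L)).hasLaw

lemma hasLaw_degree_tensorOfSlots (g : Fin L → ℝ≥0 → ℝ≥0) (w : Fin N → Fin L → ℝ≥0) (i : Fin N)
    (l : Fin L) : HasLaw (fun k => degree (tensorOfSlots k) i l)
      (poissonMeasure (meanDegree (g l) (fun j => w j l) i)) (edgeLaw g w) := by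
  have hind : iIndepFun (fun (p : EdgeSlot N L) (k : EdgeSlot N L → ℕ) => k p) (edgeLaw g w) :=
    iIndepFun_pi (μ := fun p : EdgeSlot N L => poissonMeasure (edgeRate g w p.1.1 p.1.2.1 p.1.2.2))
      (X := fun _ (n : ℕ) => n) fun _ => aemeasurable_id
  have h := hasLaw_sum_poissonMeasure (hasLaw_eval_edgeSlot g w i · l)
    (hind.precomp (edgeSlot_right_injective i l)) Finset.univ
  rw [Finset.sum_fn] at h
  exact h

lemma edgeLaw_singleton (g : Fin L → ℝ≥0 → ℝ≥0) (w : Fin N → Fin L → ℝ≥0)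
    (a : Fin N → Fin N → Fin L → ℕ) :
    edgeLaw g w {slotEntries a} = ∏ i, ∏ j ∈ Finset.univ.filter (fun j => i ≤ j), ∏ l,
      poissonMeasure (edgeRate g w i j l) {a i j l} := by
  calc edgeLaw g w {slotEntries a}
      = ∏ p : EdgeSlot N L,
          poissonMeasure (edgeRate g w p.1.1 p.1.2.1 p.1.2.2) {a p.1.1 p.1.2.1 p.1.2.2} :=
        Measure.pi_singleton _ _
    _ = ∏ p : Fin N × Fin N × Fin L with p.1 ≤ p.2.1,
          poissonMeasure (edgeRate g w p.1 p.2.1 p.2.2) {a p.1 p.2.1 p.2.2} :=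
        (Finset.prod_subtype _ (by simp) fun p : Fin N × Fin N × Fin L =>
          poissonMeasure (edgeRate g w p.1 p.2.1 p.2.2) {a p.1 p.2.1 p.2.2}).symm
    _ = _ := by
        simp only [Finset.prod_filter, Fintype.prod_prod_type, Finset.prod_ite_irrel,
          Finset.prod_const_one]

lemma measurable_edgeLaw {g : Fin L → ℝ≥0 → ℝ≥0} (hg : ∀ l, Measurable (g l)) :
    Measurable fun w : Fin N → Fin L → ℝ≥0 => edgeLaw g w := by
  refine measurable_measure_of_singleton fun k => ?_
  simp only [edgeLaw, Measure.pi_singleton, poissonMeasure_singleton, edgeRate]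
  have := hg
  fun_prop

/-- The conditional law of the edge multiplicities given the weights, as a Markov kernel. -/
noncomputable def edgeKernel {g : Fin L → ℝ≥0 → ℝ≥0} (hg : ∀ l, Measurable (g l)) :
    Kernel (Fin N → Fin L → ℝ≥0) (EdgeSlot N L → ℕ) := ⟨edgeLaw g, measurable_edgeLaw hg⟩

instance {g : Fin L → ℝ≥0 → ℝ≥0} (hg : ∀ l, Measurable (g l)) :
    IsMarkovKernel (edgeKernel (N := N) hg) :=
  ⟨fun w => inferInstanceAs (IsProbabilityMeasure (edgeLaw g w))⟩

variable {Ω : Type*} [MeasurableSpace Ω] {μ : Measure Ω} {g : Fin L → ℝ≥0 → ℝ≥0}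
  {W : Fin N → Ω → Fin L → ℝ≥0} {A : Fin N → Fin N → Fin L → Ω → ℕ}

lemma IsMIRG.measurable_slotEntries (hA : IsMIRG μ g W A) :
    Measurable fun ω => slotEntries fun i j l => A i j l ω :=
  measurable_pi_lambda _ fun _ => hA.measurable _ _ _

lemma IsMIRG.map_prodMk_eq_compProd [SFinite μ] (hA : IsMIRG μ g W A)
    (hg : ∀ l, Measurable (g l)) (hW : ∀ i, Measurable (W i)) :
    μ.map (fun ω => ((fun i => W i ω), slotEntries fun i j l => A i j l ω)) =
      μ.map (fun ω i => W i ω) ⊗ₘ edgeKernel hg := by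
  have hWm : Measurable fun ω i => W i ω := measurable_pi_lambda _ hW
  refine eq_compProd_of_singleton fun B hB k => ?_
  rw [Measure.map_apply (hWm.prodMk hA.measurable_slotEntries)
      (hB.prod (measurableSet_singleton k)),
    setLIntegral_map hB (Kernel.measurable_coe _ (measurableSet_singleton k)) hWm]
  calc _ = μ {ω | (fun i => W i ω) ∈ B ∧
          ∀ i j l, i ≤ j → A i j l ω = tensorOfSlots k i j l} := by
        simp only [← slotEntries_eq_iff]
        rfl
    _ = _ := by
        rw [hA.cond_law B hB]
        simp only [← edgeLaw_singleton, slotEntries_tensorOfSlots]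
        rfl

lemma measurableSet_isSeparated_and_isMisclassified (hg : ∀ l, Measurable (g l)) (l : Fin L)
    (u v c κmin : ℝ) {κ : (Fin N → ℝ≥0) → ℝ} (hκ : Measurable κ) (i : Fin N) :
    MeasurableSet {p : (Fin N → Fin L → ℝ≥0) × (EdgeSlot N L → ℕ) |
      IsSeparated (g l) u v c κmin (κ fun j => p.1 j l) (fun j => p.1 j l) ∧
      IsMisclassified u v (κ fun j => p.1 j l) (p.1 i l) (degree (tensorOfSlots p.2) i l)} := by
  have hlayer : Measurable fun p : (Fin N → Fin L → ℝ≥0) × (EdgeSlot N L → ℕ) =>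
    fun j => p.1 j l := by fun_prop
  have hx : Measurable fun p : (Fin N → Fin L → ℝ≥0) × (EdgeSlot N L → ℕ) =>
    (p.1 i l : ℝ) := by fun_prop
  have hd : Measurable fun p : (Fin N → Fin L → ℝ≥0) × (EdgeSlot N L → ℕ) =>
    (degree (tensorOfSlots p.2) i l : ℝ) :=
      (measurable_of_countable fun k => (degree (tensorOfSlots k) i l : ℝ)).comp measurable_snd
  exact (hlayer (measurableSet_isSeparated (hg l) u v c κmin hκ)).inter
    (((measurableSet_le hx measurable_const).inter (measurableSet_lt (hκ.comp hlayer) hd)).union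
      ((measurableSet_lt measurable_const hx).inter (measurableSet_le hd (hκ.comp hlayer))))

lemma edgeLaw_isSeparated_and_isMisclassified_le (g : Fin L → ℝ≥0 → ℝ≥0)
    (w : Fin N → Fin L → ℝ≥0) (l : Fin L) {u v c κ κmin : ℝ} (hc : 0 < c) (huv : u ≤ v)
    (i : Fin N) :
    edgeLaw g w {k | IsSeparated (g l) u v c κmin κ (fun j => w j l) ∧
      IsMisclassified u v κ (w i l) (degree (tensorOfSlots k) i l)} ≤
      ENNReal.ofReal (Real.exp (-(κmin * poissonRate c))) := by
  by_cases hw : IsSeparated (g l) u v c κmin κ fun j => w j l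
  · simp only [hw, true_and]
    exact ((hasLaw_degree_tensorOfSlots g w i l).measure_eq
      (Set.to_countable {d : ℕ | IsMisclassified u v κ (w i l) d}).measurableSet).trans_le
      (poissonMeasure_isMisclassified_le hc huv hw.1 (hw.2 i).1 (hw.2 i).2)
  · simp only [hw, false_and, Set.ofPred_false, measure_empty, zero_le]

lemma IsMIRG.measure_isMisclassified_le [IsProbabilityMeasure μ] (hA : IsMIRG μ g W A)
    (hg : ∀ l, Measurable (g l)) (hW : ∀ i, Measurable (W i)) (l : Fin L) {u v c κmin : ℝ}
    (hc : 0 < c) (huv : u ≤ v) {κ : (Fin N → ℝ≥0) → ℝ} (hκ : Measurable κ) (i : Fin N) :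
    μ {ω | IsSeparated (g l) u v c κmin (κ fun j => W j ω l) (fun j => W j ω l) ∧
      IsMisclassified u v (κ fun j => W j ω l) (W i ω l) (degree (fun i j l => A i j l ω) i l)} ≤
      ENNReal.ofReal (Real.exp (-(κmin * poissonRate c))) := by
  let S : Set ((Fin N → Fin L → ℝ≥0) × (EdgeSlot N L → ℕ)) :=
    {p | IsSeparated (g l) u v c κmin (κ fun j => p.1 j l) (fun j => p.1 j l) ∧
      IsMisclassified u v (κ fun j => p.1 j l) (p.1 i l) (degree (tensorOfSlots p.2) i l)}
  have hS : MeasurableSet S :=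
    measurableSet_isSeparated_and_isMisclassified hg l u v c κmin hκ i
  have hpre : {ω | IsSeparated (g l) u v c κmin (κ fun j => W j ω l) (fun j => W j ω l) ∧
      IsMisclassified u v (κ fun j => W j ω l) (W i ω l) (degree (fun i j l => A i j l ω) i l)} =
      (fun ω => ((fun i => W i ω), slotEntries fun i j l => A i j l ω)) ⁻¹' S := by
    ext ω
    simp only [S, Set.mem_preimage, Set.mem_ofPred_eq,
      tensorOfSlots_slotEntries fun i j l => hA.symm i j l ω]
  have hWm : Measurable fun ω i => W i ω := measurable_pi_lambda _ hW
  have : IsProbabilityMeasure (μ.map fun ω i => W i ω) :=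
    Measure.isProbabilityMeasure_map hWm.aemeasurable
  rw [hpre, ← Measure.map_apply (hWm.prodMk hA.measurable_slotEntries) hS,
    hA.map_prodMk_eq_compProd hg hW, Measure.compProd_apply hS]
  exact lintegral_le_const (ae_of_all _ fun w =>
    edgeLaw_isSeparated_and_isMisclassified_le g w l (κ := κ fun j => w j l) hc huv i)

end Graph

section Chebyshev

variable {Ω E : Type*} [MeasurableSpace Ω] [MeasurableSpace E] {μ : Measure Ω}
  {X : ℕ → Ω → E} {π : Measure E} {f : E → ℝ} {b : ℝ}

lemma variance_sum_le [IsProbabilityMeasure μ] (hX : ∀ i, HasLaw (X i) π μ)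
    (hind : iIndepFun X μ) (hf : Measurable f) (h0 : ∀ x, 0 ≤ f x) (hb : ∀ x, f x ≤ b) (N : ℕ) :
    Var[∑ i : Fin N, fun ω => f (X i ω); μ] ≤ N * (b * ∫ x, f x ∂π) := by
  have hfX : ∀ i, AEStronglyMeasurable (fun ω => f (X i ω)) μ := fun i =>
    (hf.comp_aemeasurable (hX i).aemeasurable).aestronglyMeasurable
  have hmem : ∀ i, MemLp (fun ω => f (X i ω)) 2 μ := fun i =>
    MemLp.of_bound (hfX i) b (ae_of_all _ fun ω => by rw [Real.norm_of_nonneg (h0 _)]; exact hb _)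
  have hvar : ∀ i, Var[fun ω => f (X i ω); μ] ≤ b * ∫ x, f x ∂π := fun i =>
    calc Var[fun ω => f (X i ω); μ] ≤ ∫ ω, ((fun ω => f (X i ω)) ^ 2) ω ∂μ :=
          variance_le_expectation_sq (hfX i)
      _ ≤ ∫ ω, b * f (X i ω) ∂μ :=
          integral_mono (hmem i).integrable_sq (((hmem i).integrable (by simp)).const_mul b)
            fun ω => by
              simp only [Pi.pow_apply, sq]
              exact mul_le_mul_of_nonneg_right (hb _) (h0 _)
      _ = b * ∫ x, f x ∂π := by
          rw [integral_const_mul]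
          congr 1
          exact (hX i).integral_comp hf.aestronglyMeasurable
  rw [IndepFun.variance_sum (fun (i : Fin N) _ => hmem i) fun i _ j _ hij =>
    (hind.indepFun fun h => hij (Fin.ext h)).comp hf hf]
  exact (Finset.sum_le_sum fun (i : Fin N) _ => hvar i).trans_eq (by simp)

lemma integral_sum_eq (hX : ∀ i, HasLaw (X i) π μ) (hf : Measurable f) (hfi : Integrable f π)
    (N : ℕ) : ∫ ω, ∑ i : Fin N, f (X i ω) ∂μ = N * ∫ x, f x ∂π := by
  have hint : ∀ i, Integrable (fun ω => f (X i ω)) μ := fun i =>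
    ((hX i).map_eq.symm ▸ hfi : Integrable f (μ.map (X i))).comp_aemeasurable (hX i).aemeasurable
  rw [integral_finsetSum _ fun (i : Fin N) _ => hint i]
  have : ∀ i, ∫ ω, f (X i ω) ∂μ = ∫ x, f x ∂π := fun i =>
    (hX i).integral_comp hf.aestronglyMeasurable
  simp [this]

lemma measure_abs_sum_sub_ge_le [IsProbabilityMeasure μ] (hX : ∀ i, HasLaw (X i) π μ)
    (hind : iIndepFun X μ) (hf : Measurable f) (h0 : ∀ x, 0 ≤ f x) (hb : ∀ x, f x ≤ b) (N : ℕ)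
    {r : ℝ} (hr : 0 < r) :
    μ.real {ω | r ≤ |∑ i : Fin N, f (X i ω) - N * ∫ x, f x ∂π|} ≤
      N * (b * ∫ x, f x ∂π) / r ^ 2 := by
  have hbound : ∀ x, ‖f x‖ ≤ b := fun x => by rw [Real.norm_of_nonneg (h0 x)]; exact hb x
  have : IsProbabilityMeasure π := (hX 0).isProbabilityMeasure_iff.1 inferInstance
  have hS : MemLp (fun ω => ∑ i : Fin N, f (X i ω)) 2 μ := memLp_finsetSum _ fun i _ =>
    MemLp.of_bound (hf.comp_aemeasurable (hX i).aemeasurable).aestronglyMeasurable b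
      (ae_of_all _ fun ω => hbound _)
  have chebyshev := ENNReal.toReal_mono ENNReal.ofReal_ne_top (meas_ge_le_variance_div_sq hS hr)
  rw [integral_sum_eq hX hf (.of_bound hf.aestronglyMeasurable b (ae_of_all _ hbound)),
    ENNReal.toReal_ofReal (div_nonneg (variance_nonneg _ _) (sq_nonneg _))] at chebyshev
  refine chebyshev.trans ?_
  gcongr
  rw [← Finset.sum_fn]
  exact variance_sum_le hX hind hf h0 hb N

lemma measure_sum_lt_half_le [IsProbabilityMeasure μ] (hX : ∀ i, HasLaw (X i) π μ)
    (hind : iIndepFun X μ) (hf : Measurable f) (h0 : ∀ x, 0 ≤ f x) (hb : ∀ x, f x ≤ b) (N : ℕ)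
    (hpos : 0 < N * ∫ x, f x ∂π) :
    μ.real {ω | ∑ i : Fin N, f (X i ω) < N * (∫ x, f x ∂π) / 2} ≤
      4 * b / (N * ∫ x, f x ∂π) := by
  have h := measure_abs_sum_sub_ge_le hX hind hf h0 hb N (half_pos hpos)
  refine (measureReal_mono fun ω hω => ?_).trans (h.trans_eq ?_)
  · simp only [Set.mem_ofPred_eq] at hω ⊢
    rw [abs_sub_comm]
    exact le_trans (by linarith) (le_abs_self _)
  · field_simp
    ring

lemma measure_sum_gt_le [IsProbabilityMeasure μ] (hX : ∀ i, HasLaw (X i) π μ) (hf : Measurable f)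
    (hfi : Integrable f π) (h0 : ∀ x, 0 ≤ f x) (N : ℕ) {r : ℝ} (hr : 0 < r) :
    μ.real {ω | r < ∑ i : Fin N, f (X i ω)} ≤ N * (∫ x, f x ∂π) / r := by
  have hint : ∀ i, Integrable (fun ω => f (X i ω)) μ := fun i =>
    ((hX i).map_eq.symm ▸ hfi : Integrable f (μ.map (X i))).comp_aemeasurable (hX i).aemeasurable
  have markov := mul_meas_ge_le_integral_of_nonneg (μ := μ) (f := fun ω => ∑ i : Fin N, f (X i ω))
    (ae_of_all _ fun ω => Finset.sum_nonneg fun i _ => h0 _)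
    (integrable_finsetSum _ fun i _ => hint i) r
  rw [integral_sum_eq hX hf hfi] at markov
  rw [le_div_iff₀ hr, mul_comm]
  refine le_trans (mul_le_mul_of_nonneg_left (measureReal_mono ?_) hr.le) markov
  exact fun ω (hω : r < _) => hω.le

end Chebyshev

section Halving

lemma pow_mul_le_of_half {f : ℝ → ℝ} {M q : ℝ} (hM : 0 ≤ M) (hq : 0 ≤ q)
    (h : ∀ y, M ≤ y → q * f y ≤ f (y / 2)) (k : ℕ) {y : ℝ} (hy : M * 2 ^ k ≤ y) :
    q ^ k * f y ≤ f (y / 2 ^ k) := by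
  induction k with
  | zero => simp
  | succ k ih =>
    rw [pow_succ 2, ← mul_assoc] at hy
    calc q ^ (k + 1) * f y = q * (q ^ k * f y) := by ring
      _ ≤ q * f (y / 2 ^ k) := by
          gcongr
          exact ih (by nlinarith [show 0 ≤ M * 2 ^ k by positivity])
      _ ≤ f (y / 2 ^ k / 2) := h _ ((le_div_iff₀ (by positivity)).2
          (by nlinarith [show 0 ≤ M * 2 ^ k by positivity]))
      _ = f (y / 2 ^ (k + 1)) := by rw [pow_succ, div_div]

lemma rpow_mul_le_of_half {f : ℝ → ℝ} (hf : AntitoneOn f (Set.Ioi 0)) {M β : ℝ} (hM : 0 < M)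
    (hβ : 0 ≤ β) (h : ∀ y, M ≤ y → 2 ^ β * f y ≤ f (y / 2)) {u y : ℝ} (hu : 1 ≤ u)
    (hy : M * u ≤ y) (h0 : 0 ≤ f y) : 2 ^ (-β) * u ^ β * f y ≤ f (y / u) := by
  obtain ⟨k, hku, huk⟩ := exists_nat_pow_near hu one_lt_two
  have hu0 : 0 < u := by linarith
  have hy0 : 0 < y := lt_of_lt_of_le (by positivity) hy
  have hpow : 2 ^ (-β) * u ^ β ≤ (2 ^ β : ℝ) ^ k := by
    rw [Real.rpow_neg two_pos.le, inv_mul_le_iff₀ (by positivity), ← pow_succ',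
      ← Real.rpow_natCast, ← Real.rpow_mul two_pos.le, mul_comm β, Real.rpow_mul two_pos.le,
      Real.rpow_natCast]
    gcongr
  calc 2 ^ (-β) * u ^ β * f y ≤ (2 ^ β : ℝ) ^ k * f y := by gcongr
    _ ≤ f (y / 2 ^ k) := pow_mul_le_of_half hM.le (by positivity) h k
        ((mul_le_mul_of_nonneg_left hku hM.le).trans hy)
    _ ≤ f (y / u) := hf (div_pos hy0 hu0) (div_pos hy0 (by positivity)) (by gcongr)

end Halving

section Tail

/-- The survival function `y ↦ π(y, ∞)` of a law on `ℝ₊`, extended to real arguments. -/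
noncomputable def tailFn (π : Measure ℝ≥0) (y : ℝ) : ℝ := π.real {w | y < (w : ℝ)}

/-- The law `π` on `ℝ₊` has a regularly varying tail of index `-α`. -/
structure HasRVTail (π : Measure ℝ≥0) (α : ℝ) : Prop where
  pos : ∀ y, 0 < tailFn π y
  tendsto : ∀ x : ℝ, 0 < x → Tendsto (fun y => tailFn π (y * x) / tailFn π y) atTop (𝓝 (x ^ (-α)))

variable {π : Measure ℝ≥0} {α : ℝ}

lemma HasRVTail.tendsto_half (h : HasRVTail π α) :
    Tendsto (fun y => tailFn π (y / 2) / tailFn π y) atTop (𝓝 (2 ^ α)) := by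
  have h2 := h.tendsto 2⁻¹ (by norm_num)
  rwa [Real.inv_rpow two_pos.le, Real.rpow_neg two_pos.le, inv_inv] at h2

variable [IsProbabilityMeasure π]

lemma tailFn_antitone : Antitone (tailFn π) := fun _ _ hab =>
  measureReal_mono fun _ hw => lt_of_le_of_lt hab hw

lemma tendsto_tailFn_atTop : Tendsto (tailFn π) atTop (𝓝 0) := by
  have h := tendsto_measure_iInter_atTop (μ := π) (s := fun y : ℝ => {w : ℝ≥0 | y < (w : ℝ)})
    (fun y => (measurableSet_lt measurable_const (by fun_prop)).nullMeasurableSet)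
    (fun _ _ hab _ hw => lt_of_le_of_lt hab hw) ⟨0, measure_ne_top _ _⟩
  have hempty : ⋂ y : ℝ, {w : ℝ≥0 | y < (w : ℝ)} = ∅ :=
    Set.eq_empty_of_forall_notMem fun w hw => lt_irrefl (w : ℝ) (Set.mem_iInter.1 hw w)
  rw [hempty, measure_empty] at h
  exact (ENNReal.tendsto_toReal ENNReal.zero_ne_top).comp h

lemma HasRVTail.eventually_one_le (h : HasRVTail π α) (hα : 0 < α) :
    ∃ C > 0, ∀ᶠ y in atTop, 1 ≤ C * y ^ (α + 1) * tailFn π y := by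
  have hlt : (2 : ℝ) ^ α < 2 ^ (α + 1) := Real.rpow_lt_rpow_of_exponent_lt one_lt_two (by linarith)
  obtain ⟨M, hM⟩ := eventually_atTop.1 (h.tendsto_half.eventually (gt_mem_nhds hlt))
  set K := max M 1
  have hK : 1 ≤ K := le_max_right _ _
  have hKpos := h.pos (2 * K)
  have hhalf : ∀ y, K ≤ y → 2 ^ (α + 1) * -tailFn π y ≤ -tailFn π (y / 2) := fun y hy => by
    have := hM y ((le_max_left _ _).trans hy)
    rw [div_lt_iff₀ (h.pos _)] at this
    linarith
  refine ⟨(tailFn π (2 * K))⁻¹, by positivity, ?_⟩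
  filter_upwards [eventually_ge_atTop K] with y hy
  obtain ⟨k, hky, hyk⟩ := exists_nat_pow_near ((one_le_div (by linarith)).2 hy) one_lt_two
  rw [div_lt_iff₀ (by linarith), pow_succ, mul_assoc] at hyk
  rw [le_div_iff₀ (by linarith)] at hky
  have hpow : ((2 : ℝ) ^ (α + 1)) ^ k ≤ y ^ (α + 1) := by
    rw [← Real.rpow_natCast, ← Real.rpow_mul two_pos.le, mul_comm, Real.rpow_mul two_pos.le,
      Real.rpow_natCast]
    gcongr
    exact (le_mul_of_one_le_right (by positivity) hK).trans hky
  have hiter := pow_mul_le_of_half (by linarith) (by positivity) hhalf k (mul_comm K _ ▸ hky)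
  have htail : tailFn π (2 * K) ≤ y ^ (α + 1) * tailFn π y :=
    calc tailFn π (2 * K) ≤ tailFn π (y / 2 ^ k) :=
          tailFn_antitone ((div_le_iff₀ (by positivity)).2 (by linarith))
      _ ≤ ((2 : ℝ) ^ (α + 1)) ^ k * tailFn π y := by linarith
      _ ≤ y ^ (α + 1) * tailFn π y := by
          gcongr
          exact (h.pos y).le
  rwa [mul_assoc, inv_mul_eq_div, one_le_div hKpos]

lemma HasRVTail.exists_growth (h : HasRVTail π α) (hα : 0 < α) {δ : ℝ} (hδ : 0 < δ) :
    ∃ c > 0, ∃ M > 0, ∀ y ≥ M, (1 + c) * π.real {w | y ≤ (w : ℝ)} ≤ tailFn π (y / (1 + δ)) := by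
  set s := Real.sqrt (1 + δ)
  have hss : s * s = 1 + δ := Real.mul_self_sqrt (by linarith)
  have hs1 : 1 < s := Real.lt_sqrt_of_sq_lt (by linarith)
  have hlim : 1 < s⁻¹ ^ (-α) := by
    rw [Real.inv_rpow (by positivity), Real.rpow_neg (by positivity), inv_inv]
    exact Real.one_lt_rpow hs1 hα
  obtain ⟨q, hq1, hq⟩ := exists_between hlim
  obtain ⟨M, hM⟩ := eventually_atTop.1
    ((h.tendsto s⁻¹ (by positivity)).eventually (lt_mem_nhds hq))
  refine ⟨q - 1, by linarith, s * max M 1, by positivity, fun y hy => ?_⟩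
  have hy0 : 0 < y := lt_of_lt_of_le (by positivity) hy
  have hMs : M ≤ y / s := (le_max_left M 1).trans ((le_div_iff₀' (by positivity)).2 hy)
  calc (1 + (q - 1)) * π.real {w | y ≤ (w : ℝ)} = q * π.real {w | y ≤ (w : ℝ)} := by ring
    _ ≤ q * tailFn π (y / s) := by
        gcongr
        exact measureReal_mono fun w hw => lt_of_lt_of_le (div_lt_self hy0 hs1) hw
    _ ≤ tailFn π (y / s * s⁻¹) := ((lt_div_iff₀ (h.pos _)).1 (hM _ hMs)).le
    _ = tailFn π (y / (1 + δ)) := by rw [← hss, ← div_eq_mul_inv, div_div]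

lemma HasRVTail.exists_tailFn_le_rpow (h : HasRVTail π α) {β : ℝ} (hβ : 0 ≤ β)
    (hβα : β < α) : ∃ M > 0, ∃ C, ∀ y ≥ M, tailFn π y ≤ C * y ^ (-β) := by
  obtain ⟨M, hM⟩ := eventually_atTop.1 (h.tendsto_half.eventually
    (lt_mem_nhds (Real.rpow_lt_rpow_of_exponent_lt one_lt_two hβα)))
  set K := max M 1
  have hK : 0 < K := lt_max_of_lt_right one_pos
  have hhalf : ∀ y, K ≤ y → 2 ^ β * tailFn π y ≤ tailFn π (y / 2) := fun y hy =>
    ((lt_div_iff₀ (h.pos _)).1 (hM y ((le_max_left _ _).trans hy))).le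
  refine ⟨K, hK, (2 * K) ^ β * tailFn π K, fun y hy => ?_⟩
  have hy0 : 0 < y := hK.trans_le hy
  have hgrow := rpow_mul_le_of_half (tailFn_antitone.antitoneOn _) hK hβ hhalf
    ((one_le_div hK).2 hy) (mul_div_cancel₀ y hK.ne').le (h.pos y).le
  rw [div_div_cancel₀ hy0.ne', Real.div_rpow hy0.le hK.le, Real.rpow_neg two_pos.le] at hgrow
  rw [Real.mul_rpow two_pos.le hK.le, Real.rpow_neg hy0.le]
  field_simp at hgrow ⊢
  linarith

lemma HasRVTail.integrable_coe (h : HasRVTail π α) (hα : 1 < α) :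
    Integrable (fun w : ℝ≥0 => (w : ℝ)) π := by
  obtain ⟨β, hβ1, hβα⟩ := exists_between hα
  obtain ⟨M, hM, C, hC⟩ := h.exists_tailFn_le_rpow (by linarith) hβα
  have hmeas : Measurable fun w : ℝ≥0 => (w : ℝ) := by fun_prop
  refine ⟨hmeas.aestronglyMeasurable, ?_⟩
  rw [hasFiniteIntegral_iff_ofReal (ae_of_all _ fun w => w.coe_nonneg),
    lintegral_eq_lintegral_meas_lt π (ae_of_all _ fun w => w.coe_nonneg) hmeas.aemeasurable,
    ← Set.Ioc_union_Ioi_eq_Ioi hM.le]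
  refine (lintegral_union_le _ _ _).trans_lt (ENNReal.add_lt_top.2 ⟨?_, ?_⟩)
  · calc ∫⁻ t in Set.Ioc 0 M, π {w | t < (w : ℝ)} ≤ ∫⁻ _ in Set.Ioc 0 M, 1 :=
          lintegral_mono fun _ => prob_le_one
      _ < ∞ := by simp
  · calc ∫⁻ t in Set.Ioi M, π {w | t < (w : ℝ)}
        ≤ ∫⁻ t in Set.Ioi M, ENNReal.ofReal (C * t ^ (-β)) :=
          setLIntegral_mono' measurableSet_Ioi fun t ht =>
            (ofReal_measureReal).symm.trans_le (ENNReal.ofReal_le_ofReal (hC t (le_of_lt ht)))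
      _ < ∞ := ((integrableOn_Ioi_rpow_of_lt (by linarith) hM).const_mul C).lintegral_lt_top

end Tail

section FiniteMean

/-- The weight `w` if it exceeds the level `y`, and `0` otherwise. -/
noncomputable def tailPart (y : ℝ) (w : ℝ≥0) : ℝ := if y < (w : ℝ) then (w : ℝ) else 0

lemma tailPart_nonneg (y : ℝ) (w : ℝ≥0) : 0 ≤ tailPart y w := by
  rw [tailPart]; split_ifs <;> simp

lemma tailPart_le (y : ℝ) (w : ℝ≥0) : tailPart y w ≤ w := by
  rw [tailPart]; split_ifs <;> simp

lemma measurableSet_lt_coe (y : ℝ) : MeasurableSet {w : ℝ≥0 | y < (w : ℝ)} :=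
  measurableSet_lt measurable_const measurable_coe_nnreal_real

lemma measurable_tailPart (y : ℝ) : Measurable (tailPart y) :=
  Measurable.ite (measurableSet_lt_coe y) measurable_coe_nnreal_real measurable_const

lemma le_of_sum_tailPart_le {N : ℕ} {x : Fin N → ℝ≥0} {y : ℝ} (h : ∑ j, tailPart y (x j) ≤ y)
    (i : Fin N) : (x i : ℝ) ≤ y := by
  by_contra! hlt
  have hi : (x i : ℝ) = tailPart y (x i) := (if_pos hlt).symm
  have := Finset.single_le_sum (f := fun j => tailPart y (x j))
    (fun j _ => tailPart_nonneg _ _) (Finset.mem_univ i)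
  linarith

lemma abs_sub_le_add_tailPart {G : ℝ≥0 → ℝ≥0} {η K M z₀ T : ℝ} (hη : 0 ≤ η)
    (hloc : ∀ z : ℝ≥0, (z : ℝ) ≤ z₀ → |(G z : ℝ) - z| ≤ η * z)
    (hlin : ∀ z : ℝ≥0, |(G z : ℝ) - z| ≤ K * z) (hT : 0 < T) {v w z : ℝ≥0}
    (hz : (z : ℝ) = v * w / T) (hv : (v : ℝ) * M ≤ z₀ * T) :
    |(G z : ℝ) - z| ≤ η * z + K * (v / T) * tailPart M w := by
  by_cases hw : M < (w : ℝ)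
  · have h0 : 0 ≤ η * z := by positivity
    have hKz : K * (v / T) * tailPart M w = K * z := by rw [tailPart, if_pos hw, hz]; ring
    linarith [hlin z]
  · rw [tailPart, if_neg hw, mul_zero, add_zero]
    refine hloc z ?_
    rw [hz, div_le_iff₀ hT]
    exact (mul_le_mul_of_nonneg_left (not_lt.1 hw) v.2).trans hv

lemma abs_meanDegree_sub_le {N : ℕ} {G : ℝ≥0 → ℝ≥0} {x : Fin N → ℝ≥0} {η K M z₀ : ℝ}
    (hη : 0 ≤ η) (hK : 0 ≤ K)
    (hloc : ∀ z : ℝ≥0, (z : ℝ) ≤ z₀ → |(G z : ℝ) - z| ≤ η * z)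
    (hlin : ∀ z : ℝ≥0, |(G z : ℝ) - z| ≤ K * z) (hT : 0 < ∑ k, (x k : ℝ)) {i : Fin N}
    (hM : (x i : ℝ) * M ≤ z₀ * ∑ k, (x k : ℝ))
    (hbig : ∑ j, tailPart M (x j) ≤ η * ∑ k, (x k : ℝ)) :
    |(meanDegree G x i : ℝ) - x i| ≤ η * (1 + K) * x i := by
  set T : ℝ := ∑ k, (x k : ℝ) with hTdef
  set z : Fin N → ℝ≥0 := fun j => x i * x j / ∑ k, x k with hzdef
  have hz (j) : (z j : ℝ) = x i * x j / T := by simp [hzdef, hTdef]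
  have hsum : ∑ j, (z j : ℝ) = x i := by
    simp_rw [hz, ← Finset.sum_div, ← Finset.mul_sum, ← hTdef]
    exact mul_div_cancel_right₀ _ hT.ne'
  calc |(meanDegree G x i : ℝ) - x i|
      = |∑ j, ((G (z j) : ℝ) - z j)| := by
        rw [Finset.sum_sub_distrib, hsum, meanDegree, NNReal.coe_sum]
    _ ≤ ∑ j, |(G (z j) : ℝ) - z j| := Finset.abs_sum_le_sum_abs _ _
    _ ≤ ∑ j, (η * z j + K * (x i / T) * tailPart M (x j)) :=
        Finset.sum_le_sum fun j _ => abs_sub_le_add_tailPart hη hloc hlin hT (hz j) hM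
    _ = η * x i + K * (x i / T) * ∑ j, tailPart M (x j) := by
        rw [Finset.sum_add_distrib, ← Finset.mul_sum, hsum, ← Finset.mul_sum]
    _ ≤ η * x i + K * (x i / T) * (η * T) := by gcongr
    _ = η * (1 + K) * x i := by field_simp

lemma IsConnectionFun.exists_abs_sub_le_mul {α : ℝ} {G : ℝ≥0 → ℝ≥0} (hG : IsConnectionFun α G) :
    ∃ K > 0, ∀ z : ℝ≥0, |(G z : ℝ) - z| ≤ K * z := by
  obtain ⟨K, hK⟩ := hG.linear_bound
  refine ⟨K + 1, by positivity, fun z => ?_⟩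
  have hGz : (G z : ℝ) ≤ K * z := by exact_mod_cast hK z
  have : (0 : ℝ) ≤ K * z := by positivity
  rw [abs_le]
  constructor <;> linarith [z.2, (G z).2]

lemma IsConnectionFun.exists_local {α : ℝ} {G : ℝ≥0 → ℝ≥0} (hG : IsConnectionFun α G) {η : ℝ}
    (hη : 0 < η) : ∃ z₀ > 0, ∀ z : ℝ≥0, (z : ℝ) ≤ z₀ → |(G z : ℝ) - z| ≤ η * z := by
  obtain ⟨K, hK⟩ := hG.linear_bound
  have hG0 : G 0 = 0 := by simpa using hK 0
  have hnear := hG.tendsto_one.eventually (Metric.ball_mem_nhds 1 hη)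
  rw [eventually_nhdsWithin_iff, Metric.eventually_nhds_iff] at hnear
  obtain ⟨r, hr, hnear⟩ := hnear
  refine ⟨r / 2, half_pos hr, fun z hz => ?_⟩
  obtain rfl | hz0 := eq_zero_or_pos z
  · simp [hG0]
  have hratio : |(G z : ℝ) / z - 1| < η := by
    have := hnear (y := z) (by simpa [NNReal.dist_eq] using hz.trans_lt (half_lt_self hr)) hz0
    rwa [NNReal.dist_eq, NNReal.coe_div] at this
  have hz0' : (0 : ℝ) < z := hz0
  calc |(G z : ℝ) - z| = |(G z : ℝ) / z - 1| * z := by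
        rw [← abs_of_pos hz0', ← abs_mul, abs_of_pos hz0']; field_simp
    _ ≤ η * z := by gcongr

variable {Ω : Type*} [MeasurableSpace Ω] {μ : Measure Ω} {X : ℕ → Ω → ℝ≥0} {π : Measure ℝ≥0}
  {α : ℝ} {G : ℝ≥0 → ℝ≥0}

lemma integrable_tailPart (hint : Integrable (fun w : ℝ≥0 => (w : ℝ)) π) (y : ℝ) :
    Integrable (tailPart y) π :=
  hint.mono' (measurable_tailPart y).aestronglyMeasurable <| ae_of_all _ fun w => by
    rw [Real.norm_of_nonneg (tailPart_nonneg y w)]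
    exact tailPart_le y w

lemma tendsto_integral_tailPart (hint : Integrable (fun w : ℝ≥0 => (w : ℝ)) π) :
    Tendsto (fun y : ℝ => ∫ w, tailPart y w ∂π) atTop (𝓝 0) := by
  rw [← integral_zero ℝ≥0 ℝ (μ := π)]
  refine tendsto_integral_filter_of_dominated_convergence (fun w => (w : ℝ))
    (.of_forall fun y => (measurable_tailPart y).aestronglyMeasurable) ?_ hint ?_
  · refine .of_forall fun y => ae_of_all _ fun w => ?_
    rw [Real.norm_of_nonneg (tailPart_nonneg y w)]
    exact tailPart_le y w
  · refine ae_of_all _ fun w => tendsto_const_nhds.congr' ?_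
    filter_upwards [eventually_ge_atTop (w : ℝ)] with y hy
    exact (if_neg hy.not_gt).symm

/-- The truncated mean `E[min (W, y)]` of a weight `W` with law `π`. -/
noncomputable def truncMean (π : Measure ℝ≥0) (y : ℝ) : ℝ := ∫ w, min (w : ℝ) y ∂π

lemma integrable_min [IsFiniteMeasure π] {y : ℝ} (hy : 0 ≤ y) :
    Integrable (fun w : ℝ≥0 => min (w : ℝ) y) π :=
  (integrable_const y).mono' (by fun_prop) <| ae_of_all _ fun w =>
    (Real.norm_of_nonneg (le_min w.2 hy)).trans_le (min_le_right _ _)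

lemma mul_tailFn_le_truncMean [IsFiniteMeasure π] {y : ℝ} (hy : 0 ≤ y) :
    y * tailFn π y ≤ truncMean π y := by
  have : y * tailFn π y = ∫ w, {w : ℝ≥0 | y < (w : ℝ)}.indicator (fun _ => y) w ∂π := by
    rw [integral_indicator_const _ (measurableSet_lt_coe y), tailFn, smul_eq_mul, mul_comm]
  rw [this]
  refine integral_mono_of_nonneg (ae_of_all _ fun w => Set.indicator_nonneg (fun _ _ => hy) w)
    (integrable_min hy) (ae_of_all _ (Set.indicator_le' (fun w hw => ?_) fun w _ => ?_))
  · exact (min_eq_right (le_of_lt hw)).ge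
  · exact le_min w.2 hy

lemma truncMean_pos [IsFiniteMeasure π] {y : ℝ} (hy : 0 < y) (hpos : 0 < tailFn π y) :
    0 < truncMean π y :=
  (mul_pos hy hpos).trans_le (mul_tailFn_le_truncMean hy.le)

lemma measure_sum_tailPart_gt_le [IsProbabilityMeasure μ] (hX : ∀ i, HasLaw (X i) π μ)
    (hint : Integrable (fun w : ℝ≥0 => (w : ℝ)) π) (y : ℝ) {N : ℕ} (hN : 0 < N) {a ε : ℝ}
    (ha : 0 < a) (hy : ∫ w, tailPart y w ∂π < ε * a) :
    μ.real {ω | N * a < ∑ i : Fin N, tailPart y (X i ω)} ≤ ε := by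
  refine (measure_sum_gt_le hX (measurable_tailPart y) (integrable_tailPart hint y)
    (tailPart_nonneg y) N (by positivity)).trans ?_
  rw [div_le_iff₀ (by positivity)]
  nlinarith

lemma abs_meanDegree_sub_le_of_sum_tailPart_le {N : ℕ} {x : Fin N → ℝ≥0} {η K M m z₀ : ℝ}
    (hη : 0 ≤ η) (hK : 0 ≤ K) (hM₀ : 0 < M) (hm : 0 < m) (hz₀ : 0 ≤ z₀)
    (hloc : ∀ z : ℝ≥0, (z : ℝ) ≤ z₀ → |(G z : ℝ) - z| ≤ η * z)
    (hlin : ∀ z : ℝ≥0, |(G z : ℝ) - z| ≤ K * z) (hT : N * m ≤ ∑ k, (x k : ℝ))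
    (hheavy : ∑ j, tailPart M (x j) ≤ N * (η * m))
    (hmax : ∑ j, tailPart (N * (z₀ * m / M)) (x j) ≤ N * (z₀ * m / M)) (i : Fin N) :
    |(meanDegree G x i : ℝ) - x i| ≤ η * (1 + K) * x i := by
  have hN : (0 : ℝ) < N := by exact_mod_cast i.pos
  refine abs_meanDegree_sub_le hη hK hloc hlin (M := M) ((mul_pos hN hm).trans_le hT) ?_ ?_
  · calc (x i : ℝ) * M ≤ N * (z₀ * m / M) * M := by
          gcongr; exact le_of_sum_tailPart_le hmax i
      _ = z₀ * (N * m) := by field_simp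
      _ ≤ _ := by gcongr
  · calc _ ≤ N * (η * m) := hheavy
      _ = η * (N * m) := by ring
      _ ≤ _ := by gcongr

lemma eventually_meanDegree_close [IsProbabilityMeasure μ] (hX : ∀ i, HasLaw (X i) π μ)
    (hind : iIndepFun X μ) (hpos : ∀ y, 0 < tailFn π y)
    (hint : Integrable (fun w : ℝ≥0 => (w : ℝ)) π) (hG : IsConnectionFun α G)
    {η ε : ℝ} (hη : 0 < η) (hε : 0 < ε) :
    ∀ᶠ N : ℕ in atTop, μ.real {ω | ¬ ∀ i : Fin N,
      |(meanDegree G (fun j : Fin N => X j ω) i : ℝ) - X i ω| ≤ η * X i ω} ≤ ε := by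
  have : IsProbabilityMeasure π := (hX 0).isProbabilityMeasure_iff.1 inferInstance
  obtain ⟨K, hK, hlin⟩ := hG.exists_abs_sub_le_mul
  set η' := η / (1 + K)
  have hη' : 0 < η' := by positivity
  obtain ⟨z₀, hz₀, hloc⟩ := hG.exists_local hη'
  set m := truncMean π 1
  have hm0 : 0 < m := truncMean_pos one_pos (hpos 1)
  obtain ⟨M, hM0, hM⟩ := ((eventually_gt_atTop (0 : ℝ)).and
    ((tendsto_integral_tailPart hint).eventually_lt_const
      (show 0 < ε / 3 * (η' * (m / 2)) by positivity))).exists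
  set a := z₀ * (m / 2) / M
  have ha0 : 0 < a := by positivity
  have hlim : Tendsto (fun N : ℕ => ∫ w, tailPart (N * a) w ∂π) atTop (𝓝 0) :=
    (tendsto_integral_tailPart hint).comp (tendsto_natCast_atTop_atTop.atTop_mul_const ha0)
  have hcheb : Tendsto (fun N : ℕ => 4 * 1 / (N * m)) atTop (𝓝 0) :=
    tendsto_const_nhds.div_atTop (tendsto_natCast_atTop_atTop.atTop_mul_const hm0)
  filter_upwards [hlim.eventually_lt_const (show 0 < ε / 3 * a by positivity),
    eventually_gt_atTop 0, hcheb.eventually_lt_const (show 0 < ε / 3 by positivity)]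
    with N hNa hN hNm
  have hN' : (0 : ℝ) < N := by exact_mod_cast hN
  have hsmall := (measure_sum_lt_half_le hX hind (f := fun w : ℝ≥0 => min (w : ℝ) 1)
    (by fun_prop) (fun w => le_min w.2 zero_le_one) (fun w => min_le_right _ _) N
    (mul_pos hN' hm0)).trans hNm.le
  have hheavy := measure_sum_tailPart_gt_le hX hint M hN (by positivity) hM
  have hmax := measure_sum_tailPart_gt_le hX hint (N * a) hN ha0 hNa
  rw [show ε = ε / 3 + ε / 3 + ε / 3 by ring]
  refine le_trans (measureReal_mono fun ω hω => ?_) ((measureReal_union_le _ _).trans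
    (add_le_add ((measureReal_union_le _ _).trans (add_le_add hsmall hheavy)) hmax))
  by_contra! hcon
  simp only [Set.mem_union, Set.mem_ofPred_eq, not_or, not_lt] at hcon
  obtain ⟨⟨hT, htail⟩, htop⟩ := hcon
  refine hω fun i => (abs_meanDegree_sub_le_of_sum_tailPart_le hη'.le hK.le hM0 (half_pos hm0)
    hz₀.le hloc hlin ?_ htail htop i).trans_eq ?_
  · rw [← mul_div_assoc]
    exact hT.trans (Finset.sum_le_sum fun i _ => min_le_left _ _)
  · rw [div_mul_cancel₀ η (by positivity)]

lemma isSeparated_of_abs_meanDegree_sub_le {N : ℕ} {x : Fin N → ℝ≥0} {s u : ℝ} (hs : 1 < s)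
    (hu : 0 ≤ u)
    (h : ∀ i, |(meanDegree G x i : ℝ) - x i| ≤ (s - 1) / (3 * s) * x i) :
    IsSeparated G u (s * s * u) ((s - 1) / 3) u (s * u) x := by
  set η := (s - 1) / (3 * s) with hη
  have hηs : η * s = (s - 1) / 3 := by rw [hη]; field_simp
  have hη0 : 0 < η := div_pos (by linarith) (by linarith)
  refine ⟨by nlinarith, fun i => ⟨fun hi => ?_, fun hi => ?_⟩⟩
  · calc meanDegree G x i * (1 + (s - 1) / 3) ≤ (1 + η) * u * (1 + (s - 1) / 3) := by
          gcongr
          nlinarith [(abs_le.1 (h i)).2]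
      _ = ((1 + η) * (1 + (s - 1) / 3)) * u := by ring
      _ ≤ s * u := by gcongr; nlinarith
  · calc s * u * (1 + (s - 1) / 3) ≤ s * u * ((1 - η) * s) := by gcongr; nlinarith
      _ = (1 - η) * (s * s * u) := by ring
      _ ≤ (1 - η) * x i := by gcongr; nlinarith
      _ ≤ meanDegree G x i := by linarith [(abs_le.1 (h i)).1]

lemma exists_separation_of_integrable [IsProbabilityMeasure μ] (hX : ∀ i, HasLaw (X i) π μ)
    (hind : iIndepFun X μ) (hpos : ∀ y, 0 < tailFn π y)
    (hint : Integrable (fun w : ℝ≥0 => (w : ℝ)) π) (hG : IsConnectionFun α G)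
    {u : ℕ → ℝ} (hu : Tendsto u atTop atTop) {δ ε : ℝ} (hδ : 0 < δ) (hε : 0 < ε) :
    ∃ c > 0, ∃ a > 0, ∃ β : ℝ, 0 < β ∧ ∀ᶠ N : ℕ in atTop, ∃ κ : (Fin N → ℝ≥0) → ℝ,
      Measurable κ ∧ μ.real {ω | ¬ IsSeparated G (u N) ((1 + δ) * u N) c (a * u N ^ β)
        (κ fun i => X i ω) (fun i : Fin N => X i ω)} ≤ ε := by
  set s := √(1 + δ)
  have hs1 : 1 < s := Real.lt_sqrt_of_sq_lt (by linarith)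
  have hη : 0 < (s - 1) / (3 * s) := div_pos (by linarith) (by linarith)
  refine ⟨(s - 1) / 3, by linarith, 1, one_pos, 1, one_pos, ?_⟩
  filter_upwards [eventually_meanDegree_close hX hind hpos hint hG hη hε,
    hu.eventually_ge_atTop 0] with N hN huN
  refine ⟨fun _ => s * u N, measurable_const, le_trans (measureReal_mono ?_) hN⟩
  intro ω hω hclose
  rw [Set.mem_ofPred_eq, Real.rpow_one, one_mul, ← Real.mul_self_sqrt (show 0 ≤ 1 + δ by linarith)]
    at hω
  exact hω (isSeparated_of_abs_meanDegree_sub_le hs1 huN hclose)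

end FiniteMean

/-- The properties of a concave connection function, extended by `0` to the negative half-line,
on which the infinite-mean case rests; `star` says that `z ↦ h z / z` is nonincreasing. -/
structure IsConcaveRate (h : ℝ → ℝ) : Prop where
  mono : Monotone h
  zero : ∀ z ≤ 0, h z = 0
  star : ∀ x y, 0 ≤ x → x ≤ y → x * h y ≤ y * h x
  le_self : ∀ z, 0 ≤ z → h z ≤ z
  half_le : ∃ z₀ > 0, ∀ z, 0 ≤ z → z ≤ z₀ → z / 2 ≤ h z

namespace IsConcaveRate

variable {h : ℝ → ℝ}

lemma nonneg (hh : IsConcaveRate h) (z : ℝ) : 0 ≤ h z := by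
  rcases le_total z 0 with hz | hz
  · exact (hh.zero z hz).ge
  · exact (hh.zero 0 le_rfl).ge.trans (hh.mono hz)

lemma pos (hh : IsConcaveRate h) {z : ℝ} (hz : 0 < z) : 0 < h z := by
  obtain ⟨z₀, hz₀, hhalf⟩ := hh.half_le
  have hmin : 0 < min z z₀ := lt_min hz hz₀
  calc 0 < min z z₀ / 2 := by positivity
    _ ≤ h (min z z₀) := hhalf _ hmin.le (min_le_right _ _)
    _ ≤ h z := hh.mono (min_le_left _ _)

lemma mul_le (hh : IsConcaveRate h) {s z : ℝ} (hs : 1 ≤ s) (hz : 0 ≤ z) : h (s * z) ≤ s * h z := by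
  rcases hz.eq_or_lt with rfl | hz
  · simp [hh.zero 0 le_rfl]
  · refine le_of_mul_le_mul_left ?_ hz
    linarith [hh.star z (s * z) hz.le (le_mul_of_one_le_left hz.le hs)]

lemma le_add_abs_sub (hh : IsConcaveRate h) (x y : ℝ) : h x ≤ h y + |x - y| := by
  rcases le_or_gt x y with hxy | hxy
  · exact (hh.mono hxy).trans (le_add_of_nonneg_right (abs_nonneg _))
  rw [abs_of_pos (sub_pos.2 hxy)]
  rcases le_or_gt y 0 with hy | hy
  · rcases le_total x 0 with hx | hx
    · linarith [hh.zero x hx, hh.zero y hy]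
    · linarith [hh.le_self x hx, hh.zero y hy]
  · refine le_of_mul_le_mul_left ?_ hy
    nlinarith [hh.star y x hy.le hxy.le, hh.le_self y hy.le]

lemma continuous (hh : IsConcaveRate h) : Continuous h :=
  (LipschitzWith.of_le_add fun x y => by
    simpa [Real.dist_eq] using hh.le_add_abs_sub x y : LipschitzWith 1 h).continuous

/-- A concave rate as a Stieltjes function: its measure turns expectations of the rate into
integrals of the tail. -/
noncomputable def stieltjes (hh : IsConcaveRate h) : StieltjesFunction ℝ where
  toFun := h
  mono' := hh.mono
  right_continuous' := fun _ => hh.continuous.continuousWithinAt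

lemma measure_Ioc (hh : IsConcaveRate h) (a b : ℝ) :
    hh.stieltjes.measure (Set.Ioc a b) = ENNReal.ofReal (h b - h a) :=
  StieltjesFunction.measure_Ioc _ _ _

end IsConcaveRate

lemma isConcaveRate_min_one : IsConcaveRate (fun z => max 0 (min z 1)) where
  mono := fun a b hab => max_le_max le_rfl (min_le_min hab le_rfl)
  zero := fun z hz => max_eq_left ((min_le_left _ _).trans hz)
  star := by
    intro x y hx hxy
    have hy : 0 ≤ y := hx.trans hxy
    rw [max_eq_right (le_min hx zero_le_one), max_eq_right (le_min hy zero_le_one),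
      mul_min_of_nonneg _ _ hx, mul_min_of_nonneg _ _ hy, mul_one, mul_one]
    exact min_le_min (mul_comm x y).le hxy
  le_self := fun z hz => max_le hz (min_le_left _ _)
  half_le := ⟨1, one_pos, fun z h0 h1 => by
    rw [min_eq_left h1, max_eq_right h0]; linarith⟩

section ConcaveNNReal

variable {G : ℝ≥0 → ℝ≥0}

lemma mul_le_mul_of_concaveOn_nnreal (hG : ConcaveOn ℝ≥0 Set.univ G) {x y : ℝ≥0} (hxy : x ≤ y) :
    x * G y ≤ y * G x := by
  rcases eq_or_ne y 0 with rfl | hy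
  · simp [nonpos_iff_eq_zero.1 hxy]
  have hxy1 : x / y ≤ 1 := div_le_one_of_le₀ hxy zero_le
  have hconc : x / y * G y + (1 - x / y) * G 0 ≤ G (x / y * y + (1 - x / y) * 0) :=
    hG.2 (Set.mem_univ y) (Set.mem_univ 0) zero_le zero_le (add_tsub_cancel_of_le hxy1)
  rw [mul_zero, add_zero, div_mul_cancel₀ x hy] at hconc
  calc x * G y = y * (x / y * G y) := by field_simp
    _ ≤ y * G x := by gcongr; exact le_self_add.trans hconc

/-- A concave function that decreased somewhere would eventually be negative: `y` is a convex
combination of `x` and a far away point, with weight almost one on `x`. -/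
lemma monotone_of_concaveOn_nnreal (hG : ConcaveOn ℝ≥0 Set.univ G) : Monotone G := by
  intro x y hxy
  have hconv (n : ℕ) : (1 - 1 / ((n : ℝ) + 1)) * G x ≤ G y := by
    have hn : 1 / ((n : ℝ≥0) + 1) ≤ 1 := div_le_one_of_le₀ le_add_self zero_le
    have hconc : (1 - 1 / ((n : ℝ≥0) + 1)) * G x +
        1 / ((n : ℝ≥0) + 1) * G (x + (n + 1) * (y - x)) ≤
        G ((1 - 1 / ((n : ℝ≥0) + 1)) * x + 1 / ((n : ℝ≥0) + 1) * (x + (n + 1) * (y - x))) :=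
      hG.2 (Set.mem_univ _) (Set.mem_univ _) zero_le zero_le (tsub_add_cancel_of_le hn)
    have hpoint : (1 - 1 / ((n : ℝ≥0) + 1)) * x + 1 / ((n : ℝ≥0) + 1) *
        (x + (n + 1) * (y - x)) = y := by
      apply NNReal.coe_injective
      push_cast [NNReal.coe_sub hn, NNReal.coe_sub hxy]
      field_simp
      ring
    rw [hpoint] at hconc
    have hle : (((1 - 1 / ((n : ℝ≥0) + 1)) * G x : ℝ≥0) : ℝ) ≤ G y :=
      NNReal.coe_le_coe.2 (le_self_add.trans hconc)
    push_cast [NNReal.coe_sub hn] at hle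
    exact hle
  have hlim : Tendsto (fun n : ℕ => (1 - 1 / ((n : ℝ) + 1)) * (G x : ℝ)) atTop
      (𝓝 ((1 - 0) * G x)) :=
    (tendsto_const_nhds.sub tendsto_one_div_add_atTop_nhds_zero_nat).mul_const _
  simpa using le_of_tendsto' hlim hconv

end ConcaveNNReal

namespace IsConnectionFun

variable {α : ℝ} {G : ℝ≥0 → ℝ≥0}

lemma map_zero (hG : IsConnectionFun α G) : G 0 = 0 := by
  obtain ⟨K, hK⟩ := hG.linear_bound
  simpa using hK 0

lemma le_self (hG : IsConnectionFun α G) (hα : α ≤ 1) (z : ℝ≥0) : G z ≤ z := by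
  rcases eq_zero_or_pos z with rfl | hz
  · exact hG.map_zero.le
  have hdiv : ∀ᶠ w : ℝ≥0 in 𝓝[>] 0, G z / z ≤ G w / w := by
    filter_upwards [Ioo_mem_nhdsGT hz] with w hw
    rw [div_le_div_iff₀ hz hw.1, mul_comm, mul_comm (G w)]
    exact mul_le_mul_of_concaveOn_nnreal (hG.concave hα) hw.2.le
  simpa [div_le_one₀ hz] using ge_of_tendsto hG.tendsto_one hdiv

lemma isConcaveRate (hG : IsConnectionFun α G) (hα : α ≤ 1) :
    IsConcaveRate (fun z => (G z.toNNReal : ℝ)) where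
  mono a b hab := NNReal.coe_le_coe.2
    (monotone_of_concaveOn_nnreal (hG.concave hα) (Real.toNNReal_mono hab))
  zero z hz := by simp [Real.toNNReal_of_nonpos hz, hG.map_zero]
  star x y hx hxy := by
    have hstar := NNReal.coe_le_coe.2
      (mul_le_mul_of_concaveOn_nnreal (hG.concave hα) (Real.toNNReal_mono hxy))
    simpa [hx, hx.trans hxy] using hstar
  le_self z hz := by simpa [hz] using NNReal.coe_le_coe.2 (hG.le_self hα z.toNNReal)
  half_le := by
    obtain ⟨z₀, hz₀, hlocal⟩ := hG.exists_local (show (0 : ℝ) < 1 / 2 by norm_num)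
    refine ⟨z₀, hz₀, fun z hz hz1 => ?_⟩
    have hclose := hlocal z.toNNReal (by simpa [hz])
    rw [Real.coe_toNNReal z hz] at hclose
    linarith [(abs_le.1 hclose).1]

end IsConnectionFun

section Sensitivity

variable {π : Measure ℝ≥0} {α : ℝ} {h : ℝ → ℝ} {s x : ℝ}

lemma exists_truncMean_ge [IsFiniteMeasure π] (hinf : ¬ Integrable (fun w : ℝ≥0 => (w : ℝ)) π)
    (R : ℝ) : ∃ M > 0, R ≤ truncMean π M := by
  by_contra! hbound
  refine hinf ((aecover_Iic (μ := π) (tendsto_natCast_atTop_atTop (R := ℝ≥0))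
    ).integrable_of_integral_bounded_of_nonneg_ae R (fun n => ?_)
    (ae_of_all _ fun w => w.2) (Eventually.of_forall fun n => ?_))
  · refine Integrable.of_bound (by fun_prop) n
      ((ae_restrict_iff' measurableSet_Iic).2 (ae_of_all _ fun w hw => ?_))
    rw [Real.norm_of_nonneg w.coe_nonneg]
    exact_mod_cast hw
  · refine le_trans ?_ (hbound (n + 1) (by positivity)).le
    rw [← integral_indicator measurableSet_Iic]
    refine integral_mono_of_nonneg (ae_of_all _ (Set.indicator_nonneg fun w _ => w.2))
      (integrable_min (by positivity)) (ae_of_all _ fun w => ?_)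
    by_cases hw : w ∈ Set.Iic (n : ℝ≥0)
    · have hwn : (w : ℝ) ≤ n := by exact_mod_cast hw
      simp only [Set.indicator_of_mem hw]
      exact le_min le_rfl (by linarith)
    · simp only [Set.indicator_of_notMem hw]
      exact le_min w.2 (by positivity)

/-- The expected rate `E h(y min(W, Y))` of a node at scale `y` with truncated weights. -/
noncomputable def rateMean (π : Measure ℝ≥0) (h : ℝ → ℝ) (y Y : ℝ) : ℝ :=
  ∫ w, h (y * min (w : ℝ) Y) ∂π

namespace IsConcaveRate

lemma integrable [IsFiniteMeasure π] (hh : IsConcaveRate h) (hx : 0 ≤ x) (Y : ℝ) :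
    Integrable (fun w : ℝ≥0 => h (x * min (w : ℝ) Y)) π := by
  have hmeas : Measurable fun w : ℝ≥0 => h (x * min (w : ℝ) Y) :=
    hh.continuous.measurable.comp (by fun_prop)
  refine Integrable.of_bound hmeas.aestronglyMeasurable (h (x * Y)) (ae_of_all _ fun w => ?_)
  rw [Real.norm_of_nonneg (hh.nonneg _)]
  exact hh.mono (mul_le_mul_of_nonneg_left (min_le_right _ _) hx)

lemma ofReal_rateMean [IsFiniteMeasure π] (hh : IsConcaveRate h) (hx : 0 ≤ x) (Y : ℝ) :
    ENNReal.ofReal (rateMean π h x Y) = ∫⁻ w, ENNReal.ofReal (h (x * min (w : ℝ) Y)) ∂π :=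
  ofReal_integral_eq_lintegral_ofReal (hh.integrable hx Y) (ae_of_all _ fun _ => hh.nonneg _)

end IsConcaveRate

/-- The increment `h (s x w) - h (x w)` of the rate under scaling by `s`, for weights `w ≤ Y`
only. -/
noncomputable def rateIncr (h : ℝ → ℝ) (s x Y : ℝ) (w : ℝ≥0) : ℝ :=
  {w : ℝ≥0 | (w : ℝ) ≤ Y}.indicator (fun w => h (s * (x * w)) - h (x * w)) w

lemma rateIncr_of_le {Y : ℝ} {w : ℝ≥0} (hw : (w : ℝ) ≤ Y) :
    rateIncr h s x Y w = h (s * (x * w)) - h (x * w) :=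
  Set.indicator_of_mem (s := {w : ℝ≥0 | (w : ℝ) ≤ Y}) hw _

lemma rateIncr_of_gt {Y : ℝ} {w : ℝ≥0} (hw : Y < (w : ℝ)) : rateIncr h s x Y w = 0 :=
  Set.indicator_of_notMem (s := {w : ℝ≥0 | (w : ℝ) ≤ Y}) (by simpa using hw) _

namespace IsConcaveRate

lemma measurable_rateIncr (hh : IsConcaveRate h) (s x Y : ℝ) : Measurable (rateIncr h s x Y) := by
  have hmeas := hh.continuous.measurable
  exact Measurable.indicator ((hmeas.comp (by fun_prop)).sub (hmeas.comp (by fun_prop)))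
    (measurableSet_le (by fun_prop) measurable_const)

lemma rateIncr_nonneg (hh : IsConcaveRate h) (hs : 1 ≤ s) (hx : 0 ≤ x) (Y : ℝ) (w : ℝ≥0) :
    0 ≤ rateIncr h s x Y w :=
  Set.indicator_nonneg (fun _ _ => sub_nonneg.2
    (hh.mono (le_mul_of_one_le_left (by positivity) hs))) w

lemma rateIncr_le (hh : IsConcaveRate h) (hs : 1 ≤ s) (hx : 0 ≤ x) (Y : ℝ) (w : ℝ≥0) :
    rateIncr h s x Y w ≤ s * h (x * Y) := by
  rcases le_or_gt (w : ℝ) Y with hw | hw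
  · rw [rateIncr_of_le hw]
    calc h (s * (x * w)) - h (x * w) ≤ h (s * (x * w)) := sub_le_self _ (hh.nonneg _)
      _ ≤ s * h (x * w) := hh.mul_le hs (by positivity)
      _ ≤ s * h (x * Y) := by gcongr; exact hh.mono (by gcongr)
  · rw [rateIncr_of_gt hw]
    exact mul_nonneg (by linarith) (hh.nonneg _)

lemma integrable_rateIncr [IsFiniteMeasure π] (hh : IsConcaveRate h) (hs : 1 ≤ s) (hx : 0 ≤ x)
    (Y : ℝ) : Integrable (rateIncr h s x Y) π := by
  refine Integrable.of_bound (hh.measurable_rateIncr s x Y).aestronglyMeasurable (s * h (x * Y))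
    (ae_of_all _ fun w => ?_)
  rw [Real.norm_of_nonneg (hh.rateIncr_nonneg hs hx Y w)]
  exact hh.rateIncr_le hs hx Y w

end IsConcaveRate

lemma lintegral_measure_section_comm {β γ : Type*} [MeasurableSpace β] [MeasurableSpace γ]
    (ρ : Measure β) (ν : Measure γ) [SFinite ρ] [SFinite ν] {p : β → γ → Prop}
    (hp : MeasurableSet {q : β × γ | p q.1 q.2}) :
    ∫⁻ b, ν {c | p b c} ∂ρ = ∫⁻ c, ρ {b | p b c} ∂ν :=
  (Measure.prod_apply hp).symm.trans (Measure.prod_apply_symm hp)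

lemma lintegral_rate_eq [SFinite π] (hh : IsConcaveRate h) (hx : 0 < x) (Y : ℝ) :
    ∫⁻ w, ENNReal.ofReal (h (x * min (w : ℝ) Y)) ∂π =
      ∫⁻ z in Set.Ioc 0 (x * Y), π {w | z / x ≤ (w : ℝ)} ∂hh.stieltjes.measure := by
  rw [← lintegral_measure_section_comm π (hh.stieltjes.measure.restrict (Set.Ioc 0 (x * Y)))
    (p := fun w z => z / x ≤ (w : ℝ)) (measurableSet_le (by fun_prop) (by fun_prop))]
  refine lintegral_congr fun w => ?_
  have hsection : {z : ℝ | z / x ≤ w} ∩ Set.Ioc 0 (x * Y) = Set.Ioc 0 (x * min (w : ℝ) Y) := by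
    ext z
    simp only [Set.mem_inter_iff, Set.mem_ofPred_eq, Set.mem_Ioc, div_le_iff₀' hx,
      mul_min_of_nonneg _ _ hx.le, le_min_iff]
    tauto
  rw [Measure.restrict_apply (measurableSet_le (by fun_prop) (by fun_prop)), hsection,
    hh.measure_Ioc, hh.zero 0 le_rfl, sub_zero]

lemma lintegral_rateIncr_ge [SFinite π] (hh : IsConcaveRate h) (hx : 0 < x) (hs : 0 < s)
    (M Y : ℝ) :
    ∫⁻ z in Set.Ioc (x * M) (x * Y), π {w | z / x / s < (w : ℝ) ∧ (w : ℝ) < z / x}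
      ∂hh.stieltjes.measure ≤ ∫⁻ w, ENNReal.ofReal (rateIncr h s x Y w) ∂π := by
  have hmeas : MeasurableSet {q : ℝ≥0 × ℝ | q.2 / x / s < (q.1 : ℝ) ∧ (q.1 : ℝ) < q.2 / x} := by
    rw [Set.ofPred_and]
    exact (measurableSet_lt (by fun_prop) (by fun_prop)).inter
      (measurableSet_lt (by fun_prop) (by fun_prop))
  rw [← lintegral_measure_section_comm π
    (hh.stieltjes.measure.restrict (Set.Ioc (x * M) (x * Y))) hmeas]
  refine lintegral_mono fun w => ?_
  have hsection : MeasurableSet {z : ℝ | z / x / s < (w : ℝ) ∧ (w : ℝ) < z / x} :=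
    measurable_prodMk_left hmeas
  rw [Measure.restrict_apply hsection]
  simp only [div_lt_iff₀ hs, div_lt_iff₀ hx, lt_div_iff₀ hx]
  rcases le_or_gt (w : ℝ) Y with hw | hw
  · rw [rateIncr_of_le hw, ← hh.measure_Ioc]
    refine measure_mono ?_
    rintro z ⟨⟨hzs, hzx⟩, -⟩
    exact ⟨by linarith, by linarith⟩
  · refine (measure_mono_null ?_ measure_empty).trans_le zero_le
    rintro z ⟨⟨-, hzx⟩, -, hzY⟩
    nlinarith

lemma HasRVTail.exists_measure_between_ge [IsProbabilityMeasure π] (hRV : HasRVTail π α)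
    (hα : 0 < α) (hs : 1 < s) :
    ∃ c > 0, ∃ M > 0, ∀ v ≥ M, ENNReal.ofReal c * π {w | v ≤ (w : ℝ)} ≤
      π {w | v / s < (w : ℝ) ∧ (w : ℝ) < v} := by
  obtain ⟨c, hc, M, hM, hgrow⟩ := hRV.exists_growth hα (sub_pos.2 hs)
  refine ⟨c, hc, M, hM, fun v hv => ?_⟩
  have hcover : tailFn π (v / s) ≤
      π.real {w | v / s < (w : ℝ) ∧ (w : ℝ) < v} + π.real {w | v ≤ (w : ℝ)} := by
    refine (measureReal_mono fun w hw => ?_).trans (measureReal_union_le _ _)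
    exact (lt_or_ge (w : ℝ) v).imp (fun hlt => ⟨hw, hlt⟩) id
  have hreal := hgrow v hv
  rw [add_sub_cancel] at hreal
  rw [← ofReal_measureReal, ← ofReal_measureReal, ← ENNReal.ofReal_mul hc.le]
  exact ENNReal.ofReal_le_ofReal (by linarith)

namespace IsConcaveRate

lemma mul_rateMean_le [IsProbabilityMeasure π] (hh : IsConcaveRate h) {c M : ℝ} (hc : 0 ≤ c)
    (hM : 0 ≤ M) (hs : 1 ≤ s)
    (hgrow : ∀ v ≥ M, ENNReal.ofReal c * π {w | v ≤ (w : ℝ)} ≤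
      π {w | v / s < (w : ℝ) ∧ (w : ℝ) < v}) (hx : 0 < x) (Y : ℝ) :
    c * rateMean π h x Y ≤ c * (x * M) + ∫ w, rateIncr h s x Y w ∂π := by
  have hincr0 : 0 ≤ ∫ w, rateIncr h s x Y w ∂π :=
    integral_nonneg fun w => hh.rateIncr_nonneg hs hx.le Y w
  have hcover : Set.Ioc 0 (x * Y) ⊆ Set.Ioc 0 (x * M) ∪ Set.Ioc (x * M) (x * Y) := fun z hz =>
    (le_or_gt z (x * M)).imp (fun hle => ⟨hz.1, hle⟩) fun hgt => ⟨hgt, hz.2⟩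
  have hsmall : ∫⁻ z in Set.Ioc 0 (x * M), π {w | z / x ≤ (w : ℝ)} ∂hh.stieltjes.measure ≤
      ENNReal.ofReal (x * M) := by
    refine (lintegral_mono (g := 1) fun z => prob_le_one).trans ?_
    rw [Pi.one_def, setLIntegral_one, hh.measure_Ioc, hh.zero 0 le_rfl, sub_zero]
    exact ENNReal.ofReal_le_ofReal (hh.le_self _ (by positivity))
  have hlarge : ENNReal.ofReal c * ∫⁻ z in Set.Ioc (x * M) (x * Y), π {w | z / x ≤ (w : ℝ)}
      ∂hh.stieltjes.measure ≤ ENNReal.ofReal (∫ w, rateIncr h s x Y w ∂π) := by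
    rw [ofReal_integral_eq_lintegral_ofReal (hh.integrable_rateIncr hs hx.le Y)
      (ae_of_all _ fun w => hh.rateIncr_nonneg hs hx.le Y w)]
    refine le_trans ?_ (lintegral_rateIncr_ge hh hx (by linarith) M Y)
    rw [← lintegral_const_mul' _ _ ENNReal.ofReal_ne_top]
    refine setLIntegral_mono' measurableSet_Ioc fun z hz => hgrow _ ?_
    exact (le_div_iff₀' hx).2 hz.1.le
  rw [← ENNReal.ofReal_le_ofReal_iff (by positivity), ENNReal.ofReal_add (by positivity) hincr0,
    ENNReal.ofReal_mul hc, ENNReal.ofReal_mul hc, hh.ofReal_rateMean hx.le, lintegral_rate_eq hh hx]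
  calc _ ≤ ENNReal.ofReal c * (_ + _) := by
        gcongr
        exact (lintegral_mono_set hcover).trans (lintegral_union_le _ _ _)
    _ = ENNReal.ofReal c * _ + ENNReal.ofReal c * _ := mul_add _ _ _
    _ ≤ _ := by gcongr

lemma exists_mul_le_rateMean [IsFiniteMeasure π] (hh : IsConcaveRate h)
    (hinf : ¬ Integrable (fun w : ℝ≥0 => (w : ℝ)) π) (R : ℝ) :
    ∃ x₀ > 0, ∃ M > 0, ∀ x, 0 < x → x ≤ x₀ → ∀ Y ≥ M, R * x ≤ rateMean π h x Y := by
  obtain ⟨M, hM, hbig⟩ := exists_truncMean_ge hinf (2 * R)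
  obtain ⟨z₀, hz₀, hhalf⟩ := hh.half_le
  refine ⟨z₀ / M, by positivity, M, hM, fun x hx hx0 Y hY => ?_⟩
  calc R * x ≤ x / 2 * truncMean π M := by nlinarith
    _ = ∫ w, x / 2 * min (w : ℝ) M ∂π := (integral_const_mul _ _).symm
    _ ≤ rateMean π h x Y :=
      integral_mono ((integrable_min hM.le).const_mul _) (hh.integrable hx.le Y) fun w => ?_
  have hxmin : x * min (w : ℝ) M ≤ z₀ :=
    (mul_le_mul_of_nonneg_left (min_le_right _ _) hx.le).trans ((le_div_iff₀ hM).1 hx0)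
  calc x / 2 * min (w : ℝ) M = x * min (w : ℝ) M / 2 := by ring
    _ ≤ h (x * min (w : ℝ) M) := hhalf _ (mul_nonneg hx.le (le_min w.2 hM.le)) hxmin
    _ ≤ h (x * min (w : ℝ) Y) := hh.mono (by gcongr)

/-- Integrating the tail growth against the Stieltjes measure loses only the weights below a fixed
level, which are negligible because the mean is infinite. -/
lemma exists_sensitivity [IsProbabilityMeasure π] (hh : IsConcaveRate h) (hRV : HasRVTail π α)
    (hα : 0 < α) (hinf : ¬ Integrable (fun w : ℝ≥0 => (w : ℝ)) π) (hs : 1 < s) :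
    ∃ c > 0, ∃ x₀ > 0, ∃ M > 0, ∀ x, 0 < x → x ≤ x₀ → ∀ Y ≥ M,
      c * rateMean π h x Y ≤ ∫ w, rateIncr h s x Y w ∂π := by
  obtain ⟨c, hc, M, hM, hgrow⟩ := hRV.exists_measure_between_ge hα hs
  obtain ⟨x₀, hx₀, M₁, hM₁, hmean⟩ := hh.exists_mul_le_rateMean hinf (2 * M)
  refine ⟨c / 2, by positivity, x₀, hx₀, M₁, hM₁, fun x hx hx0 Y hY => ?_⟩
  have hincr := hh.mul_rateMean_le hc.le hM.le hs.le hgrow hx Y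
  have hlow : c * (2 * M * x) ≤ c * rateMean π h x Y :=
    mul_le_mul_of_nonneg_left (hmean x hx hx0 Y hY) hc.le
  linarith

end IsConcaveRate

end Sensitivity

/-- The normalized truncated mean `E[min (W, y)] / y` of a weight `W` with law `π`. The inverse of
`N` is its value at the order of magnitude of the total of `N` weights. -/
noncomputable def truncRatio (π : Measure ℝ≥0) (y : ℝ) : ℝ := ∫ w, min (w : ℝ) y / y ∂π

section TruncRatio

variable {π : Measure ℝ≥0} {α : ℝ} {y y' : ℝ}

lemma truncRatio_eq (π : Measure ℝ≥0) (y : ℝ) : truncRatio π y = truncMean π y / y :=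
  integral_div _ _

lemma mul_truncRatio (hy : y ≠ 0) : y * truncRatio π y = truncMean π y := by
  rw [truncRatio_eq, mul_div_cancel₀ _ hy]

lemma min_div_nonneg (w : ℝ≥0) (hy : 0 ≤ y) : 0 ≤ min (w : ℝ) y / y :=
  div_nonneg (le_min w.2 hy) hy

lemma min_div_le_one (w : ℝ≥0) (hy : 0 ≤ y) : min (w : ℝ) y / y ≤ 1 :=
  div_le_one_of_le₀ (min_le_right _ _) hy

lemma min_div_anti (w : ℝ≥0) (hy : 0 < y) (hyy : y ≤ y') :
    min (w : ℝ) y' / y' ≤ min (w : ℝ) y / y := by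
  have hy' : 0 < y' := hy.trans_le hyy
  rw [← min_div_div_right hy'.le, ← min_div_div_right hy.le, div_self hy.ne', div_self hy'.ne']
  gcongr

lemma truncRatio_nonneg (hy : 0 ≤ y) : 0 ≤ truncRatio π y :=
  integral_nonneg fun w => min_div_nonneg w hy

variable [IsProbabilityMeasure π]

lemma truncMean_mono (hy : 0 ≤ y) (hyy : y ≤ y') : truncMean π y ≤ truncMean π y' :=
  integral_mono (integrable_min hy) (integrable_min (hy.trans hyy)) fun _ =>
    min_le_min le_rfl hyy

lemma integrable_min_div (hy : 0 ≤ y) : Integrable (fun w : ℝ≥0 => min (w : ℝ) y / y) π :=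
  (integrable_min hy).div_const y

lemma truncRatio_antitoneOn : AntitoneOn (truncRatio π) (Set.Ioi 0) := fun _ hy _ hy' hyy =>
  integral_mono (integrable_min_div (Set.mem_Ioi.1 hy').le)
    (integrable_min_div (Set.mem_Ioi.1 hy).le) fun w => min_div_anti w hy hyy

lemma tailFn_le_truncRatio (hy : 0 < y) : tailFn π y ≤ truncRatio π y := by
  rw [truncRatio_eq, le_div_iff₀' hy]
  exact mul_tailFn_le_truncMean hy.le

lemma continuousOn_truncRatio : ContinuousOn (truncRatio π) (Set.Ioi 0) := by
  refine continuousOn_of_dominated (bound := fun _ => 1) (fun y hy =>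
    (integrable_min_div (Set.mem_Ioi.1 hy).le).aestronglyMeasurable)
    (fun y hy => ae_of_all _ fun w => ?_) (integrable_const 1) (ae_of_all _ fun w => ?_)
  · rw [Real.norm_of_nonneg (min_div_nonneg w (Set.mem_Ioi.1 hy).le)]
    exact min_div_le_one w (Set.mem_Ioi.1 hy).le
  · exact ContinuousOn.div (by fun_prop) (by fun_prop) fun y hy => (Set.mem_Ioi.1 hy).ne'

lemma tendsto_truncRatio : Tendsto (truncRatio π) atTop (𝓝 0) := by
  rw [show (0 : ℝ) = ∫ _ : ℝ≥0, (0 : ℝ) ∂π by simp]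
  refine tendsto_integral_filter_of_dominated_convergence (fun _ => 1)
    (.of_forall fun y => Measurable.aestronglyMeasurable (by fun_prop)) ?_
    (integrable_const 1) (ae_of_all _ fun w => ?_)
  · filter_upwards [eventually_ge_atTop 0] with y hy
    refine ae_of_all _ fun w => ?_
    rw [Real.norm_of_nonneg (min_div_nonneg w hy)]
    exact min_div_le_one w hy
  · refine squeeze_zero' ?_ ?_ (tendsto_const_nhds.div_atTop tendsto_id : Tendsto
      (fun y : ℝ => (w : ℝ) / y) atTop (𝓝 0))
    · filter_upwards [eventually_ge_atTop 0] with y hy using min_div_nonneg w hy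
    · filter_upwards [eventually_ge_atTop 0] with y hy
      gcongr
      exact min_le_left _ _

lemma exists_mul_truncRatio_eq_one {N : ℕ} {y₀ : ℝ} (hy₀ : 0 < y₀)
    (hN : 1 ≤ N * truncRatio π y₀) : ∃ τ ≥ y₀, N * truncRatio π τ = 1 := by
  have hlim : Tendsto (fun y => N * truncRatio π y) atTop (𝓝 (N * 0)) :=
    tendsto_truncRatio.const_mul _
  rw [mul_zero] at hlim
  obtain ⟨b, hb, hyb⟩ := ((hlim.eventually_le_const one_pos).and (eventually_ge_atTop y₀)).exists
  have hcont : ContinuousOn (fun y => N * truncRatio π y) (Set.Icc y₀ b) :=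
    continuousOn_const.mul (continuousOn_truncRatio.mono fun _ hy => hy₀.trans_le hy.1)
  obtain ⟨τ, hτ, hτ1⟩ := intermediate_value_Icc' hyb hcont ⟨hb, hN⟩
  exact ⟨τ, hτ.1, hτ1⟩

lemma max_zero_min_inv_mul (w : ℝ≥0) (hy : 0 < y) :
    max 0 (min (y⁻¹ * w) 1) = min (w : ℝ) y / y := by
  rw [max_eq_right (le_min (by positivity) zero_le_one), ← min_div_div_right hy.le,
    div_self hy.ne', inv_mul_eq_div]

/-- This is the sensitivity of the rate `z ↦ min z 1`. -/
lemma exists_truncRatio_growth (hRV : HasRVTail π α) (hα : 0 < α)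
    (hinf : ¬ Integrable (fun w : ℝ≥0 => (w : ℝ)) π) :
    ∃ c > 0, ∃ M > 0, ∀ y ≥ M, (1 + c) * truncRatio π y ≤ truncRatio π (y / 2) := by
  obtain ⟨c, hc, x₀, hx₀, M, hM, hsens⟩ :=
    isConcaveRate_min_one.exists_sensitivity hRV hα hinf one_lt_two
  refine ⟨c, hc, max M x₀⁻¹, by positivity, fun y hy => ?_⟩
  obtain ⟨hyM, hyx⟩ := max_le_iff.1 hy
  have hy0 : 0 < y := hM.trans_le hyM
  have hmean : rateMean π (fun z => max 0 (min z 1)) y⁻¹ y = truncRatio π y := by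
    refine integral_congr_ae (ae_of_all _ fun w => ?_)
    have hmin := max_zero_min_inv_mul (min w y.toNNReal) hy0
    simpa [hy0.le] using hmin
  have hincr (w : ℝ≥0) : rateIncr (fun z => max 0 (min z 1)) 2 y⁻¹ y w ≤
      min (w : ℝ) (y / 2) / (y / 2) - min (w : ℝ) y / y := by
    rcases le_or_gt (w : ℝ) y with hw | hw
    · rw [rateIncr_of_le hw, max_zero_min_inv_mul w hy0,
        show 2 * (y⁻¹ * (w : ℝ)) = (y / 2)⁻¹ * w by field_simp,
        max_zero_min_inv_mul w (half_pos hy0)]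
    · rw [rateIncr_of_gt hw]
      exact sub_nonneg.2 (min_div_anti w (half_pos hy0) (half_le_self hy0.le))
  have hint := integrable_min_div (π := π) (half_pos hy0).le
  have hdiff : ∫ w, rateIncr (fun z => max 0 (min z 1)) 2 y⁻¹ y w ∂π ≤
      truncRatio π (y / 2) - truncRatio π y := by
    rw [truncRatio, truncRatio, ← integral_sub hint (integrable_min_div hy0.le)]
    exact integral_mono (isConcaveRate_min_one.integrable_rateIncr one_le_two (by positivity) y)
      (hint.sub (integrable_min_div hy0.le)) hincr
  have hgrow := hsens y⁻¹ (by positivity) (inv_le_of_inv_le₀ hx₀ hyx) y hyM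
  rw [hmean] at hgrow
  linarith

lemma exists_truncRatio_growth_rpow (hRV : HasRVTail π α) (hα : 0 < α)
    (hinf : ¬ Integrable (fun w : ℝ≥0 => (w : ℝ)) π) :
    ∃ β > (0 : ℝ), ∃ a > (0 : ℝ), ∃ M > (0 : ℝ), ∀ u ≥ (1 : ℝ), ∀ y, M * u ≤ y →
      a * u ^ β * truncRatio π y ≤ truncRatio π (y / u) := by
  obtain ⟨c, hc, M, hM, hgrow⟩ := exists_truncRatio_growth hRV hα hinf
  have hβ : 0 < Real.logb 2 (1 + c) := Real.logb_pos one_lt_two (by linarith)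
  refine ⟨Real.logb 2 (1 + c), hβ, 2 ^ (-Real.logb 2 (1 + c)), by positivity, M, hM,
    fun u hu y hy => ?_⟩
  refine rpow_mul_le_of_half truncRatio_antitoneOn hM hβ.le (fun z hz => ?_) hu hy
    (truncRatio_nonneg ((by positivity : 0 ≤ M * u).trans hy))
  rw [Real.rpow_logb two_pos (by norm_num) (by linarith)]
  exact hgrow z hz

end TruncRatio

section TotalWeight

variable {Ω : Type*} [MeasurableSpace Ω] {μ : Measure Ω} [IsProbabilityMeasure μ]
  {X : ℕ → Ω → ℝ≥0} {π : Measure ℝ≥0} {α y : ℝ}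

lemma measure_total_lt_le (hX : ∀ i, HasLaw (X i) π μ) (hind : iIndepFun X μ) {N : ℕ}
    (hy : 0 < y) (hq : 1 ≤ N * truncRatio π y) :
    μ.real {ω | ∑ i : Fin N, (X i ω : ℝ) < y / 2} ≤ 4 / (N * truncRatio π y) := by
  have htrunc : {ω | ∑ i : Fin N, (X i ω : ℝ) < y / 2} ⊆
      {ω | ∑ i : Fin N, min (X i ω : ℝ) y / y < N * truncRatio π y / 2} := by
    intro ω hω
    simp only [Set.mem_ofPred_eq, ← Finset.sum_div] at hω ⊢
    have hmin : ∑ i : Fin N, min (X i ω : ℝ) y ≤ ∑ i : Fin N, (X i ω : ℝ) :=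
      Finset.sum_le_sum fun i _ => min_le_left _ _
    rw [div_lt_iff₀ hy]
    nlinarith
  calc μ.real {ω | ∑ i : Fin N, (X i ω : ℝ) < y / 2}
      ≤ μ.real {ω | ∑ i : Fin N, min (X i ω : ℝ) y / y < N * truncRatio π y / 2} :=
        measureReal_mono htrunc
    _ ≤ 4 * 1 / (N * truncRatio π y) :=
      measure_sum_lt_half_le hX hind (f := fun w : ℝ≥0 => min (w : ℝ) y / y) (by fun_prop)
        (fun w => min_div_nonneg w hy.le) (fun w => min_div_le_one w hy.le) N
        (zero_lt_one.trans_le hq)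
    _ = 4 / (N * truncRatio π y) := by rw [mul_one]

variable [IsProbabilityMeasure π]

lemma measure_total_gt_le (hX : ∀ i, HasLaw (X i) π μ) (N : ℕ) (hy : 0 < y) :
    μ.real {ω | y < ∑ i : Fin N, (X i ω : ℝ)} ≤ 2 * (N * truncRatio π y) := by
  have htrunc : {ω | y < ∑ i : Fin N, (X i ω : ℝ)} ⊆
      {ω | 1 / 2 < ∑ i : Fin N, min (X i ω : ℝ) y / y} := by
    intro ω hω
    simp only [Set.mem_ofPred_eq, ← Finset.sum_div, lt_div_iff₀ hy] at hω ⊢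
    by_cases hall : ∀ i : Fin N, (X i ω : ℝ) ≤ y
    · rw [Finset.sum_congr rfl fun i _ => min_eq_left (hall i)]
      linarith
    · push Not at hall
      obtain ⟨i, hi⟩ := hall
      have hsingle := Finset.single_le_sum (f := fun i : Fin N => min (X i ω : ℝ) y)
        (fun i _ => le_min (X i ω).2 hy.le) (Finset.mem_univ i)
      rw [min_eq_right hi.le] at hsingle
      linarith
  calc μ.real {ω | y < ∑ i : Fin N, (X i ω : ℝ)}
      ≤ μ.real {ω | 1 / 2 < ∑ i : Fin N, min (X i ω : ℝ) y / y} := measureReal_mono htrunc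
    _ ≤ N * truncRatio π y / (1 / 2) :=
      measure_sum_gt_le hX (f := fun w : ℝ≥0 => min (w : ℝ) y / y) (by fun_prop)
        (integrable_min_div hy.le) (fun w => min_div_nonneg w hy.le) N (by norm_num)
    _ = 2 * (N * truncRatio π y) := by ring

lemma exists_le_mul_truncRatio_div (hRV : HasRVTail π α) (hα : 0 < α)
    (hinf : ¬ Integrable (fun w : ℝ≥0 => (w : ℝ)) π) (Q : ℝ) :
    ∃ K ≥ 1, ∃ M > 0, ∀ (N : ℕ) (τ : ℝ), M ≤ τ →
      Q * (N * truncRatio π τ) ≤ N * truncRatio π (τ / K) := by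
  obtain ⟨β, hβ, a, ha, M, hM, hgrow⟩ := exists_truncRatio_growth_rpow hRV hα hinf
  obtain ⟨K, hQ, hK⟩ := (((tendsto_rpow_atTop hβ).const_mul_atTop ha).eventually_ge_atTop Q
    |>.and (eventually_ge_atTop 1)).exists
  refine ⟨K, hK, M * K, by positivity, fun N τ hτ => ?_⟩
  have hτ0 : 0 ≤ truncRatio π τ := truncRatio_nonneg ((by positivity : 0 ≤ M * K).trans hτ)
  calc Q * (N * truncRatio π τ) ≤ a * K ^ β * (N * truncRatio π τ) := by gcongr
    _ = N * (a * K ^ β * truncRatio π τ) := by ring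
    _ ≤ N * truncRatio π (τ / K) := by gcongr; exact hgrow K hK τ hτ

lemma exists_measure_total_le (hX : ∀ i, HasLaw (X i) π μ) (hind : iIndepFun X μ)
    (hRV : HasRVTail π α) (hα : 0 < α) (hinf : ¬ Integrable (fun w : ℝ≥0 => (w : ℝ)) π)
    {ε : ℝ} (hε : 0 < ε) :
    ∃ K ≥ 1, ∃ M > 0, ∀ (N : ℕ) (τ : ℝ), M ≤ τ → N * truncRatio π τ = 1 →
      μ.real {ω | ∑ i : Fin N, (X i ω : ℝ) < τ / (2 * K)} ≤ ε ∧
      μ.real {ω | 2 * K * τ < ∑ i : Fin N, (X i ω : ℝ)} ≤ ε := by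
  obtain ⟨K, hK, M, hM, hgrow⟩ := exists_le_mul_truncRatio_div hRV hα hinf (max 1 (4 / ε))
  have hK0 : 0 < K := by linarith
  refine ⟨K, hK, M, hM, fun N τ hMτ hτ => ?_⟩
  have hτ0 : 0 < τ := hM.trans_le hMτ
  constructor
  · have hbig := hgrow N τ hMτ
    rw [hτ, mul_one, max_le_iff] at hbig
    rw [mul_comm 2 K, ← div_div]
    refine (measure_total_lt_le hX hind (by positivity) hbig.1).trans ?_
    exact (div_le_comm₀ hε (zero_lt_one.trans_le hbig.1)).1 hbig.2
  · have hbig := hgrow N (K * τ) (hMτ.trans (le_mul_of_one_le_left hτ0.le hK))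
    rw [mul_div_cancel_left₀ _ hK0.ne', hτ] at hbig
    have hsmall : 4 / ε * (N * truncRatio π (K * τ)) ≤ 1 := by
      refine le_trans (mul_le_mul_of_nonneg_right (le_max_right _ _) ?_) hbig
      exact mul_nonneg N.cast_nonneg (truncRatio_nonneg (by positivity))
    have hanti : N * truncRatio π (2 * K * τ) ≤ N * truncRatio π (K * τ) := by
      gcongr
      refine truncRatio_antitoneOn (Set.mem_Ioi.2 (by positivity)) (Set.mem_Ioi.2 (by positivity))
        ?_
      nlinarith
    refine (measure_total_gt_le hX N (by positivity)).trans ?_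
    rw [div_mul_eq_mul_div, div_le_one hε] at hsmall
    linarith [mul_nonneg N.cast_nonneg (truncRatio_nonneg (π := π) (y := K * τ) (by positivity))]

end TotalWeight

/-- The sum of the rates of the weights `x` at scale `y`. At `y = x i / ∑ k, x k` it is the
conditional mean degree of node `i`. -/
noncomputable def rateSum {N : ℕ} (h : ℝ → ℝ) (y : ℝ) (x : Fin N → ℝ≥0) : ℝ := ∑ j, h (y * x j)

/-- The weights `x` have typical rates at scale `y` when, up to the constants `c / 2` and `R`, the
sums of the rate increments and of the truncated rates are of the order of the expected sum of
truncated rates. -/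
structure HasTypicalRates {N : ℕ} (π : Measure ℝ≥0) (h : ℝ → ℝ) (s c R Y y : ℝ)
    (x : Fin N → ℝ≥0) : Prop where
  le_incr : N * (c * rateMean π h y Y) / 2 ≤ ∑ j, rateIncr h s y Y (x j)
  trunc_le : ∑ j, h (y * min (x j : ℝ) Y) ≤ R * (N * rateMean π h y Y)

section RateSum

variable {π : Measure ℝ≥0} {h : ℝ → ℝ} {N : ℕ} {x : Fin N → ℝ≥0} {s c R B y Y : ℝ}

lemma meanDegree_eq_rateSum (G : ℝ≥0 → ℝ≥0) (x : Fin N → ℝ≥0) (i : Fin N) :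
    (meanDegree G x i : ℝ) = rateSum (fun z => (G z.toNNReal : ℝ)) (x i / ∑ k, (x k : ℝ)) x := by
  rw [meanDegree, rateSum, NNReal.coe_sum]
  refine Finset.sum_congr rfl fun j _ => ?_
  have hcast : (x i / ∑ k, (x k : ℝ)) * x j = ((x i * x j / ∑ k, x k : ℝ≥0) : ℝ) := by
    push_cast
    ring
  simp only [hcast, Real.toNNReal_coe]

namespace IsConcaveRate

lemma rateSum_mono (hh : IsConcaveRate h) (x : Fin N → ℝ≥0) :
    Monotone fun y => rateSum h y x := fun _ _ hyy =>
  Finset.sum_le_sum fun _ _ => hh.mono (mul_le_mul_of_nonneg_right hyy (NNReal.coe_nonneg _))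

lemma rateSum_nonneg (hh : IsConcaveRate h) (y : ℝ) (x : Fin N → ℝ≥0) : 0 ≤ rateSum h y x :=
  Finset.sum_nonneg fun _ _ => hh.nonneg _

lemma sum_rateIncr_le (hh : IsConcaveRate h) (hs : 1 ≤ s) (hy : 0 ≤ y) (Y : ℝ)
    (x : Fin N → ℝ≥0) :
    ∑ j, rateIncr h s y Y (x j) ≤ rateSum h (s * y) x - rateSum h y x := by
  rw [rateSum, rateSum, ← Finset.sum_sub_distrib]
  refine Finset.sum_le_sum fun j _ => ?_
  rcases le_or_gt (x j : ℝ) Y with hw | hw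
  · rw [rateIncr_of_le hw, mul_assoc]
  · rw [rateIncr_of_gt hw, sub_nonneg]
    exact hh.mono (by gcongr; exact le_mul_of_one_le_left hy hs)

lemma rateSum_le (hh : IsConcaveRate h) (hy : 0 ≤ y) (hY : 0 < Y) (x : Fin N → ℝ≥0) :
    rateSum h y x ≤ ∑ j, h (y * min (x j : ℝ) Y) + h (y * Y) / Y * ∑ j, (x j : ℝ) := by
  rw [Finset.mul_sum, ← Finset.sum_add_distrib]
  refine Finset.sum_le_sum fun j _ => ?_
  have hYn := hh.nonneg (y * Y)
  rcases le_or_gt (x j : ℝ) Y with hw | hw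
  · rw [min_eq_left hw]
    exact le_add_of_nonneg_right (by positivity)
  · have hscale := hh.mul_le (s := x j / Y) (z := y * Y) ((one_le_div hY).2 hw.le)
      (by positivity)
    rw [show (x j : ℝ) / Y * (y * Y) = y * x j by field_simp] at hscale
    calc h (y * x j) ≤ x j / Y * h (y * Y) := hscale
      _ = h (y * Y) / Y * x j := by ring
      _ ≤ _ := le_add_of_nonneg_left (hh.nonneg _)

variable [IsFiniteMeasure π]

lemma rateMean_mono (hh : IsConcaveRate h) {y' : ℝ} (hy : 0 ≤ y) (hyy : y ≤ y') (hY : 0 ≤ Y) :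
    rateMean π h y Y ≤ rateMean π h y' Y :=
  integral_mono (hh.integrable hy Y) (hh.integrable (hy.trans hyy) Y) fun w =>
    hh.mono (mul_le_mul_of_nonneg_right hyy (le_min w.coe_nonneg hY))

lemma mul_truncRatio_le (hh : IsConcaveRate h) (hy : 0 ≤ y) (hY : 0 < Y) :
    h (y * Y) * truncRatio π Y ≤ rateMean π h y Y := by
  rw [truncRatio, ← integral_const_mul, rateMean]
  refine integral_mono (((integrable_min hY.le).div_const Y).const_mul _) (hh.integrable hy Y)
    fun w => ?_
  change h (y * Y) * (min (w : ℝ) Y / Y) ≤ h (y * min (w : ℝ) Y)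
  rw [mul_div_assoc', div_le_iff₀ hY]
  rcases hy.eq_or_lt with rfl | hy
  · simp [hh.zero 0 le_rfl]
  have hstar := hh.star (y * min (w : ℝ) Y) (y * Y)
    (mul_nonneg hy.le (le_min w.coe_nonneg hY.le)) (by gcongr; exact min_le_right _ _)
  exact le_of_mul_le_mul_left (by linarith) hy

lemma mul_truncRatio_inv_le (hh : IsConcaveRate h) (hy : 0 < y) (hyY : 1 ≤ y * Y) :
    h 1 * truncRatio π y⁻¹ ≤ rateMean π h y Y := by
  have hY : y⁻¹ ≤ Y := by rwa [inv_le_iff_one_le_mul₀ hy, mul_comm]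
  have htrunc := hh.mul_truncRatio_le (π := π) hy.le (inv_pos.2 hy)
  rw [mul_inv_cancel₀ hy.ne'] at htrunc
  refine htrunc.trans (integral_mono (hh.integrable hy.le _) (hh.integrable hy.le _) fun w => ?_)
  exact hh.mono (mul_le_mul_of_nonneg_left (min_le_min_left _ hY) hy.le)

end IsConcaveRate

namespace HasTypicalRates

lemma le_rateSum (hx : HasTypicalRates π h s c R Y y x) (hh : IsConcaveRate h) (hs : 1 ≤ s)
    (hy : 0 ≤ y) : rateSum h y x + c * (N * rateMean π h y Y) / 2 ≤ rateSum h (s * y) x := by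
  linarith [hx.le_incr, hh.sum_rateIncr_le hs hy Y x]

lemma rateSum_le [IsFiniteMeasure π] (hx : HasTypicalRates π h s c R Y y x)
    (hh : IsConcaveRate h) (hy : 0 ≤ y) (hY : 0 < Y) (hN : 1 ≤ N * truncRatio π Y)
    (hB : ∑ j, (x j : ℝ) ≤ B) :
    rateSum h y x ≤ (R + B / Y) * (N * rateMean π h y Y) := by
  have hlarge : h (y * Y) ≤ N * rateMean π h y Y := by
    calc h (y * Y) ≤ h (y * Y) * (N * truncRatio π Y) :=
          le_mul_of_one_le_right (hh.nonneg _) hN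
      _ = N * (h (y * Y) * truncRatio π Y) := by ring
      _ ≤ N * rateMean π h y Y := by gcongr; exact hh.mul_truncRatio_le hy hY
  have hmean : 0 ≤ N * rateMean π h y Y := (hh.nonneg _).trans hlarge
  calc rateSum h y x ≤ ∑ j, h (y * min (x j : ℝ) Y) + h (y * Y) / Y * ∑ j, (x j : ℝ) :=
        hh.rateSum_le hy hY x
    _ ≤ R * (N * rateMean π h y Y) + N * rateMean π h y Y / Y * B := by
        gcongr
        exact hx.trunc_le
    _ = (R + B / Y) * (N * rateMean π h y Y) := by ring

lemma rateSum_mul_le [IsFiniteMeasure π] (hx : HasTypicalRates π h s c R Y y x)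
    (hh : IsConcaveRate h) (hs : 1 ≤ s) (hc : 0 < c) (hR : 0 < R) (hy : 0 ≤ y) (hY : 0 < Y)
    (hN : 1 ≤ N * truncRatio π Y) (hB : ∑ j, (x j : ℝ) ≤ B) :
    rateSum h y x * (1 + c / (2 * (R + B / Y))) ≤ rateSum h (s * y) x := by
  have hB0 : 0 ≤ B := (Finset.sum_nonneg fun j _ => (x j).coe_nonneg).trans hB
  calc rateSum h y x * (1 + c / (2 * (R + B / Y)))
      = rateSum h y x + rateSum h y x * (c / (2 * (R + B / Y))) := by ring
    _ ≤ rateSum h y x +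
        (R + B / Y) * (N * rateMean π h y Y) * (c / (2 * (R + B / Y))) := by
        gcongr
        exact hx.rateSum_le hh hy hY hN hB
    _ = rateSum h y x + c * (N * rateMean π h y Y) / 2 := by
        field_simp
    _ ≤ rateSum h (s * y) x := hx.le_rateSum hh hs hy

end HasTypicalRates

end RateSum

lemma measure_not_hasTypicalRates_le {Ω : Type*} [MeasurableSpace Ω] {μ : Measure Ω}
    [IsProbabilityMeasure μ] {X : ℕ → Ω → ℝ≥0} {π : Measure ℝ≥0} [IsFiniteMeasure π] {h : ℝ → ℝ}
    {s c R y Y : ℝ} (hX : ∀ i, HasLaw (X i) π μ) (hind : iIndepFun X μ) (hh : IsConcaveRate h)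
    {N : ℕ} (hs : 1 ≤ s) (hc : 0 < c) (hR : 0 < R) (hy : 0 < y) (hY : 0 < Y)
    (hsens : c * rateMean π h y Y ≤ ∫ w, rateIncr h s y Y w ∂π)
    (hN : 0 < N * truncRatio π Y) :
    μ.real {ω | ¬ HasTypicalRates π h s c R Y y fun i : Fin N => X i ω} ≤
      4 * s / (c * (N * truncRatio π Y)) + 1 / R := by
  have hpos : 0 < h (y * Y) := hh.pos (by positivity)
  have hmean : h (y * Y) * (N * truncRatio π Y) ≤ N * rateMean π h y Y := by
    rw [mul_left_comm]
    exact mul_le_mul_of_nonneg_left (hh.mul_truncRatio_le hy.le hY) N.cast_nonneg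
  have hmean0 : 0 < N * rateMean π h y Y := (mul_pos hpos hN).trans_le hmean
  have hincr : c * (N * rateMean π h y Y) ≤ N * ∫ w, rateIncr h s y Y w ∂π := by
    rw [mul_left_comm]
    exact mul_le_mul_of_nonneg_left hsens N.cast_nonneg
  have hlow : μ.real {ω | ∑ j : Fin N, rateIncr h s y Y (X j ω) <
      N * (∫ w, rateIncr h s y Y w ∂π) / 2} ≤ 4 * s / (c * (N * truncRatio π Y)) := by
    calc _ ≤ 4 * (s * h (y * Y)) / (N * ∫ w, rateIncr h s y Y w ∂π) :=
          measure_sum_lt_half_le hX hind (hh.measurable_rateIncr s y Y)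
            (hh.rateIncr_nonneg hs hy.le Y) (hh.rateIncr_le hs hy.le Y) N
            ((mul_pos hc hmean0).trans_le hincr)
      _ ≤ 4 * (s * h (y * Y)) / (c * (h (y * Y) * (N * truncRatio π Y))) := by
          exact div_le_div_of_nonneg_left (by positivity) (by positivity)
            ((mul_le_mul_of_nonneg_left hmean hc.le).trans hincr)
      _ = 4 * s / (c * (N * truncRatio π Y)) := by field_simp
  have hhigh : μ.real {ω | R * (N * rateMean π h y Y) <
      ∑ j : Fin N, h (y * min (X j ω : ℝ) Y)} ≤ 1 / R :=
    (measure_sum_gt_le hX (f := fun w : ℝ≥0 => h (y * min (w : ℝ) Y))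
      (hh.continuous.measurable.comp (by fun_prop)) (hh.integrable hy.le Y)
      (fun w => hh.nonneg _) N (mul_pos hR hmean0)).trans_eq
      (by rw [← rateMean, div_mul_cancel_right₀ hmean0.ne', one_div])
  refine (measureReal_mono ?_).trans
    ((measureReal_union_le _ _).trans (add_le_add hlow hhigh))
  intro ω hω
  by_contra hcon
  simp only [Set.mem_union, Set.mem_ofPred_eq, not_or, not_lt] at hcon
  exact hω ⟨by linarith [hcon.1], hcon.2⟩

lemma exists_grid_point {s lo hi u T : ℝ} {J : ℕ} (hs : 1 < s) (hlo : 0 < lo) (hu : 0 < u)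
    (hJ : hi / lo < s ^ J) (hloT : lo ≤ T) (hThi : T ≤ hi) :
    ∃ k ≤ J, u / T ≤ s ^ (k + 1) * (u / hi) ∧ s ^ (k + 1) * (u / hi) ≤ s * (u / T) := by
  have hT : 0 < T := hlo.trans_le hloT
  have hhi : 0 < hi := hT.trans_le hThi
  obtain ⟨k, hk, hk'⟩ := exists_nat_pow_near ((one_le_div hT).2 hThi) hs
  refine ⟨k, ?_, ?_, ?_⟩
  · have hkJ : s ^ k < s ^ J := hk.trans_lt (hJ.trans_le' (by gcongr))
    exact ((pow_lt_pow_iff_right₀ hs).1 hkJ).le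
  · calc u / T = hi / T * (u / hi) := by field_simp
      _ ≤ s ^ (k + 1) * (u / hi) := by gcongr
  · calc s ^ (k + 1) * (u / hi) = s * (s ^ k * (u / hi)) := by ring
      _ ≤ s * (hi / T * (u / hi)) := by gcongr
      _ = s * (u / T) := by field_simp

/-- The weights `x` are typical at weight `u` when their total lies in `[lo, hi]` and they have
typical rates on the geometric grid `s ^ (k + 1) * (u / hi)`, `k ≤ J`, which is to contain a point
near the scale `u / ∑ j, x j` of a node of weight `u`. -/
structure IsTypical {N : ℕ} (π : Measure ℝ≥0) (h : ℝ → ℝ) (s c R Y : ℝ) (J : ℕ) (lo hi u : ℝ)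
    (x : Fin N → ℝ≥0) : Prop where
  le_total : lo ≤ ∑ j, (x j : ℝ)
  total_le : ∑ j, (x j : ℝ) ≤ hi
  rates : ∀ k ≤ J, HasTypicalRates π h s c R Y (s ^ (k + 1) * (u / hi)) x

section Separation

variable {π : Measure ℝ≥0} {N J : ℕ} {x : Fin N → ℝ≥0} {s c R Y lo hi u : ℝ}

lemma isSeparated_of_rateSum {G : ℝ≥0 → ℝ≥0} (hh : IsConcaveRate fun z => (G z.toNNReal : ℝ))
    {q y κmin : ℝ} (hq : 0 < q) (hT : 0 < ∑ i, (x i : ℝ)) (hs : 0 < s)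
    (hy : u / ∑ i, (x i : ℝ) ≤ y) (hy' : y ≤ s * (u / ∑ i, (x i : ℝ)))
    (hgrow : rateSum (fun z => (G z.toNNReal : ℝ)) y x * (q * q) ≤
      rateSum (fun z => (G z.toNNReal : ℝ)) (s * y) x)
    (hκ : κmin * q ≤ rateSum (fun z => (G z.toNNReal : ℝ)) (s * y) x) :
    IsSeparated G u (s * s * u) (q - 1) κmin
      (rateSum (fun z => (G z.toNNReal : ℝ)) (s * s * (u / ∑ k, (x k : ℝ))) x / q) x := by
  have hmono := hh.rateSum_mono x
  have hsy : s * y ≤ s * s * (u / ∑ i, (x i : ℝ)) := by rw [mul_assoc]; gcongr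
  refine ⟨(le_div_iff₀ hq).2 (hκ.trans (hmono hsy)), fun i => ⟨fun hi => ?_, fun hi => ?_⟩⟩
  · rw [add_sub_cancel, meanDegree_eq_rateSum, le_div_iff₀ hq, mul_assoc]
    refine le_trans ?_ (hgrow.trans (hmono hsy))
    gcongr
    refine hmono (le_trans ?_ hy)
    gcongr
  · rw [add_sub_cancel, meanDegree_eq_rateSum, div_mul_cancel₀ _ hq.ne']
    refine hmono ?_
    rw [mul_div_assoc']
    gcongr

lemma IsTypical.isSeparated [IsFiniteMeasure π] {G : ℝ≥0 → ℝ≥0}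
    (hx : IsTypical π (fun z => (G z.toNNReal : ℝ)) s c R Y J lo hi u x)
    (hh : IsConcaveRate fun z => (G z.toNNReal : ℝ)) (hs : 1 < s) (hc : 0 < c) (hR : 0 < R)
    (hY : 0 < Y) (hlo : 0 < lo) (hu : 0 < u) (hJ : hi / lo < s ^ J)
    (hN : 1 ≤ N * truncRatio π Y) {q κmin : ℝ} (hq : 0 < q)
    (hqq : q * q = 1 + c / (2 * (R + hi / Y)))
    (hκ : κmin * q ≤ c * (N * rateMean π (fun z => (G z.toNNReal : ℝ)) (u / hi) Y) / 2) :
    IsSeparated G u (s * s * u) (q - 1) κmin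
      (rateSum (fun z => (G z.toNNReal : ℝ)) (s * s * (u / ∑ k, (x k : ℝ))) x / q) x := by
  have hT : 0 < ∑ j, (x j : ℝ) := hlo.trans_le hx.le_total
  have hhi : 0 < hi := hT.trans_le hx.total_le
  obtain ⟨k, hkJ, hk, hk'⟩ := exists_grid_point hs hlo hu hJ hx.le_total hx.total_le
  have hy : u / hi ≤ s ^ (k + 1) * (u / hi) :=
    le_mul_of_one_le_left (by positivity) (one_le_pow₀ hs.le)
  have hy0 : 0 ≤ s ^ (k + 1) * (u / hi) := hy.trans' (by positivity)
  have hrates := hx.rates k hkJ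
  refine isSeparated_of_rateSum hh hq hT (zero_lt_one.trans hs) hk hk' ?_ (hκ.trans ?_)
  · rw [hqq]
    exact hrates.rateSum_mul_le hh hs.le hc hR hy0 hY hN hx.total_le
  · refine le_trans ?_ ((le_add_of_nonneg_left (hh.rateSum_nonneg _ x)).trans
      (hrates.le_rateSum hh hs.le hy0))
    gcongr
    exact hh.rateMean_mono (by positivity) hy hY.le

variable {Ω : Type*} [MeasurableSpace Ω] {μ : Measure Ω} [IsProbabilityMeasure μ]
  {X : ℕ → Ω → ℝ≥0} {h : ℝ → ℝ} {α : ℝ}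

lemma measure_not_isTypical_le {ε : ℝ}
    (hlo : μ.real {ω | ∑ i : Fin N, (X i ω : ℝ) < lo} ≤ ε)
    (hhi : μ.real {ω | hi < ∑ i : Fin N, (X i ω : ℝ)} ≤ ε)
    (hrates : ∀ k ≤ J, μ.real {ω | ¬ HasTypicalRates π h s c R Y (s ^ (k + 1) * (u / hi))
      fun i : Fin N => X i ω} ≤ ε / (J + 1)) :
    μ.real {ω | ¬ IsTypical π h s c R Y J lo hi u fun i : Fin N => X i ω} ≤ 3 * ε := by
  have hgrid : μ.real (⋃ k ∈ Finset.range (J + 1), {ω | ¬ HasTypicalRates π h s c R Y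
      (s ^ (k + 1) * (u / hi)) fun i : Fin N => X i ω}) ≤ ε := by
    refine (measureReal_biUnion_finset_le _ _).trans ((Finset.sum_le_card_nsmul _ _ _ fun k hk =>
      hrates k (Finset.mem_range_succ_iff.1 hk)).trans_eq ?_)
    rw [Finset.card_range, nsmul_eq_mul, Nat.cast_succ]
    field_simp
  have hsub : {ω | ¬ IsTypical π h s c R Y J lo hi u fun i : Fin N => X i ω} ⊆
      {ω | ∑ i : Fin N, (X i ω : ℝ) < lo} ∪ {ω | hi < ∑ i : Fin N, (X i ω : ℝ)} ∪
      ⋃ k ∈ Finset.range (J + 1), {ω | ¬ HasTypicalRates π h s c R Y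
        (s ^ (k + 1) * (u / hi)) fun i : Fin N => X i ω} := by
    intro ω hω
    by_contra hcon
    simp only [Set.mem_union, Set.mem_ofPred_eq, Set.mem_iUnion, Finset.mem_range_succ_iff,
      not_or, not_lt, not_exists, not_not] at hcon
    exact hω ⟨hcon.1.1, hcon.1.2, hcon.2⟩
  refine (measureReal_mono hsub).trans ((measureReal_union_le _ _).trans
    ((add_le_add ((measureReal_union_le _ _).trans (add_le_add hlo hhi)) hgrid).trans_eq ?_))
  ring

lemma exists_measure_not_isTypical_le [IsProbabilityMeasure π] (hX : ∀ i, HasLaw (X i) π μ)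
    (hind : iIndepFun X μ) (hRV : HasRVTail π α) (hα : 0 < α)
    (hinf : ¬ Integrable (fun w : ℝ≥0 => (w : ℝ)) π) (hh : IsConcaveRate h) (hs : 1 < s)
    {ε : ℝ} (hε : 0 < ε) :
    ∃ c > (0 : ℝ), ∃ R > (0 : ℝ), ∃ B ≥ (1 : ℝ), ∃ J : ℕ, ∃ K ≥ (1 : ℝ), ∃ M > (0 : ℝ),
      B ^ 2 < s ^ J ∧ ∀ (N : ℕ) (τ u : ℝ), N * truncRatio π τ = 1 → M ≤ τ → 0 < u → u * M ≤ τ →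
        1 ≤ N * truncRatio π (τ / K) ∧ μ.real {ω | ¬ IsTypical π h s c R (τ / K) J (τ / B)
          (B * τ) u fun i : Fin N => X i ω} ≤ ε := by
  obtain ⟨c, hc, y₀, hy₀, M₁, -, hsens⟩ := hh.exists_sensitivity hRV hα hinf hs
  obtain ⟨K₀, hK₀, M₂, hM₂, htotal⟩ :=
    exists_measure_total_le hX hind hRV hα hinf (ε := ε / 3) (by positivity)
  obtain ⟨J, hJ⟩ := pow_unbounded_of_one_lt ((2 * K₀) ^ 2) hs
  obtain ⟨K, hK, M₃, -, hratio⟩ := exists_le_mul_truncRatio_div hRV hα hinf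
    (max 1 (4 * s / (c * (ε / 3 / (J + 1) / 2))))
  obtain ⟨M, hM₁, hM₂', hM₃, hM⟩ : ∃ M, M₁ * K ≤ M ∧ M₂ ≤ M ∧ M₃ ≤ M ∧
      s ^ (J + 1) / (2 * K₀ * y₀) ≤ M :=
    ((eventually_ge_atTop _).and ((eventually_ge_atTop _).and
      ((eventually_ge_atTop _).and (eventually_ge_atTop _)))).exists
  have hM0 : 0 < M := hM₂.trans_le hM₂'
  refine ⟨c, hc, 2 / (ε / 3 / (J + 1)), by positivity, 2 * K₀, by linarith, J, K, hK, M, hM0, hJ,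
    fun N τ u hτ hMτ hu huτ => ?_⟩
  have hτ0 : 0 < τ := hM0.trans_le hMτ
  have hY := hratio N τ (hM₃.trans hMτ)
  rw [hτ, mul_one, max_le_iff] at hY
  refine ⟨hY.1, (measure_not_isTypical_le (htotal N τ (hM₂'.trans hMτ) hτ).1
    (htotal N τ (hM₂'.trans hMτ) hτ).2 fun k hk => ?_).trans_eq (mul_div_cancel₀ _ (by norm_num))⟩
  have hy : s ^ (k + 1) * (u / (2 * K₀ * τ)) ≤ y₀ := by
    calc s ^ (k + 1) * (u / (2 * K₀ * τ)) ≤ s ^ (J + 1) * (u / (2 * K₀ * τ)) := by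
          gcongr
          exact hs.le
      _ = u * (s ^ (J + 1) / (2 * K₀ * y₀)) * (y₀ / τ) := by field_simp
      _ ≤ τ * (y₀ / τ) := by gcongr; exact (mul_le_mul_of_nonneg_left hM hu.le).trans huτ
      _ = y₀ := by field_simp
  have hYM : M₁ ≤ τ / K := (le_div_iff₀ (by positivity)).2 (hM₁.trans hMτ)
  refine (measure_not_hasTypicalRates_le hX hind hh hs.le hc (by positivity) (by positivity)
    (by positivity) (hsens _ (by positivity) hy _ hYM) (zero_lt_one.trans_le hY.1)).trans ?_
  have hQ := (div_le_comm₀ (by positivity) (by linarith [hY.1])).1 ((div_div _ _ _).trans_le hY.2)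
  rw [div_div] at hQ
  calc _ ≤ ε / 3 / (J + 1) / 2 + 1 / (2 / (ε / 3 / (J + 1))) := by gcongr
    _ = ε / 3 / (J + 1) := by rw [one_div_div, add_halves]

end Separation

section InfiniteMean

variable {Ω : Type*} [MeasurableSpace Ω] {μ : Measure Ω} [IsProbabilityMeasure μ]
  {X : ℕ → Ω → ℝ≥0} {π : Measure ℝ≥0} [IsProbabilityMeasure π] {α : ℝ} {G : ℝ≥0 → ℝ≥0}

lemma exists_sq_eq_one_add {δ : ℝ} (hδ : 0 < δ) : ∃ s, 1 < s ∧ s * s = 1 + δ :=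
  ⟨√(1 + δ), Real.lt_sqrt_of_sq_lt (by linarith), Real.mul_self_sqrt (by linarith)⟩

lemma exists_rpow_le_rateMean {h : ℝ → ℝ} (hh : IsConcaveRate h) (hRV : HasRVTail π α)
    (hα : 0 < α) (hinf : ¬ Integrable (fun w : ℝ≥0 => (w : ℝ)) π) {B K : ℝ} (hB : 1 ≤ B)
    (hK : 1 ≤ K) :
    ∃ β > (0 : ℝ), ∃ a > (0 : ℝ), ∃ M > (0 : ℝ), ∀ (N : ℕ) (τ u : ℝ), N * truncRatio π τ = 1 →
      M ≤ u → u * M ≤ τ → a * u ^ β ≤ N * rateMean π h (u / (B * τ)) (τ / K) := by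
  obtain ⟨β, hβ, a, ha, M, hM, hgrow⟩ := exists_truncRatio_growth_rpow hRV hα hinf
  have hB0 : 0 < B := by linarith
  have : 0 < K := by linarith
  have h1 : 0 < h 1 := hh.pos one_pos
  refine ⟨β, hβ, h 1 * (a / B ^ β), by positivity, max (B * K) M, lt_max_of_lt_right hM,
    fun N τ u hτ hu huτ => ?_⟩
  have hBK : B * K ≤ u := (le_max_left _ _).trans hu
  have hu0 : 0 < u := (by positivity : 0 < B * K).trans_le hBK
  have hM' : M * u ≤ τ := by
    calc M * u ≤ u * max (B * K) M := by rw [mul_comm]; gcongr; exact le_max_right _ _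
      _ ≤ τ := huτ
  have hτ0 : 0 < τ := (by positivity : 0 < M * u).trans_le hM'
  have hscale : 1 ≤ u / (B * τ) * (τ / K) := by
    rw [show u / (B * τ) * (τ / K) = u / (B * K) by field_simp]
    exact (one_le_div (by positivity)).2 hBK
  have hinv : (u / (B * τ))⁻¹ = τ / (u / B) := by field_simp
  have huB : 1 ≤ u / B := (one_le_div hB0).2 ((le_mul_of_one_le_right hB0.le hK).trans hBK)
  have hMB : M * (u / B) ≤ τ := hM'.trans' (by gcongr; exact div_le_self hu0.le hB)
  calc h 1 * (a / B ^ β) * u ^ β = h 1 * (a * (u / B) ^ β * (N * truncRatio π τ)) := by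
        rw [hτ, Real.div_rpow hu0.le hB0.le]
        ring
    _ = N * (h 1 * (a * (u / B) ^ β * truncRatio π τ)) := by ring
    _ ≤ N * (h 1 * truncRatio π (u / (B * τ))⁻¹) := by
        gcongr
        rw [hinv]
        exact hgrow _ huB τ hMB
    _ ≤ N * rateMean π h (u / (B * τ)) (τ / K) := by
        gcongr
        exact hh.mul_truncRatio_inv_le (by positivity) hscale

lemma exists_separation_of_scale (hX : ∀ i, HasLaw (X i) π μ) (hind : iIndepFun X μ)
    (hRV : HasRVTail π α) (hα : 0 < α) (hinf : ¬ Integrable (fun w : ℝ≥0 => (w : ℝ)) π)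
    (hh : IsConcaveRate fun z => (G z.toNNReal : ℝ)) {δ ε : ℝ} (hδ : 0 < δ) (hε : 0 < ε) :
    ∃ c > (0 : ℝ), ∃ a > (0 : ℝ), ∃ β > (0 : ℝ), ∃ M > (0 : ℝ), ∀ (N : ℕ) (τ u : ℝ),
      N * truncRatio π τ = 1 → M ≤ τ → M ≤ u → u * M ≤ τ →
      ∃ κ : (Fin N → ℝ≥0) → ℝ, Measurable κ ∧
        μ.real {ω | ¬ IsSeparated G u ((1 + δ) * u) c (a * u ^ β) (κ fun i => X i ω)
          (fun i : Fin N => X i ω)} ≤ ε := by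
  obtain ⟨s, hs, hss⟩ := exists_sq_eq_one_add hδ
  obtain ⟨c, hc, R, hR, B, hB, J, K, hK, M₁, hM₁, hJ, htyp⟩ :=
    exists_measure_not_isTypical_le hX hind hRV hα hinf hh hs hε
  obtain ⟨β, hβ, a, ha, M₂, -, hrate⟩ := exists_rpow_le_rateMean hh hRV hα hinf hB hK
  obtain ⟨q, hq, hqq⟩ := exists_sq_eq_one_add
    (show 0 < c / (2 * (R + B * K)) by positivity)
  have hq0 : 0 < q := by linarith
  have : 0 < B := by linarith
  have : 0 < K := by linarith
  refine ⟨q - 1, by linarith, c * a / (2 * q), by positivity, β, hβ, max M₁ M₂,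
    lt_max_of_lt_left hM₁, fun N τ u hτ hMτ hMu huτ => ⟨fun x =>
      rateSum (fun z => (G z.toNNReal : ℝ)) (s * s * (u / ∑ k, (x k : ℝ))) x / q, ?_, ?_⟩⟩
  · exact Measurable.div_const (Finset.measurable_fun_sum _ fun j _ =>
      hh.continuous.measurable.comp (by fun_prop)) q
  have hτ0 : 0 < τ := hM₁.trans_le ((le_max_left _ _).trans hMτ)
  have hu0 : 0 < u := hM₁.trans_le ((le_max_left _ _).trans hMu)
  obtain ⟨hN, htyp⟩ := htyp N τ u hτ ((le_max_left _ _).trans hMτ) hu0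
    ((mul_le_mul_of_nonneg_left (le_max_left _ _) hu0.le).trans huτ)
  refine (measureReal_mono (Set.ofPred_subset_ofPred.2 fun ω => mt fun hω => ?_)).trans htyp
  rw [← hss]
  refine hω.isSeparated hh hs hc hR (by positivity) (by positivity) hu0 ?_ hN hq0 ?_ ?_
  · rwa [show B * τ / (τ / B) = B ^ 2 by field_simp]
  · rw [hqq, show B * τ / (τ / K) = B * K by field_simp]
  · have hrate := hrate N τ u hτ ((le_max_right _ _).trans hMu)
      ((mul_le_mul_of_nonneg_left (le_max_right _ _) hu0.le).trans huτ)
    calc c * a / (2 * q) * u ^ β * q = c * (a * u ^ β) / 2 := by field_simp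
      _ ≤ _ := by gcongr

lemma exists_separation (hX : ∀ i, HasLaw (X i) π μ) (hind : iIndepFun X μ)
    (hRV : HasRVTail π α) (hα : 0 < α) (hG : IsConnectionFun α G) {u : ℕ → ℝ}
    (hu : Tendsto u atTop atTop)
    (hNu : Tendsto (fun N : ℕ => N * tailFn π (u N)) atTop atTop) {δ ε : ℝ} (hδ : 0 < δ)
    (hε : 0 < ε) :
    ∃ c > (0 : ℝ), ∃ a > (0 : ℝ), ∃ β : ℝ, 0 < β ∧ ∀ᶠ N : ℕ in atTop,
      ∃ κ : (Fin N → ℝ≥0) → ℝ, Measurable κ ∧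
        μ.real {ω | ¬ IsSeparated G (u N) ((1 + δ) * u N) c (a * u N ^ β) (κ fun i => X i ω)
          (fun i : Fin N => X i ω)} ≤ ε := by
  by_cases hint : Integrable (fun w : ℝ≥0 => (w : ℝ)) π
  · exact exists_separation_of_integrable hX hind hRV.pos hint hG hu hδ hε
  have hα1 : α ≤ 1 := not_lt.1 fun hlt => hint (hRV.integrable_coe hlt)
  obtain ⟨c, hc, a, ha, β, hβ, M, hM, hsep⟩ :=
    exists_separation_of_scale hX hind hRV hα hint (hG.isConcaveRate hα1) hδ hε
  refine ⟨c, hc, a, ha, β, hβ, ?_⟩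
  have hN : Tendsto (fun N : ℕ => N * truncRatio π M) atTop atTop :=
    tendsto_natCast_atTop_atTop.atTop_mul_const
      ((hRV.pos M).trans_le (tailFn_le_truncRatio hM))
  filter_upwards [hN.eventually_ge_atTop 1, hu.eventually_ge_atTop M,
    hNu.eventually_gt_atTop (max M 1)] with N hNM hMu hmax
  have hu0 : 0 < u N := hM.trans_le hMu
  obtain ⟨τ, hMτ, hτ⟩ := exists_mul_truncRatio_eq_one hM hNM
  have hτ0 : 0 < τ := hM.trans_le hMτ
  have hlarge : max M 1 < N * truncRatio π (u N) :=
    hmax.trans_le (by gcongr; exact tailFn_le_truncRatio hu0)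
  have huτ : u N ≤ τ := by
    by_contra! hlt
    have hanti : N * truncRatio π (u N) ≤ N * truncRatio π τ := by
      gcongr
      exact truncRatio_antitoneOn (Set.mem_Ioi.2 hτ0) (Set.mem_Ioi.2 hu0) hlt.le
    linarith [le_max_right M 1]
  refine hsep N τ (u N) hτ hMτ hMu ?_
  calc u N * M ≤ u N * (N * truncRatio π (u N)) := by
        gcongr
        exact (le_max_left _ _).trans hlarge.le
    _ = N * truncMean π (u N) := by rw [← mul_truncRatio hu0.ne']; ring
    _ ≤ N * truncMean π τ := by gcongr; exact truncMean_mono hu0.le huτ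
    _ = τ * (N * truncRatio π τ) := by rw [← mul_truncRatio hτ0.ne']; ring
    _ = τ := by rw [hτ, mul_one]

end InfiniteMean

section Quantile

variable {F : ℝ → ℝ} {q : ℝ}

lemma lt_of_lt_quantile {b x : ℝ} (hb : ∀ y < b, F y < q) (hx : x < quantile F q) : F x < q := by
  by_contra! hle
  have hbdd : BddBelow {x | q ≤ F x} := ⟨b, fun y hy => not_lt.1 fun hyb => (hb y hyb).not_ge hy⟩
  exact (csInf_le hbdd hle).not_gt hx

lemma le_apply_quantile (hF : Monotone F) (hcont : ∀ x, ContinuousWithinAt F (Set.Ici x) x)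
    (hne : ∃ x, q ≤ F x) : q ≤ F (quantile F q) := by
  have hright : Tendsto F (𝓝[>] quantile F q) (𝓝 (F (quantile F q))) :=
    (hcont _).mono Set.Ioi_subset_Ici_self
  refine ge_of_tendsto hright (eventually_nhdsWithin_of_forall fun y hy => ?_)
  obtain ⟨z, hz, hzy⟩ := exists_lt_of_csInf_lt hne hy
  exact le_trans hz (hF hzy.le)

end Quantile

section Margins

variable {L : ℕ} {ρ : Measure (Fin L → ℝ≥0)} {α : ℝ}

/-- The law of the `l`-th coordinate under `ρ`. -/
noncomputable def margin (ρ : Measure (Fin L → ℝ≥0)) (l : Fin L) : Measure ℝ≥0 :=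
  ρ.map fun w => w l

instance [IsProbabilityMeasure ρ] (l : Fin L) : IsProbabilityMeasure (margin ρ l) :=
  Measure.isProbabilityMeasure_map (measurable_pi_apply l).aemeasurable

/-- The quantile function of the `l`-th coordinate under `ρ`. -/
noncomputable def marginQuantile (ρ : Measure (Fin L → ℝ≥0)) (l : Fin L) (q : ℝ) : ℝ :=
  quantile (marginalCDF ρ l) q

lemma measurableSet_lt_coord (l : Fin L) (y : ℝ) :
    MeasurableSet {w : Fin L → ℝ≥0 | y < (w l : ℝ)} :=
  measurableSet_lt measurable_const (by fun_prop)

lemma tailFn_margin (l : Fin L) (y : ℝ) : tailFn (margin ρ l) y = ρ.real {w | y < (w l : ℝ)} := by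
  rw [tailFn, margin, map_measureReal_apply (by fun_prop) (measurableSet_lt_coe y)]
  rfl

lemma coe_marginalTail (l : Fin L) {y : ℝ} (hy : 0 ≤ y) :
    (marginalTail ρ l y.toNNReal : ℝ) = tailFn (margin ρ l) y := by
  simp only [tailFn_margin, marginalTail, ENNReal.coe_toNNReal_eq_toReal, ← measureReal_def,
    Real.toNNReal_lt_iff_lt_coe hy]

variable [IsProbabilityMeasure ρ]

lemma marginalCDF_eq_measureReal (l : Fin L) (y : ℝ) :
    marginalCDF ρ l y = ρ.real {w | (w l : ℝ) ≤ y} := by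
  have hcoord : Measurable fun w : Fin L → ℝ≥0 => (w l : ℝ) := by fun_prop
  have : IsProbabilityMeasure (ρ.map fun w => (w l : ℝ)) :=
    Measure.isProbabilityMeasure_map hcoord.aemeasurable
  rw [marginalCDF, cdf_eq_real, map_measureReal_apply hcoord measurableSet_Iic]
  rfl

lemma marginalCDF_eq (l : Fin L) (y : ℝ) :
    marginalCDF ρ l y = 1 - tailFn (margin ρ l) y := by
  rw [marginalCDF_eq_measureReal, tailFn_margin,
    ← probReal_compl_eq_one_sub (measurableSet_lt_coord l y)]
  simp only [Set.compl_ofPred, not_lt]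

lemma marginalCDF_of_neg (l : Fin L) {y : ℝ} (hy : y < 0) : marginalCDF ρ l y = 0 := by
  have hempty : {w : Fin L → ℝ≥0 | (w l : ℝ) ≤ y} = ∅ :=
    Set.eq_empty_of_forall_notMem fun w hw => (hy.trans_le (w l).coe_nonneg).not_ge hw
  rw [marginalCDF_eq_measureReal, hempty, measureReal_empty]

lemma exists_le_marginalCDF (l : Fin L) {q : ℝ} (hq : q < 1) : ∃ x, q ≤ marginalCDF ρ l x := by
  obtain ⟨x, hx⟩ := ((tendsto_tailFn_atTop (π := margin ρ l)).eventually
    (gt_mem_nhds (sub_pos.2 hq))).exists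
  exact ⟨x, by rw [marginalCDF_eq]; linarith⟩

lemma hasRVTail_margin {l : Fin L} (h : IsRegularlyVarying (marginalTail ρ l) (-α)) :
    HasRVTail (margin ρ l) α where
  pos y := by
    obtain ⟨x, hxpos, hyx⟩ := (h.eventually_pos.and (eventually_ge_atTop y.toNNReal)).exists
    rw [← NNReal.coe_pos, ← Real.toNNReal_coe (r := x), coe_marginalTail l x.coe_nonneg] at hxpos
    exact hxpos.trans_le (tailFn_antitone (Real.toNNReal_le_iff_le_coe.1 hyx))
  tendsto x hx := by
    have hlim := (NNReal.continuous_coe.tendsto _).comp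
      ((h.tendsto x.toNNReal (Real.toNNReal_pos.2 hx)).comp Real.tendsto_toNNReal_atTop)
    rw [NNReal.coe_rpow, Real.coe_toNNReal _ hx.le] at hlim
    refine hlim.congr' ?_
    filter_upwards [eventually_ge_atTop 0] with y hy
    simp only [Function.comp_apply]
    rw [NNReal.coe_div, ← Real.toNNReal_mul hy, coe_marginalTail l hy,
      coe_marginalTail l (by positivity)]

lemma tailFn_marginQuantile_le (l : Fin L) {q : ℝ} (hq : q < 1) :
    tailFn (margin ρ l) (marginQuantile ρ l q) ≤ 1 - q := by
  have hle : q ≤ marginalCDF ρ l (marginQuantile ρ l q) :=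
    le_apply_quantile (monotone_cdf _) (fun x => (cdf _).right_continuous x)
      (exists_le_marginalCDF l hq)
  rw [marginalCDF_eq] at hle
  linarith

lemma lt_tailFn_of_lt_marginQuantile (l : Fin L) {q x : ℝ} (hq : 0 < q)
    (hx : x < marginQuantile ρ l q) : 1 - q < tailFn (margin ρ l) x := by
  have hlt := lt_of_lt_quantile (b := 0) (fun y hy => by rwa [marginalCDF_of_neg l hy]) hx
  rw [marginalCDF_eq] at hlt
  linarith

lemma tendsto_marginQuantile {l : Fin L} (h : HasRVTail (margin ρ l) α) :
    Tendsto (marginQuantile ρ l) (𝓝[<] 1) atTop := by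
  refine tendsto_atTop.2 fun B => ?_
  have hlarge : ∀ᶠ q in 𝓝[<] (1 : ℝ), 1 - tailFn (margin ρ l) B < q :=
    nhdsWithin_le_nhds (lt_mem_nhds (by linarith [h.pos B]))
  filter_upwards [hlarge, self_mem_nhdsWithin] with q hq (hq1 : q < 1)
  by_contra! hlt
  linarith [tailFn_antitone (π := margin ρ l) hlt.le, tailFn_marginQuantile_le (ρ := ρ) l hq1]

lemma eventually_mul_lt_tailFn_marginQuantile {l : Fin L} (h : HasRVTail (margin ρ l) α)
    (hα : 0 < α) {r : ℝ} (hr : r < 1) :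
    ∀ᶠ q in 𝓝[<] (1 : ℝ), r * (1 - q) < tailFn (margin ρ l) (marginQuantile ρ l q) := by
  obtain ⟨r', hr', hr1⟩ := exists_between (max_lt hr one_pos)
  obtain ⟨p, hrp, hp1⟩ := exists_between hr1
  have hr0 : 0 < r' := (le_max_right _ _).trans_lt hr'
  have hp0 : 0 < p := hr0.trans hrp
  have hηα : (p ^ (1 / α)) ^ (-α) = p⁻¹ := by
    rw [← Real.rpow_mul hp0.le, show 1 / α * -α = -1 by field_simp, Real.rpow_neg_one]
  have hη1 : p ^ (1 / α) < 1 := Real.rpow_lt_one hp0.le hp1 (by positivity)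
  have hQ := tendsto_marginQuantile h
  have hratio := (h.tendsto (p ^ (1 / α)) (by positivity)).comp hQ
  rw [hηα] at hratio
  filter_upwards [hratio.eventually (gt_mem_nhds (inv_strictAnti₀ hr0 hrp)), self_mem_nhdsWithin,
    nhdsWithin_le_nhds (lt_mem_nhds one_pos), hQ.eventually_gt_atTop 0] with q hq (hq1 : q < 1)
    hq0 hQ0
  rw [Function.comp_apply, div_lt_iff₀ (h.pos _)] at hq
  have hbelow := lt_tailFn_of_lt_marginQuantile (ρ := ρ) l hq0 (mul_lt_of_lt_one_right hQ0 hη1)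
  calc r * (1 - q) ≤ r' * (1 - q) :=
        mul_le_mul_of_nonneg_right ((le_max_left _ _).trans hr'.le) (by linarith)
    _ < _ := (lt_inv_mul_iff₀ hr0).1 (hbelow.trans hq)

lemma tendsto_tailFn_marginQuantile {l : Fin L} (h : HasRVTail (margin ρ l) α) (hα : 0 < α) :
    Tendsto (fun q => tailFn (margin ρ l) (marginQuantile ρ l q) / (1 - q)) (𝓝[<] 1) (𝓝 1) := by
  refine tendsto_order.2 ⟨fun r hr => ?_, fun r hr => ?_⟩
  · filter_upwards [eventually_mul_lt_tailFn_marginQuantile h hα hr, self_mem_nhdsWithin]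
      with q hq (hq1 : q < 1)
    exact (lt_div_iff₀ (sub_pos.2 hq1)).2 hq
  · filter_upwards [self_mem_nhdsWithin] with q (hq1 : q < 1)
    exact ((div_le_one (sub_pos.2 hq1)).2 (tailFn_marginQuantile_le l hq1)).trans_lt hr

lemma tendsto_tailFn_mul_marginQuantile {l : Fin L} (h : HasRVTail (margin ρ l) α) (hα : 0 < α)
    {x : ℝ} (hx : 0 < x) :
    Tendsto (fun q => tailFn (margin ρ l) (x * marginQuantile ρ l q) / (1 - q)) (𝓝[<] 1)
      (𝓝 (x ^ (-α))) := by
  have hmul := ((h.tendsto x hx).comp (tendsto_marginQuantile h)).mul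
    (tendsto_tailFn_marginQuantile h hα)
  rw [mul_one] at hmul
  refine hmul.congr fun q => ?_
  rw [Function.comp_apply, div_mul_div_cancel₀ (h.pos _).ne', mul_comm x]

end Margins

section ConvergenceInProbability

variable {Ω ι : Type*} [MeasurableSpace Ω] {μ : Measure Ω} {l : Filter ι}
  {f g h : ι → Ω → ℝ} {x y : ℝ}

lemma tendsto_measureReal_zero_iff {s : ι → Set Ω} :
    Tendsto (fun i => μ.real (s i)) l (𝓝 0) ↔ ∀ η > 0, ∀ᶠ i in l, μ.real (s i) ≤ η := by
  refine ⟨fun hs η hη => (hs.eventually (gt_mem_nhds hη)).mono fun _ => le_of_lt, fun hs => ?_⟩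
  refine tendsto_order.2 ⟨fun r hr => .of_forall fun i => hr.trans_le measureReal_nonneg,
    fun r hr => ?_⟩
  exact (hs (r / 2) (half_pos hr)).mono fun i hi => hi.trans_lt (half_lt_self hr)

variable [IsProbabilityMeasure μ]

lemma tendstoInMeasure_of_abs_sub_le (hg : TendstoInMeasure μ g l fun _ => x)
    (hh : TendstoInMeasure μ h l fun _ => 0) (hle : ∀ i ω, |f i ω - g i ω| ≤ h i ω) :
    TendstoInMeasure μ f l fun _ => x := by
  rw [tendstoInMeasure_iff_measureReal_dist] at hg hh ⊢
  intro ε hε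
  have hsum := (hg (ε / 2) (half_pos hε)).add (hh (ε / 2) (half_pos hε))
  rw [add_zero] at hsum
  refine squeeze_zero (fun _ => measureReal_nonneg) (fun i => ?_) hsum
  refine (measureReal_mono fun ω hω => ?_).trans (measureReal_union_le _ _)
  by_contra! hout
  simp only [Set.mem_union, Set.mem_ofPred_eq, not_or, not_le, Real.dist_eq, sub_zero] at hω hout
  linarith [abs_sub_le (f i ω) (g i ω) x, hle i ω, le_abs_self (h i ω)]

lemma tendstoInMeasure_comp_prodMk {φ : ℝ × ℝ → ℝ} (hφ : ContinuousAt φ (x, y))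
    (hf : TendstoInMeasure μ f l fun _ => x) (hg : TendstoInMeasure μ g l fun _ => y) :
    TendstoInMeasure μ (fun i ω => φ (f i ω, g i ω)) l fun _ => φ (x, y) := by
  rw [tendstoInMeasure_iff_measureReal_dist] at hf hg ⊢
  intro ε hε
  obtain ⟨δ, hδ, hδε⟩ := Metric.continuousAt_iff.1 hφ ε hε
  have hsum := (hf δ hδ).add (hg δ hδ)
  rw [add_zero] at hsum
  refine squeeze_zero (fun _ => measureReal_nonneg) (fun i => ?_) hsum
  refine (measureReal_mono fun ω hω => ?_).trans (measureReal_union_le _ _)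
  by_contra! hout
  simp only [Set.mem_union, Set.mem_ofPred_eq, not_or, not_le] at hω hout
  exact (hδε (x := (f i ω, g i ω)) (max_lt hout.1 hout.2)).not_ge hω

lemma tendstoInMeasure_add (hf : TendstoInMeasure μ f l fun _ => x)
    (hg : TendstoInMeasure μ g l fun _ => y) :
    TendstoInMeasure μ (fun i ω => f i ω + g i ω) l fun _ => x + y :=
  tendstoInMeasure_comp_prodMk (φ := fun p => p.1 + p.2) (continuousAt_fst.add continuousAt_snd) hf
    hg

lemma tendstoInMeasure_div (hf : TendstoInMeasure μ f l fun _ => x)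
    (hg : TendstoInMeasure μ g l fun _ => y) (hy : y ≠ 0) :
    TendstoInMeasure μ (fun i ω => f i ω / g i ω) l fun _ => x / y :=
  tendstoInMeasure_comp_prodMk (φ := fun p => p.1 / p.2)
    (continuousAt_fst.div continuousAt_snd hy) hf hg

end ConvergenceInProbability

section Counting

variable {Ω : Type*} [MeasurableSpace Ω] {μ : Measure Ω}

open Classical in
lemma measure_card_ge_le {ι : Type*} [Fintype ι] (E : ι → Set Ω) {p : ℝ≥0∞}
    (hE : ∀ i, μ (E i) ≤ p) {r : ℝ} (hr : 0 < r) :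
    μ {ω | r ≤ ((Finset.univ.filter fun i => ω ∈ E i).card : ℝ)} ≤
      Fintype.card ι * p / ENNReal.ofReal r := by
  -- The events need not be measurable, so Markov's inequality is applied to measurable hulls.
  set count : Ω → ℝ≥0∞ := fun ω => ∑ i, (toMeasurable μ (E i)).indicator 1 ω
  have hmeas : ∀ i, Measurable ((toMeasurable μ (E i)).indicator (1 : Ω → ℝ≥0∞)) := fun i =>
    measurable_one.indicator (measurableSet_toMeasurable _ _)
  have hint : ∫⁻ ω, count ω ∂μ ≤ Fintype.card ι * p := by
    rw [lintegral_finsetSum _ fun i _ => hmeas i, ← nsmul_eq_mul]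
    refine Finset.sum_le_card_nsmul _ _ _ fun i _ => ?_
    rw [lintegral_indicator_one (measurableSet_toMeasurable _ _), measure_toMeasurable]
    exact hE i
  have hcard : ∀ ω, ((Finset.univ.filter fun i => ω ∈ E i).card : ℝ≥0∞) ≤ count ω := by
    intro ω
    rw [Finset.card_filter, Nat.cast_sum]
    refine Finset.sum_le_sum fun i _ => ?_
    split_ifs with hi
    · rw [Set.indicator_of_mem (subset_toMeasurable μ (E i) hi), Nat.cast_one, Pi.one_apply]
    · rw [Nat.cast_zero]
      exact zero_le
  calc _ ≤ μ {ω | ENNReal.ofReal r ≤ count ω} := measure_mono fun ω hω =>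
        (ENNReal.ofReal_le_ofReal hω).trans ((ENNReal.ofReal_natCast _).trans_le (hcard ω))
    _ ≤ (∫⁻ ω, count ω ∂μ) / ENNReal.ofReal r :=
        meas_ge_le_lintegral_div (Finset.measurable_fun_sum _ fun i _ => hmeas i).aemeasurable
          (by simpa using hr) ENNReal.ofReal_ne_top
    _ ≤ _ := by gcongr

variable [IsProbabilityMeasure μ] {E : Type*} [MeasurableSpace E] {X : ℕ → Ω → E} {π : Measure E}

lemma tendstoInMeasure_card_mem (hX : ∀ i, HasLaw (X i) π μ) (hind : iIndepFun X μ) {t : ℕ → ℕ}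
    (ht : Tendsto t atTop atTop) {B : ℕ → Set E} (hB : ∀ N, MeasurableSet (B N)) {x : ℝ}
    (hlim : Tendsto (fun N : ℕ => N * π.real (B N) / t N) atTop (𝓝 x))
    [∀ N, DecidablePred (· ∈ B N)] :
    TendstoInMeasure μ
      (fun N ω => ((Finset.univ.filter fun i : Fin N => X i ω ∈ B N).card : ℝ) / t N) atTop
      fun _ => x := by
  have htR : Tendsto (fun N => (t N : ℝ)) atTop atTop := tendsto_natCast_atTop_atTop.comp ht
  rw [tendstoInMeasure_iff_measureReal_dist]
  intro ε hε
  have hbound : Tendsto (fun N : ℕ => N * π.real (B N) / t N * (4 / ε ^ 2) * (t N : ℝ)⁻¹) atTop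
      (𝓝 (x * (4 / ε ^ 2) * 0)) := (hlim.mul_const _).mul htR.inv_tendsto_atTop
  rw [mul_zero] at hbound
  refine squeeze_zero' (.of_forall fun N => measureReal_nonneg) ?_ hbound
  filter_upwards [htR.eventually_gt_atTop 0,
    hlim.eventually (Metric.ball_mem_nhds x (half_pos hε))] with N hN hmean
  have hcheb := measure_abs_sum_sub_ge_le hX hind (measurable_one.indicator (hB N))
    (fun y => Set.indicator_nonneg (fun _ _ => zero_le_one) y)
    (fun y => Set.indicator_le_self' (fun _ _ => zero_le_one) y) N
    (show 0 < ε / 2 * t N by positivity) (b := 1)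
  rw [integral_indicator_one (hB N), one_mul] at hcheb
  refine (measureReal_mono fun ω hω => ?_).trans (hcheb.trans (le_of_eq (by field_simp; norm_num)))
  set S := ∑ i : Fin N, (B N).indicator (1 : E → ℝ) (X i ω)
  have hcard : ((Finset.univ.filter fun i : Fin N => X i ω ∈ B N).card : ℝ) = S := by
    simp only [S, Finset.card_filter, Nat.cast_sum, Set.indicator_apply, Pi.one_apply,
      Nat.cast_ite, Nat.cast_one, Nat.cast_zero]
  have hdev : ε / 2 ≤ |S / t N - N * π.real (B N) / t N| := by
    rw [Set.mem_ofPred_eq, hcard] at hω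
    rw [← Real.dist_eq]
    linarith [dist_triangle (S / t N) (N * π.real (B N) / t N) x, Metric.mem_ball.1 hmean]
  rwa [← sub_div, abs_div, abs_of_pos hN, le_div_iff₀ hN] at hdev

end Counting

section EmpiricalThreshold

/-- The set of indices at which `f` exceeds the level `x`. -/
noncomputable def exceedances {ι : Type*} [Fintype ι] (f : ι → ℝ) (x : ℝ) : Finset ι :=
  Finset.univ.filter fun i => x < f i

lemma mem_exceedances {ι : Type*} [Fintype ι] {f : ι → ℝ} {x : ℝ} {i : ι} :
    i ∈ exceedances f x ↔ x < f i := by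
  simp only [exceedances, Finset.mem_filter, Finset.mem_univ, true_and]

lemma exceedances_anti {ι : Type*} [Fintype ι] (f : ι → ℝ) : Antitone (exceedances f) :=
  fun _ _ hxy _ hi => mem_exceedances.2 (hxy.trans_lt (mem_exceedances.1 hi))

lemma card_symmDiff_eq {ι : Type*} [DecidableEq ι] (S D : Finset ι) :
    ((symmDiff S D).card : ℝ) = D.card - S.card + 2 * (S \ D).card := by
  have hsymm : (symmDiff S D).card = (S \ D).card + (D \ S).card := by
    rw [symmDiff_def, Finset.sup_eq_union, Finset.card_union_of_disjoint disjoint_sdiff_sdiff]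
  have hS := Finset.card_sdiff_add_card_inter S D
  have hD := Finset.card_sdiff_add_card_inter D S
  rw [Finset.inter_comm] at hD
  rw [hsymm, ← hS, ← hD]
  push_cast
  ring

variable {L N : ℕ} (a : Fin N → Fin N → Fin L → ℕ) (l : Fin L)

lemma empiricalCDF_eq (x : ℝ) (hN : 0 < N) :
    empiricalCDF a l x = 1 - (exceedances (fun i => (degree a i l : ℝ)) x).card / N := by
  have hadd := Finset.card_filter_add_card_filter_not (s := (Finset.univ : Finset (Fin N)))
    fun i => (degree a i l : ℝ) ≤ x
  simp only [not_le, Finset.card_univ, Fintype.card_fin] at hadd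
  have hN' : (N : ℝ) ≠ 0 := by exact_mod_cast hN.ne'
  rw [empiricalCDF, eq_sub_iff_add_eq, ← add_div, div_eq_one_iff_eq hN']
  exact_mod_cast hadd

lemma empiricalCDF_mono : Monotone (empiricalCDF a l) := by
  intro x y hxy
  unfold empiricalCDF
  gcongr

lemma continuousWithinAt_empiricalCDF (x : ℝ) :
    ContinuousWithinAt (empiricalCDF a l) (Set.Ici x) x := by
  have hconst : ∀ᶠ y in 𝓝[≥] x, ∀ i, ((degree a i l : ℝ) ≤ x ↔ (degree a i l : ℝ) ≤ y) := by
    refine eventually_all.2 fun i => ?_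
    rcases le_or_gt (degree a i l : ℝ) x with hdx | hxd
    · filter_upwards [self_mem_nhdsWithin] with y hy
      exact iff_of_true hdx (hdx.trans hy)
    · filter_upwards [nhdsWithin_le_nhds (gt_mem_nhds hxd)] with y hy
      exact iff_of_false hxd.not_ge hy.not_ge
  refine tendsto_const_nhds.congr' ?_
  filter_upwards [hconst] with y hy
  simp only [empiricalCDF, hy]

variable {t : ℕ}

lemma card_exceedances_degreeThreshold_le (hN : 0 < N) :
    ((exceedances (fun i => (degree a i l : ℝ)) (degreeThreshold a t l)).card : ℝ) ≤ t := by
  have hN' : (0 : ℝ) < N := by exact_mod_cast hN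
  obtain ⟨x, hx⟩ := (Set.finite_range fun i => (degree a i l : ℝ)).bddAbove
  have hempty : exceedances (fun i => (degree a i l : ℝ)) x = ∅ :=
    Finset.eq_empty_of_forall_notMem fun i hi => (mem_exceedances.1 hi).not_ge (hx ⟨i, rfl⟩)
  have hne : 1 - (t : ℝ) / N ≤ empiricalCDF a l x := by
    rw [empiricalCDF_eq a l x hN, hempty, Finset.card_empty, Nat.cast_zero, zero_div, sub_zero]
    linarith [show (0 : ℝ) ≤ t / N by positivity]
  have hle : 1 - (t : ℝ) / N ≤ empiricalCDF a l (degreeThreshold a t l) :=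
    le_apply_quantile (empiricalCDF_mono a l) (continuousWithinAt_empiricalCDF a l) ⟨x, hne⟩
  rw [empiricalCDF_eq a l _ hN, sub_le_sub_iff_left] at hle
  exact (div_le_div_iff_of_pos_right hN').1 hle

variable {a l}

lemma lt_card_exceedances_of_lt_degreeThreshold (htN : t < N) {x : ℝ}
    (hx : x < degreeThreshold a t l) :
    t < (exceedances (fun i => (degree a i l : ℝ)) x).card := by
  have hN : 0 < N := by omega
  have hN' : (0 : ℝ) < N := by exact_mod_cast hN
  have hneg : ∀ y < 0, empiricalCDF a l y < 1 - (t : ℝ) / N := by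
    intro y hy
    have hempty : (Finset.univ.filter fun i => (degree a i l : ℝ) ≤ y) = ∅ :=
      Finset.filter_eq_empty_iff.2 fun i _ => (hy.trans_le (Nat.cast_nonneg _)).not_ge
    rw [empiricalCDF, hempty, Finset.card_empty, Nat.cast_zero, zero_div, sub_pos, div_lt_one hN']
    exact_mod_cast htN
  have hlt := lt_of_lt_quantile hneg hx
  rw [empiricalCDF_eq a l _ hN, sub_lt_sub_iff_left] at hlt
  exact_mod_cast (div_lt_div_iff_of_pos_right hN').1 hlt

variable {u v κ : ℝ} {x : Fin N → ℝ≥0}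

open Classical in
lemma degreeThreshold_le_of_card_lt (htN : t < N)
    (hcard : (exceedances (fun i => (x i : ℝ)) u).card +
      (Finset.univ.filter fun i => IsMisclassified u v κ (x i) (degree a i l)).card < t) :
    degreeThreshold a t l ≤ κ := by
  by_contra! hκ
  refine (lt_card_exceedances_of_lt_degreeThreshold htN hκ).not_ge (le_trans ?_ hcard.le)
  refine (Finset.card_le_card fun i hi => ?_).trans (Finset.card_union_le _ _)
  rw [mem_exceedances] at hi
  simp only [Finset.mem_union, mem_exceedances, Finset.mem_filter, Finset.mem_univ, true_and]
  exact (lt_or_ge u (x i)).imp_right fun hxu => Or.inl ⟨hxu, hi⟩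

open Classical in
lemma card_exceedances_sdiff_le (hκ : degreeThreshold a t l ≤ κ) {u₀ : ℝ} (hu₀ : u₀ ≤ v) :
    ((exceedances (fun i => (x i : ℝ)) u₀ \
      exceedances (fun i => (degree a i l : ℝ)) (degreeThreshold a t l)).card : ℝ) ≤
      (exceedances (fun i => (x i : ℝ)) u₀).card - (exceedances (fun i => (x i : ℝ)) v).card +
      (Finset.univ.filter fun i => IsMisclassified u v κ (x i) (degree a i l)).card := by
  rw [← Nat.cast_sub (Finset.card_le_card (exceedances_anti _ hu₀)),
    ← Finset.card_sdiff_of_subset (exceedances_anti _ hu₀)]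
  norm_cast
  refine (Finset.card_le_card fun i hi => ?_).trans (Finset.card_union_le _ _)
  simp only [Finset.mem_sdiff, Finset.mem_union, mem_exceedances, not_lt, Finset.mem_filter,
    Finset.mem_univ, true_and] at hi ⊢
  rcases lt_or_ge v (x i) with hxv | hxv
  · exact Or.inr (Or.inr ⟨hxv, hi.2.trans hκ⟩)
  · exact Or.inl ⟨hi.1, hxv⟩

open Classical in
lemma card_symmDiff_le (htN : t < N) {u₀ : ℝ} (hu₀ : u₀ ≤ v)
    (hcard : (exceedances (fun i => (x i : ℝ)) u).card +
      (Finset.univ.filter fun i => IsMisclassified u v κ (x i) (degree a i l)).card < t) :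
    ((symmDiff (exceedances (fun i => (x i : ℝ)) u₀)
      (exceedances (fun i => (degree a i l : ℝ)) (degreeThreshold a t l))).card : ℝ) ≤
      t - (exceedances (fun i => (x i : ℝ)) u₀).card +
      2 * ((exceedances (fun i => (x i : ℝ)) u₀).card -
        (exceedances (fun i => (x i : ℝ)) v).card +
        (Finset.univ.filter fun i => IsMisclassified u v κ (x i) (degree a i l)).card) := by
  rw [card_symmDiff_eq]
  have hκ := degreeThreshold_le_of_card_lt htN hcard
  have hD := card_exceedances_degreeThreshold_le a l (t := t) (by omega)
  gcongr
  exact card_exceedances_sdiff_le hκ hu₀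

open Classical in
lemma card_symmDiff_div_lt (ht : 0 < t) (htN : t < N) {u₀ p q e : ℝ} (hu₀ : u₀ ≤ v)
    (he : p + 2 * e ≤ 1) (h₀ : |((exceedances (fun i => (x i : ℝ)) u₀).card : ℝ) / t - 1| < e)
    (hu : |((exceedances (fun i => (x i : ℝ)) u).card : ℝ) / t - p| < e)
    (hv : |((exceedances (fun i => (x i : ℝ)) v).card : ℝ) / t - q| < e)
    (hmis : ((Finset.univ.filter fun i =>
      IsMisclassified u v κ (x i) (degree a i l)).card : ℝ) < e * t) :
    ((symmDiff (exceedances (fun i => (x i : ℝ)) u₀)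
      (exceedances (fun i => (degree a i l : ℝ)) (degreeThreshold a t l))).card : ℝ) / t <
      2 - 2 * q + 5 * e := by
  have htR : (0 : ℝ) < t := by exact_mod_cast ht
  have h₀' := (sub_lt_iff_lt_add.1 (abs_lt.1 h₀).2)
  have hu' := (sub_lt_iff_lt_add.1 (abs_lt.1 hu).2)
  have hv' := (lt_sub_iff_add_lt.1 (abs_lt.1 hv).1)
  rw [div_lt_iff₀ htR] at h₀' hu'
  rw [lt_div_iff₀ htR] at hv'
  have hcard : (exceedances (fun i => (x i : ℝ)) u).card +
      (Finset.univ.filter fun i => IsMisclassified u v κ (x i) (degree a i l)).card < t := by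
    have hpe : (e + p) * t + e * t ≤ t := by nlinarith
    exact_mod_cast (add_lt_add hu' hmis).trans_le hpe
  rw [div_lt_iff₀ htR]
  linarith [card_symmDiff_le htN hu₀ hcard]

end EmpiricalThreshold

section Layer

variable {Ω : Type*} [MeasurableSpace Ω] {μ : Measure Ω} {L : ℕ} {g : Fin L → ℝ≥0 → ℝ≥0}
  {ρ : Measure (Fin L → ℝ≥0)} {W : ℕ → Ω → Fin L → ℝ≥0} {l : Fin L}

lemma hasLaw_margin (hlaw : ∀ i, HasLaw (W i) ρ μ) (l : Fin L) (i : ℕ) :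
    HasLaw (fun ω => W i ω l) (margin ρ l) μ :=
  HasLaw.comp (Y := fun w : Fin L → ℝ≥0 => w l)
    ⟨(measurable_pi_apply l).aemeasurable, rfl⟩ (hlaw i)

variable [IsProbabilityMeasure μ]

open Classical in
lemma IsMIRG.measureReal_card_isMisclassified_le {N : ℕ} {W : Fin N → Ω → Fin L → ℝ≥0}
    {A : Fin N → Fin N → Fin L → Ω → ℕ} (hA : IsMIRG μ g W A) (hg : ∀ l, Measurable (g l))
    (hW : ∀ i, Measurable (W i)) (l : Fin L) {u v c κmin : ℝ} (hc : 0 < c) (huv : u ≤ v)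
    {κ : (Fin N → ℝ≥0) → ℝ} (hκ : Measurable κ) {r : ℝ} (hr : 0 < r) :
    μ.real {ω | r ≤ ((Finset.univ.filter fun i => IsMisclassified u v (κ fun j => W j ω l)
      (W i ω l) (degree (fun i j l => A i j l ω) i l)).card : ℝ)} ≤
      μ.real {ω | ¬ IsSeparated (g l) u v c κmin (κ fun j => W j ω l) fun j => W j ω l} +
        N * Real.exp (-(κmin * poissonRate c)) / r := by
  have hmarkov := ENNReal.toReal_mono (ENNReal.div_ne_top (by finiteness) (by simpa using hr))
    (measure_card_ge_le _
      (fun i => hA.measure_isMisclassified_le (κmin := κmin) hg hW l hc huv hκ i) hr)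
  rw [ENNReal.toReal_div, ENNReal.toReal_mul, ENNReal.toReal_natCast,
    ENNReal.toReal_ofReal (Real.exp_pos _).le, ENNReal.toReal_ofReal hr.le,
    Fintype.card_fin] at hmarkov
  refine (measureReal_mono fun ω hω => ?_).trans
    ((measureReal_union_le _ _).trans (add_le_add le_rfl hmarkov))
  refine or_iff_not_imp_left.2 fun hsep => ?_
  rw [Set.mem_ofPred_eq, not_not] at hsep
  simpa only [Set.mem_ofPred_eq, hsep, true_and] using hω

lemma exists_symmDiff_tolerance {α : ℝ} (hα : 0 < α) {ε : ℝ} (hε : 0 < ε) :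
    ∃ δ > (0 : ℝ), ∃ e > (0 : ℝ), (1 + δ) ^ (-α) + 2 * e ≤ 1 ∧
      2 - 2 * ((1 + δ) * (1 + δ)) ^ (-α) + 5 * e ≤ ε := by
  have hlim : Tendsto (fun δ : ℝ => 2 - 2 * ((1 + δ) * (1 + δ)) ^ (-α)) (𝓝 0) (𝓝 0) := by
    have hcont : ContinuousAt (fun δ : ℝ => 2 - 2 * ((1 + δ) * (1 + δ)) ^ (-α)) 0 :=
      continuousAt_const.sub <| continuousAt_const.mul <|
        ContinuousAt.rpow_const (by fun_prop) (Or.inl (by norm_num))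
    simpa using hcont.tendsto
  obtain ⟨δ, hδε, hδ⟩ := (((hlim.eventually_lt_const (half_pos hε)).filter_mono
    nhdsWithin_le_nhds).and (self_mem_nhdsWithin (s := Set.Ioi (0 : ℝ)))).exists
  have hp : (1 + δ) ^ (-α) < 1 :=
    Real.rpow_lt_one_of_one_lt_of_neg (lt_add_of_pos_right 1 hδ) (neg_lt_zero.2 hα)
  obtain ⟨e, he, hmin⟩ : ∃ e > 0, e < min (ε / 10) ((1 - (1 + δ) ^ (-α)) / 2) :=
    exists_between (lt_min (by positivity) (by linarith))
  obtain ⟨heε, hep⟩ := lt_min_iff.1 hmin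
  exact ⟨δ, hδ, e, he, by linarith, by linarith⟩

variable {t : ℕ → ℕ}

lemma tendsto_level (ht : Tendsto t atTop atTop)
    (htN : Tendsto (fun N : ℕ => (t N : ℝ) / N) atTop (𝓝 0)) :
    Tendsto (fun N : ℕ => 1 - (t N : ℝ) / N) atTop (𝓝[<] 1) := by
  refine tendsto_nhdsWithin_iff.2 ⟨by simpa using tendsto_const_nhds.sub htN, ?_⟩
  filter_upwards [ht.eventually_gt_atTop 0, eventually_gt_atTop 0] with N ht0 hN0
  exact Set.mem_Iio.2 (sub_lt_self _ (by positivity))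

lemma eventually_lt_of_tendsto_div (htN : Tendsto (fun N : ℕ => (t N : ℝ) / N) atTop (𝓝 0)) :
    ∀ᶠ N in atTop, t N < N := by
  filter_upwards [htN.eventually (gt_mem_nhds one_pos), eventually_gt_atTop 0] with N hlt hN0
  rw [div_lt_one (by positivity)] at hlt
  exact_mod_cast hlt

lemma tendsto_comp_level {f : ℝ → ℝ} {x : ℝ} (ht : Tendsto t atTop atTop)
    (htN : Tendsto (fun N : ℕ => (t N : ℝ) / N) atTop (𝓝 0))
    (hf : Tendsto (fun q => f q / (1 - q)) (𝓝[<] 1) (𝓝 x)) :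
    Tendsto (fun N : ℕ => N * f (1 - (t N : ℝ) / N) / t N) atTop (𝓝 x) := by
  refine (hf.comp (tendsto_level ht htN)).congr fun N => ?_
  rw [Function.comp_apply, sub_sub_cancel, div_div_eq_mul_div, mul_comm]

variable {α : ℝ} {u : ℕ → ℝ} {x : ℝ}

lemma HasRVTail.tendsto_mul_exp_neg {π : Measure ℝ≥0} [IsProbabilityMeasure π]
    (h : HasRVTail π α) (hα : 0 < α) (hu : Tendsto u atTop atTop)
    (hlim : Tendsto (fun N : ℕ => N * tailFn π (u N) / t N) atTop (𝓝 x)) {b β : ℝ} (hb : 0 < b)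
    (hβ : 0 < β) :
    Tendsto (fun N : ℕ => N * Real.exp (-(b * u N ^ β)) / t N) atTop (𝓝 0) := by
  obtain ⟨C, _, hpoly⟩ := h.eventually_one_le hα
  have hexp : Tendsto (fun N : ℕ => (u N ^ β) ^ ((α + 1) / β) * Real.exp (-b * (u N ^ β)))
      atTop (𝓝 0) :=
    (tendsto_rpow_mul_exp_neg_mul_atTop_nhds_zero _ b hb).comp ((tendsto_rpow_atTop hβ).comp hu)
  have hbound := (hlim.mul_const C).mul hexp
  rw [mul_zero] at hbound
  refine squeeze_zero' (.of_forall fun N => by positivity) ?_ hbound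
  filter_upwards [hu.eventually hpoly, hu.eventually_gt_atTop 0] with N hN hN0
  rw [← Real.rpow_mul hN0.le, mul_div_cancel₀ _ hβ.ne', neg_mul]
  calc N * Real.exp (-(b * u N ^ β)) / t N = N * Real.exp (-(b * u N ^ β)) / t N * 1 := by ring
    _ ≤ N * Real.exp (-(b * u N ^ β)) / t N * (C * u N ^ (α + 1) * tailFn π (u N)) := by gcongr
    _ = _ := by ring

variable {A : (N : ℕ) → Fin N → Fin N → Fin L → Ω → ℕ}

open Classical in
lemma eventually_exists_measureReal_card_isMisclassified_le [IsProbabilityMeasure ρ]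
    (hW : ∀ i, Measurable (W i)) (hlaw : ∀ i, HasLaw (W i) ρ μ) (hind : iIndepFun W μ)
    (hRV : HasRVTail (margin ρ l) α) (hα : 0 < α) (hg : ∀ l, IsConnectionFun α (g l))
    (hA : ∀ N, IsMIRG μ g (fun i : Fin N => W i) (A N)) (ht : Tendsto t atTop atTop)
    (hu : Tendsto u atTop atTop)
    (hlim : Tendsto (fun N : ℕ => N * tailFn (margin ρ l) (u N) / t N) atTop (𝓝 x)) (hx : 0 < x)
    {δ e η : ℝ} (hδ : 0 < δ) (he : 0 < e) (hη : 0 < η) :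
    ∀ᶠ N in atTop, ∃ κ : Ω → ℝ, μ.real {ω | e * t N ≤ ((Finset.univ.filter fun i : Fin N =>
      IsMisclassified (u N) ((1 + δ) * u N) (κ ω) (W i ω l)
        (degree (fun i j l => A N i j l ω) i l)).card : ℝ)} ≤ η := by
  have htR : Tendsto (fun N => (t N : ℝ)) atTop atTop := tendsto_natCast_atTop_atTop.comp ht
  have hNu : Tendsto (fun N : ℕ => N * tailFn (margin ρ l) (u N)) atTop atTop := by
    refine (hlim.pos_mul_atTop hx htR).congr' ?_
    filter_upwards [htR.eventually_gt_atTop 0] with N hN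
    exact div_mul_cancel₀ _ hN.ne'
  obtain ⟨c, hc, a, ha, β, hβ, hsep⟩ := exists_separation (hasLaw_margin hlaw l)
    (hind.comp (fun _ w => w l) fun _ => measurable_pi_apply l) hRV hα (hg l) hu hNu hδ
    (half_pos hη)
  have hexp := hRV.tendsto_mul_exp_neg hα hu hlim (mul_pos ha (poissonRate_pos hc)) hβ
  filter_upwards [hsep, hexp.eventually (gt_mem_nhds (show 0 < η / 2 * e by positivity)),
    htR.eventually_gt_atTop 0, hu.eventually_gt_atTop 0] with N ⟨κ, hκ, hsepN⟩ hexpN htpos hupos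
  refine ⟨fun ω => κ fun i => W i ω l, ((hA N).measureReal_card_isMisclassified_le
    (fun l => (hg l).measurable) (fun i => hW i) l hc
    (le_mul_of_one_le_left hupos.le (by linarith)) hκ (by positivity)).trans
    ((add_le_add hsepN (?_ : _ ≤ η / 2)).trans_eq (add_halves η))⟩
  rw [div_lt_iff₀ htpos] at hexpN
  rw [mul_right_comm a, div_le_iff₀ (by positivity)]
  linarith

lemma tendsto_mul_tailFn_mul_marginQuantile [IsProbabilityMeasure ρ]
    (hRV : HasRVTail (margin ρ l) α) (hα : 0 < α) (ht : Tendsto t atTop atTop)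
    (htN : Tendsto (fun N : ℕ => (t N : ℝ) / N) atTop (𝓝 0)) (hx : 0 < x) :
    Tendsto (fun N : ℕ => N * tailFn (margin ρ l) (x * marginQuantile ρ l (1 - (t N : ℝ) / N)) /
      t N) atTop (𝓝 (x ^ (-α))) :=
  tendsto_comp_level (f := fun q => tailFn (margin ρ l) (x * marginQuantile ρ l q)) ht htN
    (tendsto_tailFn_mul_marginQuantile hRV hα hx)

lemma tendstoInMeasure_card_exceedances_mul_marginQuantile [IsProbabilityMeasure ρ]
    (hlaw : ∀ i, HasLaw (W i) ρ μ) (hind : iIndepFun W μ) (hRV : HasRVTail (margin ρ l) α)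
    (hα : 0 < α) (ht : Tendsto t atTop atTop)
    (htN : Tendsto (fun N : ℕ => (t N : ℝ) / N) atTop (𝓝 0)) (hx : 0 < x) :
    TendstoInMeasure μ (fun N ω => ((exceedances (fun i : Fin N => (W i ω l : ℝ))
      (x * marginQuantile ρ l (1 - (t N : ℝ) / N))).card : ℝ) / t N) atTop
      fun _ => x ^ (-α) :=
  tendstoInMeasure_card_mem hlaw hind ht
    (B := fun N => {w | x * marginQuantile ρ l (1 - (t N : ℝ) / N) < (w l : ℝ)})
    (fun N => measurableSet_lt_coord l _) (by
      simpa only [tailFn_margin] using tendsto_mul_tailFn_mul_marginQuantile hRV hα ht htN hx)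

open Classical in
lemma tendstoInMeasure_card_symmDiff [IsProbabilityMeasure ρ] (hW : ∀ i, Measurable (W i))
    (hlaw : ∀ i, HasLaw (W i) ρ μ) (hind : iIndepFun W μ) (hRV : HasRVTail (margin ρ l) α)
    (hα : 0 < α) (hg : ∀ l, IsConnectionFun α (g l))
    (hA : ∀ N, IsMIRG μ g (fun i : Fin N => W i) (A N)) (ht : Tendsto t atTop atTop)
    (htN : Tendsto (fun N : ℕ => (t N : ℝ) / N) atTop (𝓝 0)) :
    TendstoInMeasure μ (fun N ω => ((symmDiff
      (exceedances (fun i : Fin N => (W i ω l : ℝ)) (marginQuantile ρ l (1 - (t N : ℝ) / N)))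
      (exceedances (fun i => (degree (fun i j l => A N i j l ω) i l : ℝ))
        (degreeThreshold (fun i j l => A N i j l ω) (t N) l))).card : ℝ) / t N) atTop
      fun _ => 0 := by
  rw [tendstoInMeasure_iff_measureReal_dist]
  refine fun ε hε => tendsto_measureReal_zero_iff.2 fun η hη => ?_
  obtain ⟨δ, hδ, e, he, hpe, hqe⟩ := exists_symmDiff_tolerance hα hε
  have hcount (y : ℝ) (hy : 0 < y) := tendsto_measureReal_zero_iff.1
    (tendstoInMeasure_iff_measureReal_dist.1 (tendstoInMeasure_card_exceedances_mul_marginQuantile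
      hlaw hind hRV hα ht htN hy) e he) (η / 4) (by positivity)
  have hquantile : Tendsto (fun N : ℕ => marginQuantile ρ l (1 - (t N : ℝ) / N)) atTop atTop :=
    (tendsto_marginQuantile hRV).comp (tendsto_level ht htN)
  have hmis := eventually_exists_measureReal_card_isMisclassified_le hW hlaw hind hRV hα hg hA ht
    (hquantile.const_mul_atTop (by positivity))
    (tendsto_mul_tailFn_mul_marginQuantile hRV hα ht htN (x := 1 + δ) (by positivity))
    (by positivity) hδ he (show 0 < η / 4 by positivity)
  filter_upwards [ht.eventually_gt_atTop 0, eventually_lt_of_tendsto_div htN,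
    hquantile.eventually_gt_atTop 0, hcount 1 one_pos, hcount (1 + δ) (by positivity),
    hcount ((1 + δ) * (1 + δ)) (by positivity), hmis]
    with N htpos htN' hqpos h₀ hu hv ⟨κ, hκ⟩
  have hunion := (measureReal_union_le _ _).trans
    (add_le_add ((measureReal_union_le _ _).trans (add_le_add h₀ hu))
      ((measureReal_union_le _ _).trans (add_le_add hv hκ)))
  refine (measureReal_mono fun ω hω => ?_).trans (hunion.trans_eq (by ring))
  have hle : marginQuantile ρ l (1 - (t N : ℝ) / N) ≤
      (1 + δ) * ((1 + δ) * marginQuantile ρ l (1 - (t N : ℝ) / N)) := by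
    have := mul_pos hδ hqpos
    nlinarith
  by_contra hgood
  simp only [Set.mem_union, Set.mem_ofPred_eq, not_or, not_le, one_mul, Real.one_rpow] at hgood
  obtain ⟨⟨hω₀, hωu⟩, hωv, hωκ⟩ := hgood
  rw [mul_assoc] at hωv
  have hlt := card_symmDiff_div_lt htpos htN' hle hpe hω₀ hωu hωv hωκ
  rw [Set.mem_ofPred_eq, Real.dist_0_eq_abs, abs_of_nonneg (by positivity)] at hω
  linarith

end Layer

section TailDependence

variable {L : ℕ} {ρ : Measure (Fin L → ℝ≥0)} {α : ℝ} {s m : Fin L}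

/-- The joint tail function `P(W_s > x, W_m > y)` of the coordinates `s` and `m`. -/
noncomputable def jointTail (ρ : Measure (Fin L → ℝ≥0)) (s m : Fin L) (x y : ℝ) : ℝ :=
  ρ.real {w | x < (w s : ℝ) ∧ y < (w m : ℝ)}

lemma measurableSet_jointTail (s m : Fin L) (x y : ℝ) :
    MeasurableSet {w : Fin L → ℝ≥0 | x < (w s : ℝ) ∧ y < (w m : ℝ)} :=
  (measurableSet_lt_coord s x).inter (measurableSet_lt_coord m y)

/-- The joint tail of the coordinates `s` and `m` at their quantiles of level `q`, the numerator of
`utd ρ s m q`. -/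
noncomputable def jointQuantileTail (ρ : Measure (Fin L → ℝ≥0)) (s m : Fin L) (q : ℝ) : ℝ :=
  jointTail ρ s m (marginQuantile ρ s q) (marginQuantile ρ m q)

lemma utd_eq_div (s m : Fin L) (q : ℝ) :
    utd ρ s m q = jointQuantileTail ρ s m q / tailFn (margin ρ s) (marginQuantile ρ s q) := by
  rw [utd, measureReal_def, cond_apply (measurableSet_lt_coord s _), ENNReal.toReal_mul,
    ENNReal.toReal_inv, inv_mul_eq_div, tailFn_margin]
  rfl

variable [IsProbabilityMeasure ρ]

lemma measureReal_strip_le (l : Fin L) (x x' : ℝ) :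
    ρ.real {w | x < (w l : ℝ) ∧ (w l : ℝ) ≤ x'} ≤
      |tailFn (margin ρ l) x - tailFn (margin ρ l) x'| := by
  have hstrip : {w : Fin L → ℝ≥0 | x < (w l : ℝ) ∧ (w l : ℝ) ≤ x'} =
      {w | x < (w l : ℝ)} \ {w | x' < (w l : ℝ)} := by
    ext w
    simp only [Set.mem_sdiff, Set.mem_ofPred_eq, not_lt]
  rw [hstrip]
  rcases le_total x x' with h | h
  · have hsub : {w : Fin L → ℝ≥0 | x' < (w l : ℝ)} ⊆ {w | x < (w l : ℝ)} :=
      fun w hw => h.trans_lt hw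
    rw [measureReal_sdiff hsub (measurableSet_lt_coord l x'), tailFn_margin, tailFn_margin]
    exact le_abs_self _
  · have hsub : {w : Fin L → ℝ≥0 | x < (w l : ℝ)} ⊆ {w | x' < (w l : ℝ)} :=
      fun w hw => h.trans_lt hw
    rw [Set.sdiff_eq_empty.2 hsub, measureReal_empty]
    exact abs_nonneg _

lemma jointTail_sub_le (s m : Fin L) (x y x' y' : ℝ) :
    jointTail ρ s m x y - jointTail ρ s m x' y' ≤
      |tailFn (margin ρ s) x - tailFn (margin ρ s) x'| +
        |tailFn (margin ρ m) y - tailFn (margin ρ m) y'| := by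
  have hsub : {w : Fin L → ℝ≥0 | x < (w s : ℝ) ∧ y < (w m : ℝ)} ⊆
      {w | x' < (w s : ℝ) ∧ y' < (w m : ℝ)} ∪ ({w | x < (w s : ℝ) ∧ (w s : ℝ) ≤ x'} ∪
        {w | y < (w m : ℝ) ∧ (w m : ℝ) ≤ y'}) := fun w ⟨hs, hm⟩ => by
    simp only [Set.mem_union, Set.mem_ofPred_eq, hs, hm, true_and]
    by_contra! hcon
    exact (hcon.1 hcon.2.1).not_gt hcon.2.2
  rw [sub_le_iff_le_add']
  exact (measureReal_mono hsub).trans ((measureReal_union_le _ _).trans (add_le_add le_rfl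
    ((measureReal_union_le _ _).trans
      (add_le_add (measureReal_strip_le s x x') (measureReal_strip_le m y y')))))

lemma abs_jointTail_sub_le (s m : Fin L) (x y x' y' : ℝ) :
    |jointTail ρ s m x y - jointTail ρ s m x' y'| ≤
      |tailFn (margin ρ s) x - tailFn (margin ρ s) x'| +
        |tailFn (margin ρ m) y - tailFn (margin ρ m) y'| := by
  refine abs_sub_le_iff.2 ⟨jointTail_sub_le s m x y x' y', ?_⟩
  rw [abs_sub_comm (tailFn _ x), abs_sub_comm (tailFn _ y)]
  exact jointTail_sub_le s m x' y' x y

lemma isUTDCoeff_iff (hs : HasRVTail (margin ρ s) α) (hα : 0 < α) (m : Fin L) (lam : ℝ) :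
    IsUTDCoeff ρ s m lam ↔
      Tendsto (fun q => jointQuantileTail ρ s m q / (1 - q)) (𝓝[<] 1) (𝓝 lam) := by
  have htail := tendsto_tailFn_marginQuantile hs hα
  constructor
  · intro h
    simpa only [utd_eq_div, div_mul_div_cancel₀ (hs.pos _).ne', mul_one] using h.mul htail
  · intro h
    have hdiv := h.div htail one_ne_zero
    rw [div_one] at hdiv
    refine hdiv.congr' ?_
    filter_upwards [self_mem_nhdsWithin] with q (hq : q < 1)
    rw [Pi.div_apply, utd_eq_div, div_div_div_cancel_right₀ (sub_pos.2 hq).ne']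

lemma tendsto_iff_of_tendsto_sub_zero {ι : Type*} {l : Filter ι} {f g : ι → ℝ} {x : ℝ}
    (h : Tendsto (fun i => f i - g i) l (𝓝 0)) : Tendsto f l (𝓝 x) ↔ Tendsto g l (𝓝 x) :=
  ⟨fun hf => by simpa using hf.sub h, fun hg => by simpa using h.add hg⟩

lemma IsCopula.sub_mem_Icc {C : ℝ → ℝ → ℝ} (hC : IsCopula C) {u u' v v' : ℝ} (hu : 0 ≤ u)
    (huu' : u ≤ u') (hu' : u' ≤ 1) (hv : 0 ≤ v) (hvv' : v ≤ v') (hv' : v' ≤ 1) :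
    C u' v' - C u v ∈ Set.Icc 0 ((u' - u) + (v' - v)) := by
  have mu : u ∈ Set.Icc (0 : ℝ) 1 := ⟨hu, huu'.trans hu'⟩
  have mu' : u' ∈ Set.Icc (0 : ℝ) 1 := ⟨hu.trans huu', hu'⟩
  have mv : v ∈ Set.Icc (0 : ℝ) 1 := ⟨hv, hvv'.trans hv'⟩
  have mv' : v' ∈ Set.Icc (0 : ℝ) 1 := ⟨hv.trans hvv', hv'⟩
  have m0 : (0 : ℝ) ∈ Set.Icc (0 : ℝ) 1 := ⟨le_rfl, zero_le_one⟩
  have m1 : (1 : ℝ) ∈ Set.Icc (0 : ℝ) 1 := ⟨zero_le_one, le_rfl⟩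
  have hbelow := hC.two_increasing u mu u' mu' 0 m0 v mv huu' hv
  have habove := hC.two_increasing u mu u' mu' v mv 1 m1 huu' mv.2
  have hleft := hC.two_increasing 0 m0 u' mu' v mv v' mv' mu'.1 hvv'
  have hright := hC.two_increasing u' mu' 1 m1 v mv v' mv' hu' hvv'
  rw [hC.zero_right u mu, hC.zero_right u' mu'] at hbelow
  rw [hC.one_right u mu, hC.one_right u' mu'] at habove
  rw [hC.zero_left v mv, hC.zero_left v' mv'] at hleft
  rw [hC.one_left v mv, hC.one_left v' mv'] at hright
  constructor <;> linarith

lemma jointTail_eq_copula {C : ℝ → ℝ → ℝ} (hC : IsPairCopula ρ s m C) (x y : ℝ) :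
    jointTail ρ s m x y =
      1 - marginalCDF ρ s x - marginalCDF ρ m y + C (marginalCDF ρ s x) (marginalCDF ρ m y) := by
  set A : Set (Fin L → ℝ≥0) := {w | (w s : ℝ) ≤ x}
  set B : Set (Fin L → ℝ≥0) := {w | (w m : ℝ) ≤ y}
  have hA : MeasurableSet A := measurableSet_le (by fun_prop) measurable_const
  have hB : MeasurableSet B := measurableSet_le (by fun_prop) measurable_const
  have hcompl : {w : Fin L → ℝ≥0 | x < (w s : ℝ) ∧ y < (w m : ℝ)} = (A ∪ B)ᶜ := by
    ext w
    simp [A, B]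
  have hunion : ρ.real (A ∪ B) + ρ.real (A ∩ B) = ρ.real A + ρ.real B :=
    measureReal_union_add_inter hB
  rw [jointTail, hcompl, probReal_compl_eq_one_sub (hA.union hB), ← hC.sklar,
    marginalCDF_eq_measureReal, marginalCDF_eq_measureReal]
  change _ = 1 - ρ.real A - ρ.real B + ρ.real (A ∩ B)
  linarith

lemma abs_jointQuantileTail_sub_copula_le {C : ℝ → ℝ → ℝ} (hC : IsPairCopula ρ s m C) {q : ℝ}
    (h0 : 0 ≤ q) (h1 : q < 1) :
    |jointQuantileTail ρ s m q - (1 - 2 * q + C q q)| ≤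
      2 * (1 - q) - (tailFn (margin ρ s) (marginQuantile ρ s q) +
        tailFn (margin ρ m) (marginQuantile ρ m q)) := by
  rw [jointQuantileTail, jointTail_eq_copula hC, marginalCDF_eq, marginalCDF_eq]
  have hs := tailFn_marginQuantile_le (ρ := ρ) s h1
  have hm := tailFn_marginQuantile_le (ρ := ρ) m h1
  have hs0 : 0 ≤ tailFn (margin ρ s) (marginQuantile ρ s q) := measureReal_nonneg
  have hm0 : 0 ≤ tailFn (margin ρ m) (marginQuantile ρ m q) := measureReal_nonneg
  obtain ⟨hlow, hupp⟩ := hC.copula.sub_mem_Icc h0 (le_sub_comm.1 hs) (sub_le_self 1 hs0) h0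
    (le_sub_comm.1 hm) (sub_le_self 1 hm0)
  rw [abs_le]
  constructor <;> linarith

lemma isUTDCoeff_iff_copula (hs : HasRVTail (margin ρ s) α) (hm : HasRVTail (margin ρ m) α)
    (hα : 0 < α) {C : ℝ → ℝ → ℝ} (hC : IsPairCopula ρ s m C) (lam : ℝ) :
    IsUTDCoeff ρ s m lam ↔
      Tendsto (fun q : ℝ => (1 - 2 * q + C q q) / (1 - q)) (𝓝[<] 1) (𝓝 lam) := by
  rw [isUTDCoeff_iff hs hα]
  refine tendsto_iff_of_tendsto_sub_zero ?_
  have htails := ((tendsto_tailFn_marginQuantile hs hα).add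
    (tendsto_tailFn_marginQuantile hm hα)).const_sub 2
  rw [one_add_one_eq_two, sub_self] at htails
  refine squeeze_zero_norm' ?_ htails
  filter_upwards [Ioo_mem_nhdsLT (zero_lt_one' ℝ)] with q ⟨h0, h1⟩
  have hq : 0 < 1 - q := sub_pos.2 h1
  rw [← sub_div, ← add_div, Real.norm_eq_abs, abs_div, abs_of_pos hq, div_le_iff₀ hq, sub_mul,
    div_mul_cancel₀ _ hq.ne']
  exact abs_jointQuantileTail_sub_copula_le hC h0.le h1

lemma gumbel_diag {θ q : ℝ} (hθ : θ ≠ 0) (h0 : 0 < q) (h1 : q ≤ 1) :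
    gumbel θ q q = q ^ ((2 : ℝ) ^ (1 / θ)) := by
  have hlog : 0 ≤ -Real.log q := neg_nonneg.2 (Real.log_nonpos h0.le h1)
  rw [gumbel, if_neg (by simp only [h0.ne', or_self, not_false_eq_true]), ← two_mul,
    Real.mul_rpow two_pos.le (by positivity), ← Real.rpow_mul hlog, mul_one_div_cancel hθ,
    Real.rpow_one, Real.rpow_def_of_pos h0, mul_neg, neg_neg, mul_comm]

/-- By `gumbel_diag` the limit is `2` minus the derivative of `q ↦ q ^ (2 ^ (1 / θ))` at `1`. -/
lemma tendsto_gumbel {θ : ℝ} (hθ : θ ≠ 0) :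
    Tendsto (fun q : ℝ => (1 - 2 * q + gumbel θ q q) / (1 - q)) (𝓝[<] 1)
      (𝓝 (2 - 2 ^ (1 / θ))) := by
  set p : ℝ := (2 : ℝ) ^ (1 / θ)
  have hderiv : HasDerivAt (fun x : ℝ => x ^ p) p 1 := by
    simpa only [Real.one_rpow, mul_one] using Real.hasDerivAt_rpow_const (p := p) (.inl one_ne_zero)
  have hslope := (hderiv.tendsto_slope.mono_left (nhdsLT_le_nhdsNE 1)).const_sub 2
  refine hslope.congr' ?_
  filter_upwards [Ioo_mem_nhdsLT (zero_lt_one' ℝ)] with q ⟨h0, h1⟩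
  have hq : 1 - q ≠ 0 := (sub_pos.2 h1).ne'
  have hq' : q - 1 ≠ 0 := (sub_neg.2 h1).ne
  rw [gumbel_diag hθ h0 h1.le, slope_def_field, Real.one_rpow]
  field_simp
  ring

end TailDependence

section Estimator

lemma card_le_add_card_symmDiff {ι : Type*} [DecidableEq ι] (S S' : Finset ι) :
    S'.card ≤ S.card + (symmDiff S S').card := by
  refine (Finset.card_le_card fun i hi => ?_).trans (Finset.card_union_le S _)
  rw [Finset.mem_union, Finset.mem_symmDiff]
  tauto

lemma abs_card_sub_card_le {ι : Type*} [DecidableEq ι] (S S' : Finset ι) :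
    |(S'.card : ℝ) - S.card| ≤ (symmDiff S S').card := by
  refine abs_sub_le_iff.2 ⟨sub_le_iff_le_add'.2 ?_, sub_le_iff_le_add'.2 ?_⟩
  · exact_mod_cast card_le_add_card_symmDiff S S'
  · rw [symmDiff_comm]
    exact_mod_cast card_le_add_card_symmDiff S' S

lemma card_symmDiff_inter_le {ι : Type*} [DecidableEq ι] (S M S' M' : Finset ι) :
    (symmDiff (S ∩ M) (S' ∩ M')).card ≤ (symmDiff S S').card + (symmDiff M M').card := by
  refine (Finset.card_le_card fun i hi => ?_).trans (Finset.card_union_le _ _)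
  simp only [Finset.mem_symmDiff, Finset.mem_inter, Finset.mem_union] at hi ⊢
  tauto

lemma abs_card_div_sub_card_div_le {ι : Type*} [DecidableEq ι] (S S' : Finset ι) (t : ℕ) :
    |(S'.card : ℝ) / t - S.card / t| ≤ (symmDiff S S').card / t := by
  rw [← sub_div, abs_div, Nat.abs_cast]
  gcongr
  exact abs_card_sub_card_le S S'

lemma abs_card_inter_div_sub_le {ι : Type*} [DecidableEq ι] (S M S' M' : Finset ι) (t : ℕ) :
    |((S' ∩ M').card : ℝ) / t - (S ∩ M).card / t| ≤
      (symmDiff S S').card / t + (symmDiff M M').card / t := by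
  refine (abs_card_div_sub_card_div_le _ _ t).trans ?_
  rw [← add_div]
  gcongr
  exact_mod_cast card_symmDiff_inter_le S M S' M'

open Classical in
lemma utdEstimator_eq {L N t : ℕ} (ht : t ≠ 0) (a : Fin N → Fin N → Fin L → ℕ) (s m : Fin L) :
    utdEstimator a t s m =
      (((exceedances (fun i => (degree a i s : ℝ)) (degreeThreshold a t s) ∩
        exceedances (fun i => (degree a i m : ℝ)) (degreeThreshold a t m)).card : ℝ) / t) /
      ((exceedances (fun i => (degree a i s : ℝ)) (degreeThreshold a t s)).card / t) := by
  rw [div_div_div_cancel_right₀ (Nat.cast_ne_zero.2 ht), exceedances, exceedances,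
    ← Finset.filter_and, utdEstimator]

variable {Ω : Type*} [MeasurableSpace Ω] {μ : Measure Ω} [IsProbabilityMeasure μ] {L : ℕ} {α : ℝ}
  {ρ : Measure (Fin L → ℝ≥0)} [IsProbabilityMeasure ρ] {W : ℕ → Ω → Fin L → ℝ≥0}
  {g : Fin L → ℝ≥0 → ℝ≥0} {A : (N : ℕ) → Fin N → Fin N → Fin L → Ω → ℕ} {t : ℕ → ℕ} {s m : Fin L}
  {lam : ℝ}

open Classical in
lemma tendstoInMeasure_card_joint_exceedances (hlaw : ∀ i, HasLaw (W i) ρ μ)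
    (hind : iIndepFun W μ) (hRV : HasRVTail (margin ρ s) α) (hα : 0 < α)
    (ht : Tendsto t atTop atTop) (htN : Tendsto (fun N : ℕ => (t N : ℝ) / N) atTop (𝓝 0))
    (hlam : IsUTDCoeff ρ s m lam) :
    TendstoInMeasure μ (fun N ω =>
      ((exceedances (fun i : Fin N => (W i ω s : ℝ)) (marginQuantile ρ s (1 - (t N : ℝ) / N)) ∩
        exceedances (fun i : Fin N => (W i ω m : ℝ))
          (marginQuantile ρ m (1 - (t N : ℝ) / N))).card : ℝ) / t N) atTop fun _ => lam := by
  have hcount := tendstoInMeasure_card_mem hlaw hind ht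
    (B := fun N => {w | marginQuantile ρ s (1 - (t N : ℝ) / N) < (w s : ℝ) ∧
      marginQuantile ρ m (1 - (t N : ℝ) / N) < (w m : ℝ)})
    (fun N => measurableSet_jointTail s m _ _)
    (tendsto_comp_level (f := fun q => jointQuantileTail ρ s m q) ht htN
      ((isUTDCoeff_iff hRV hα m lam).1 hlam))
  simpa only [exceedances, ← Finset.filter_and, Set.mem_ofPred_eq] using hcount

theorem tendstoInMeasure_utdEstimator (hW : ∀ i, Measurable (W i))
    (hlaw : ∀ i, HasLaw (W i) ρ μ) (hind : iIndepFun W μ) (hs : HasRVTail (margin ρ s) α)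
    (hm : HasRVTail (margin ρ m) α) (hα : 0 < α) (hg : ∀ l, IsConnectionFun α (g l))
    (hA : ∀ N, IsMIRG μ g (fun i : Fin N => W i) (A N)) (ht : Tendsto t atTop atTop)
    (htN : Tendsto (fun N : ℕ => (t N : ℝ) / N) atTop (𝓝 0)) (hlam : IsUTDCoeff ρ s m lam) :
    TendstoInMeasure μ (fun N ω => utdEstimator (fun i j l => A N i j l ω) (t N) s m) atTop
      fun _ => lam := by
  classical
  have hsymms := tendstoInMeasure_card_symmDiff hW hlaw hind hs hα hg hA ht htN
  have hsymmm := tendstoInMeasure_card_symmDiff hW hlaw hind hm hα hg hA ht htN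
  have hsymm := tendstoInMeasure_add hsymms hsymmm
  rw [add_zero] at hsymm
  have hjoint := tendstoInMeasure_of_abs_sub_le
    (tendstoInMeasure_card_joint_exceedances hlaw hind hs hα ht htN hlam) hsymm
    fun N ω => abs_card_inter_div_sub_le _ _ _ _ _
  have hone := tendstoInMeasure_card_exceedances_mul_marginQuantile hlaw hind hs hα ht htN one_pos
  simp only [one_mul, Real.one_rpow] at hone
  have hsingle := tendstoInMeasure_of_abs_sub_le hone hsymms
    fun N ω => abs_card_div_sub_card_div_le _ _ _
  have hdiv := tendstoInMeasure_div hjoint hsingle one_ne_zero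
  rw [div_one] at hdiv
  refine hdiv.congr' ?_ .rfl
  filter_upwards [ht.eventually_ne_atTop 0] with N hN
  exact .of_forall fun ω => (utdEstimator_eq hN _ s m).symm

end Estimator

section MultivariateRegularVariation

/-- A continuous approximation, from below, of the indicator of the corner
`{z | x < z s ∧ y < z m}`; it is `1` on the corner with apex `(x + η, y + η)`. -/
noncomputable def cornerBump {L : ℕ} (s m : Fin L) (x y η : ℝ≥0) (z : Fin L → ℝ≥0) : ℝ≥0 :=
  min 1 ((z s - x) / η) * min 1 ((z m - y) / η)

/-- The integral of `cornerBump`, a smoothed version of `jointTail`. -/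
noncomputable def smoothJointTail {L : ℕ} (π : Measure (Fin L → ℝ≥0)) (s m : Fin L)
    (x y η : ℝ≥0) : ℝ :=
  (∫⁻ z, (cornerBump s m x y η z : ℝ≥0∞) ∂π).toReal

variable {L : ℕ} {s m : Fin L} {x y η : ℝ≥0} {z : Fin L → ℝ≥0}

lemma continuous_cornerBump : Continuous (cornerBump s m x y η) := by
  unfold cornerBump
  fun_prop

lemma cornerBump_le_one (z : Fin L → ℝ≥0) : cornerBump s m x y η z ≤ 1 :=
  mul_le_one' (min_le_left _ _) (min_le_left _ _)

lemma cornerBump_ne_zero_iff (hη : 0 < η) :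
    cornerBump s m x y η z ≠ 0 ↔ x < z s ∧ y < z m := by
  have hfactor : ∀ a c : ℝ≥0, min 1 ((a - c) / η) ≠ 0 ↔ c < a := fun a c => by
    rw [← pos_iff_ne_zero, lt_min_iff, div_pos_iff_of_pos_right hη, tsub_pos_iff_lt,
      and_iff_right one_pos]
  rw [cornerBump, mul_ne_zero_iff, hfactor, hfactor]

lemma cornerBump_eq_one (hη : 0 < η) (hs : x + η < z s) (hm : y + η < z m) :
    cornerBump s m x y η z = 1 := by
  have hfactor : ∀ {a c : ℝ≥0}, c + η < a → min 1 ((a - c) / η) = 1 := fun h =>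
    min_eq_left ((one_le_div hη).2 (le_tsub_of_add_le_left h.le))
  rw [cornerBump, hfactor hs, hfactor hm, one_mul]

lemma cornerBump_div {c : ℝ≥0} (hc : c ≠ 0) :
    cornerBump s m x y η (fun l => z l / c) = cornerBump s m (x * c) (y * c) (η * c) z := by
  have hfactor : ∀ a d : ℝ≥0, (a / c - d) / η = (a - d * c) / (η * c) := fun a d => by
    rw [mul_comm η, ← div_div, tsub_div a, mul_div_cancel_right₀ _ hc]
  rw [cornerBump, hfactor, hfactor, cornerBump]

lemma isMTest_cornerBump (hx : 0 < x) (hη : 0 < η) : IsMTest (cornerBump s m x y η) where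
  continuousOn := continuous_cornerBump.continuousOn
  bounded := ⟨1, cornerBump_le_one⟩
  away := ⟨x, hx, fun z hz => by
    have hxs : (x : ℝ) < dist (z s) 0 := by
      rw [NNReal.dist_eq, NNReal.coe_zero, sub_zero, NNReal.abs_eq]
      exact ((cornerBump_ne_zero_iff hη).1 hz).1
    exact hxs.le.trans (dist_le_pi_dist z 0 s)⟩

lemma measurableSet_corner (s m : Fin L) (x y : ℝ≥0) :
    MeasurableSet {z : Fin L → ℝ≥0 | x < z s ∧ y < z m} :=
  measurableSet_jointTail s m x y

section Measure

variable {π : Measure (Fin L → ℝ≥0)}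

lemma lintegral_cornerBump_le (hη : 0 < η) :
    ∫⁻ z, (cornerBump s m x y η z : ℝ≥0∞) ∂π ≤ π {z | x < z s ∧ y < z m} := by
  rw [← lintegral_indicator_one (measurableSet_corner s m x y)]
  refine lintegral_mono fun z => ?_
  by_cases hz : cornerBump s m x y η z = 0
  · simp only [hz, ENNReal.coe_zero, zero_le]
  · rw [Set.indicator_of_mem (Set.mem_ofPred_eq ▸ (cornerBump_ne_zero_iff hη).1 hz)]
    exact ENNReal.coe_le_one_iff.2 (cornerBump_le_one z)

lemma measure_corner_le_lintegral_cornerBump (hη : 0 < η) :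
    π {z | x + η < z s ∧ y + η < z m} ≤ ∫⁻ z, (cornerBump s m x y η z : ℝ≥0∞) ∂π := by
  rw [← lintegral_indicator_one (measurableSet_corner s m (x + η) (y + η))]
  refine lintegral_mono (Set.indicator_le fun z hz => ?_)
  rw [cornerBump_eq_one hη hz.1 hz.2, Pi.one_apply, ENNReal.coe_one]

lemma jointTail_le_smoothJointTail [IsFiniteMeasure π] (hη : 0 < η) :
    jointTail π s m (x + η) (y + η) ≤ smoothJointTail π s m x y η :=
  ENNReal.toReal_mono (ne_top_of_le_ne_top (measure_ne_top _ _) (lintegral_cornerBump_le hη))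
    (measure_corner_le_lintegral_cornerBump hη)

lemma smoothJointTail_le_jointTail [IsFiniteMeasure π] (hη : 0 < η) :
    smoothJointTail π s m x y η ≤ jointTail π s m x y :=
  ENNReal.toReal_mono (measure_ne_top _ _) (lintegral_cornerBump_le hη)

end Measure

variable {ν : Measure (Fin L → ℝ≥0)}

lemma IsMMeasure.lintegral_cornerBump_ne_top (hν : IsMMeasure ν) (hx : 0 < x) (hη : 0 < η) :
    ∫⁻ z, (cornerBump s m x y η z : ℝ≥0∞) ∂ν ≠ ∞ := by
  obtain ⟨r, hr, haway⟩ := (isMTest_cornerBump (s := s) (m := m) (y := y) hx hη).away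
  have hcorner : {z : Fin L → ℝ≥0 | x < z s ∧ y < z m} ⊆ {z | r ≤ dist z 0} :=
    fun z hz => haway z ((cornerBump_ne_zero_iff hη).2 hz)
  exact ((lintegral_cornerBump_le hη).trans_lt
    ((measure_mono hcorner).trans_lt (hν.finite_away r hr))).ne

lemma IsMMeasure.smoothJointTail_pos (hν : IsMMeasure ν) (hx : 0 < x) (hη : 0 < η)
    (hpos : ν {z | x < z s ∧ y < z m} ≠ 0) : 0 < smoothJointTail ν s m x y η := by
  refine ENNReal.toReal_pos ?_ (hν.lintegral_cornerBump_ne_top hx hη)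
  rw [← pos_iff_ne_zero,
    lintegral_pos_iff_support continuous_cornerBump.measurable.coe_nnreal_ennreal, pos_iff_ne_zero]
  convert hpos using 2
  ext z
  rw [Function.mem_support, ENNReal.coe_ne_zero, cornerBump_ne_zero_iff hη, Set.mem_ofPred_eq]

variable {ρ : Measure (Fin L → ℝ≥0)} {α : ℝ} {b : ℝ≥0 → ℝ≥0}

lemma IsMRV.tendsto_smoothJointTail (h : IsMRV ρ α b ν) (s m : Fin L) (y : ℝ≥0) (hx : 0 < x)
    (hη : 0 < η) :
    Tendsto (fun t : ℝ≥0 => t * smoothJointTail ρ s m (x * b t) (y * b t) (η * b t)) atTop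
      (𝓝 (smoothJointTail ν s m x y η)) := by
  refine ((ENNReal.tendsto_toReal (h.limit.lintegral_cornerBump_ne_top hx hη)).comp
    (h.tendsto _ (isMTest_cornerBump hx hη))).congr' ?_
  filter_upwards [h.scaling.eventually_pos] with t hb
  simp only [Function.comp_apply, cornerBump_div hb.ne', ENNReal.toReal_mul, ENNReal.coe_toReal,
    smoothJointTail]

lemma jointTail_self (ρ : Measure (Fin L → ℝ≥0)) (s : Fin L) (x : ℝ) :
    jointTail ρ s s x x = tailFn (margin ρ s) x := by
  simp only [jointTail, and_self, tailFn_margin]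

variable [IsProbabilityMeasure ρ]

lemma IsMRV.exists_eventually_tail_scaling_le (h : IsMRV ρ α b ν) (s : Fin L) :
    ∃ H > (0 : ℝ), ∀ᶠ t : ℝ≥0 in atTop, t * tailFn (margin ρ s) (b t) ≤ H := by
  have hhalf : (0 : ℝ≥0) < 1 / 2 := by positivity
  refine ⟨smoothJointTail ν s s (1 / 2) (1 / 2) (1 / 2) + 1,
    add_pos_of_nonneg_of_pos ENNReal.toReal_nonneg one_pos, ?_⟩
  filter_upwards [h.scaling.eventually_pos, (h.tendsto_smoothJointTail s s (1 / 2) hhalf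
    hhalf).eventually (ge_mem_nhds (lt_add_one _))] with t hb ht
  have hbump := jointTail_le_smoothJointTail (π := ρ) (s := s) (m := s) (x := 1 / 2 * b t)
    (y := 1 / 2 * b t) (mul_pos hhalf hb)
  rw [← NNReal.coe_add, ← add_mul, add_halves, one_mul, jointTail_self] at hbump
  exact (mul_le_mul_of_nonneg_left hbump t.coe_nonneg).trans ht

lemma IsMRV.tendsto_scaling_atTop (h : IsMRV ρ α b ν) (hs : HasRVTail (margin ρ s) α) :
    Tendsto (fun t => (b t : ℝ)) atTop atTop := by
  obtain ⟨H, -, hH⟩ := h.exists_eventually_tail_scaling_le s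
  refine tendsto_atTop.2 fun K => ?_
  filter_upwards [hH, (NNReal.tendsto_coe_atTop.2 tendsto_id).eventually_gt_atTop
    (H / tailFn (margin ρ s) K)] with t hle hgt
  by_contra! hlt
  rw [div_lt_iff₀ (hs.pos _)] at hgt
  exact (hgt.trans_le (mul_le_mul_of_nonneg_left (tailFn_antitone hlt.le) t.coe_nonneg)).not_ge hle

lemma IsMRV.tendsto_tail_ratio (h : IsMRV ρ α b ν) (hs : HasRVTail (margin ρ s) α) (hx : 0 < x) :
    Tendsto (fun t => tailFn (margin ρ s) (x * b t) / tailFn (margin ρ s) (b t)) atTop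
      (𝓝 ((x : ℝ) ^ (-α))) := by
  simpa only [Function.comp_def, mul_comm] using
    (hs.tendsto x hx).comp (h.tendsto_scaling_atTop hs)

lemma IsMRV.eventually_strip_le (h : IsMRV ρ α b ν) (hs : HasRVTail (margin ρ s) α)
    (hx : 0 < x) {e : ℝ} (he : 0 < e) :
    ∀ᶠ η : ℝ≥0 in 𝓝[>] 0, ∀ᶠ t : ℝ≥0 in atTop,
      t * |tailFn (margin ρ s) (x * b t) - tailFn (margin ρ s) ((x + η : ℝ≥0) * b t)| ≤ e := by
  obtain ⟨H, hH, hbound⟩ := h.exists_eventually_tail_scaling_le s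
  have hcont : Tendsto (fun η : ℝ≥0 => |(x : ℝ) ^ (-α) - ((x + η : ℝ≥0) : ℝ) ^ (-α)|) (𝓝[>] 0)
      (𝓝 |(x : ℝ) ^ (-α) - ((x + 0 : ℝ≥0) : ℝ) ^ (-α)|) := by
    have hadd : Tendsto (fun η : ℝ≥0 => ((x + η : ℝ≥0) : ℝ)) (𝓝[>] 0) (𝓝 ((x + 0 : ℝ≥0) : ℝ)) :=
      (by fun_prop : Continuous fun η : ℝ≥0 => ((x + η : ℝ≥0) : ℝ)).continuousWithinAt
    exact (tendsto_const_nhds.sub (hadd.rpow_const (.inl (by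
      simpa only [add_zero, NNReal.coe_ne_zero] using hx.ne')))).abs
  rw [add_zero, sub_self, abs_zero] at hcont
  filter_upwards [hcont.eventually (gt_mem_nhds (div_pos he hH))] with η hη
  have hratio := ((h.tendsto_tail_ratio hs hx).sub
    (h.tendsto_tail_ratio hs (add_pos_of_pos_of_nonneg hx (zero_le (a := η))))).abs
  filter_upwards [hbound, hratio.eventually (gt_mem_nhds hη)] with t hle hlt
  have hpos := hs.pos (b t)
  rw [← sub_div, abs_div, abs_of_pos hpos, div_lt_iff₀ hpos] at hlt
  calc (t : ℝ) * _ ≤ t * (e / H * tailFn (margin ρ s) (b t)) := by gcongr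
    _ = e / H * (t * tailFn (margin ρ s) (b t)) := by ring
    _ ≤ e / H * H := by gcongr
    _ = e := div_mul_cancel₀ _ hH.ne'

lemma exists_tendsto_of_forall_eventually_le {ι : Type*} {l : Filter ι} [l.NeBot] {f : ι → ℝ}
    (h : ∀ e : ℝ, 0 < e → ∃ i : ℝ, ∀ᶠ t in l, |f t - i| ≤ e) : ∃ a, Tendsto f l (𝓝 a) := by
  refine cauchy_map_iff_exists_tendsto.1 (Metric.cauchy_iff.2 ⟨inferInstance, fun ε hε => ?_⟩)
  obtain ⟨i, hi⟩ := h (ε / 3) (by positivity)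
  refine ⟨f '' {t | |f t - i| ≤ ε / 3}, image_mem_map hi, ?_⟩
  rintro _ ⟨t, ht, rfl⟩ _ ⟨t', ht', rfl⟩
  rw [Set.mem_ofPred_eq] at ht ht'
  rw [abs_sub_comm] at ht'
  rw [Real.dist_eq]
  linarith [abs_sub_le (f t) i (f t')]

lemma IsMRV.exists_tendsto_jointTail (h : IsMRV ρ α b ν) (hs : HasRVTail (margin ρ s) α)
    (hm : HasRVTail (margin ρ m) α) (hx : 0 < x) (hy : 0 < y) :
    ∃ a, Tendsto (fun t : ℝ≥0 => t * jointTail ρ s m (x * b t) (y * b t)) atTop (𝓝 a) := by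
  refine exists_tendsto_of_forall_eventually_le fun e he => ?_
  obtain ⟨η, ⟨hstrips, hstripm⟩, hη : 0 < η⟩ := (((h.eventually_strip_le hs hx
    (show 0 < e / 3 by positivity)).and (h.eventually_strip_le hm hy
      (show 0 < e / 3 by positivity))).and self_mem_nhdsWithin).exists
  refine ⟨smoothJointTail ν s m x y η, ?_⟩
  filter_upwards [hstrips, hstripm, h.scaling.eventually_pos,
    (h.tendsto_smoothJointTail s m y hx hη).eventually
      (Metric.closedBall_mem_nhds _ (show 0 < e / 3 by positivity))] with t hts htm hb hsmooth
  have hηb : 0 < η * b t := mul_pos hη hb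
  have hlow := mul_le_mul_of_nonneg_left
    (jointTail_le_smoothJointTail (π := ρ) (s := s) (m := m) (x := x * b t) (y := y * b t) hηb)
    t.coe_nonneg
  have hupp := mul_le_mul_of_nonneg_left
    (smoothJointTail_le_jointTail (π := ρ) (s := s) (m := m) (x := x * b t) (y := y * b t) hηb)
    t.coe_nonneg
  have hdiff := mul_le_mul_of_nonneg_left (jointTail_sub_le (ρ := ρ) s m (x * b t) (y * b t)
    ((x + η : ℝ≥0) * b t) ((y + η : ℝ≥0) * b t)) t.coe_nonneg
  simp only [NNReal.coe_mul, NNReal.coe_add, add_mul, mul_add, mul_sub] at hlow hupp hdiff hts htm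
  obtain ⟨hclose, hclose'⟩ := abs_le.1 (Real.dist_eq _ _ ▸ hsmooth)
  rw [abs_le]
  constructor <;> linarith

lemma IsMRV.exists_tendsto_tail_one (h : IsMRV ρ α b ν) (hα : 0 < α)
    (hs : HasRVTail (margin ρ s) α) (hν : ν {x | 1 < x s} ≠ 0) :
    ∃ x : ℝ≥0, 0 < x ∧
      Tendsto (fun t : ℝ≥0 => t * tailFn (margin ρ s) (x * b t)) atTop (𝓝 1) := by
  obtain ⟨c, hc⟩ := h.exists_tendsto_jointTail hs hs one_pos one_pos
  have hbump : 0 < smoothJointTail ν s s 1 1 1 :=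
    h.limit.smoothJointTail_pos one_pos one_pos (by simpa only [and_self] using hν)
  have hcpos : 0 < c := hbump.trans_le (le_of_tendsto_of_tendsto
    (h.tendsto_smoothJointTail s s 1 one_pos one_pos) hc (by
      filter_upwards [h.scaling.eventually_pos] with t hb
      exact mul_le_mul_of_nonneg_left (by
        simpa only [NNReal.coe_mul] using
          smoothJointTail_le_jointTail (x := 1 * b t) (y := 1 * b t) (mul_pos one_pos hb))
        t.coe_nonneg))
  simp only [NNReal.coe_one, one_mul, jointTail_self] at hc
  have hx : 0 < c ^ (1 / α) := by positivity
  refine ⟨(c ^ (1 / α)).toNNReal, Real.toNNReal_pos.2 hx, ?_⟩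
  have hlim := hc.mul (h.tendsto_tail_ratio hs (Real.toNNReal_pos.2 hx))
  rw [Real.coe_toNNReal _ hx.le, ← Real.rpow_mul hcpos.le, mul_neg, one_div_mul_cancel hα.ne',
    Real.rpow_neg_one, mul_inv_cancel₀ hcpos.ne'] at hlim
  refine hlim.congr fun t => ?_
  rw [Real.coe_toNNReal _ hx.le, mul_assoc, mul_div_cancel₀ _ (hs.pos _).ne']

lemma tendsto_toNNReal_inv_one_sub :
    Tendsto (fun q : ℝ => (1 - q)⁻¹.toNNReal) (𝓝[<] 1) atTop := by
  have hsub : Tendsto (fun q : ℝ => 1 - q) (𝓝[<] 1) (𝓝[>] 0) := by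
    have hcont : ContinuousWithinAt (fun q : ℝ => 1 - q) (Set.Iio 1) 1 := by fun_prop
    have hmaps : Set.MapsTo (fun q : ℝ => 1 - q) (Set.Iio 1) (Set.Ioi 0) :=
      fun q (hq : q < 1) => (sub_pos.2 hq : 0 < 1 - q)
    simpa only [sub_self] using hcont.tendsto_nhdsWithin hmaps
  exact tendsto_real_toNNReal_atTop.comp (tendsto_inv_nhdsGT_zero.comp hsub)

theorem IsMRV.exists_isUTDCoeff (h : IsMRV ρ α b ν) (hα : 0 < α) (hs : HasRVTail (margin ρ s) α)
    (hm : HasRVTail (margin ρ m) α) (hνs : ν {x | 1 < x s} ≠ 0) (hνm : ν {x | 1 < x m} ≠ 0) :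
    ∃ lam : ℝ, IsUTDCoeff ρ s m lam := by
  obtain ⟨x, hx, hxlim⟩ := h.exists_tendsto_tail_one hα hs hνs
  obtain ⟨y, hy, hylim⟩ := h.exists_tendsto_tail_one hα hm hνm
  obtain ⟨lam, hlam⟩ := h.exists_tendsto_jointTail hs hm hx hy
  have hT := tendsto_toNNReal_inv_one_sub
  refine ⟨lam, (isUTDCoeff_iff hs hα m lam).2
    ((tendsto_iff_of_tendsto_sub_zero ?_).2 (hlam.comp hT))⟩
  have htails := (((tendsto_tailFn_marginQuantile hs hα).sub (hxlim.comp hT)).abs).add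
    ((tendsto_tailFn_marginQuantile hm hα).sub (hylim.comp hT)).abs
  simp only [sub_self, abs_zero, add_zero] at htails
  refine squeeze_zero_norm' ?_ htails
  filter_upwards [self_mem_nhdsWithin] with q (hq : q < 1)
  have hr : 0 < (1 - q)⁻¹ := inv_pos.2 (sub_pos.2 hq)
  simp only [Function.comp_apply, Real.coe_toNNReal _ hr.le, div_eq_inv_mul, ← mul_sub,
    Real.norm_eq_abs, abs_mul, abs_of_pos hr, ← mul_add]
  exact mul_le_mul_of_nonneg_left (abs_jointTail_sub_le s m _ _ _ _) hr.le

end MultivariateRegularVariation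

theorem corollary3p2 {Ω : Type*} [MeasurableSpace Ω] (μ : Measure Ω) [IsProbabilityMeasure μ]
    {L : ℕ} (α : ℝ) (hα : 0 < α)
    -- the law of the weight vector, with regularly varying margins and multivariate regular variation
    (ρ : Measure (Fin L → ℝ≥0)) [IsProbabilityMeasure ρ]
    (b : ℝ≥0 → ℝ≥0) (ν : Measure (Fin L → ℝ≥0)) (hMRV : IsMRV ρ α b ν)
    (hmarg : ∀ l, IsRegularlyVarying (marginalTail ρ l) (-α))
    -- the i.i.d. weights
    (W : ℕ → Ω → Fin L → ℝ≥0) (hWmeas : ∀ i, Measurable (W i)) (hWind : iIndepFun W μ)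
    (hWlaw : ∀ i, μ.map (W i) = ρ)
    -- the random graphs
    (g : Fin L → ℝ≥0 → ℝ≥0) (hg : ∀ l, IsConnectionFun α (g l))
    (A : (N : ℕ) → Fin N → Fin N → Fin L → Ω → ℕ)
    (hA : ∀ N, IsMIRG μ g (fun i : Fin N => W i) (A N))
    -- the intermediate sequence
    (t : ℕ → ℕ) (ht : Tendsto t atTop atTop)
    (htN : Tendsto (fun N : ℕ => (t N : ℝ) / N) atTop (𝓝 0))
    -- two layers and their copula
    (s m : Fin L) (C : ℝ → ℝ → ℝ) (hC : IsPairCopula ρ s m C) :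
    (∀ lam : ℝ,
      (IsUTDCoeff ρ s m lam ↔
        Tendsto (fun q : ℝ => (1 - 2 * q + C q q) / (1 - q)) (𝓝[<] 1) (𝓝 lam)) ∧
      (IsUTDCoeff ρ s m lam →
        TendstoInMeasure μ
          (fun N ω => utdEstimator (fun i j l => A N i j l ω) (t N) s m) atTop (fun _ => lam))) ∧
    (ν {x | 1 < x s} ≠ 0 → ν {x | 1 < x m} ≠ 0 → ∃ lam : ℝ, IsUTDCoeff ρ s m lam) ∧
    (∀ θ : ℝ, 1 ≤ θ →
      (∀ u ∈ Set.Icc (0 : ℝ) 1, ∀ v ∈ Set.Icc (0 : ℝ) 1, C u v = gumbel θ u v) →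
      IsUTDCoeff ρ s m (2 - 2 ^ (1 / θ)) ∧
        TendstoInMeasure μ
          (fun N ω => utdEstimator (fun i j l => A N i j l ω) (t N) s m) atTop
          (fun _ => 2 - 2 ^ (1 / θ))) := by
  have hRV : ∀ l, HasRVTail (margin ρ l) α := fun l => hasRVTail_margin (hmarg l)
  have hlaw : ∀ i, HasLaw (W i) ρ μ := fun i => ⟨(hWmeas i).aemeasurable, hWlaw i⟩
  have hcopula := isUTDCoeff_iff_copula (hRV s) (hRV m) hα hC
  have hconsistent : ∀ lam, IsUTDCoeff ρ s m lam → TendstoInMeasure μ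
      (fun N ω => utdEstimator (fun i j l => A N i j l ω) (t N) s m) atTop (fun _ => lam) :=
    fun _ => tendstoInMeasure_utdEstimator hWmeas hlaw hWind (hRV s) (hRV m) hα hg hA ht htN
  refine ⟨fun lam => ⟨hcopula lam, hconsistent lam⟩,
    hMRV.exists_isUTDCoeff hα (hRV s) (hRV m), fun θ hθ hgumbel => ?_⟩
  have hlim : IsUTDCoeff ρ s m (2 - 2 ^ (1 / θ)) := by
    refine (hcopula _).2 ((tendsto_gumbel (zero_lt_one.trans_le hθ).ne').congr' ?_)
    filter_upwards [Ioo_mem_nhdsLT (zero_lt_one' ℝ)] with q ⟨h0, h1⟩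
    rw [hgumbel q ⟨h0.le, h1.le⟩ q ⟨h0.le, h1.le⟩]
  exact ⟨hlim, hconsistent _ hlim⟩
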